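/- **Setting.** Fix $N\ge 1$ and the periodic lattice $\Lambda=(\mathbb Z/N)^4$. An $r$-form is a function $\alpha_{x,\mu_1\cdots\mu_r}$ of a site $x$ and $r$ directions, antisymmetric in the directions; sums over its components run over $\mu_1<\cdots<\mu_r$, and $\alpha\cdot\beta$ is the corresponding inner product. Put $(d\alpha)_{x,\mu_1\cdots\mu_{r+1}}=\sum_j(-1)^{j+1}[\alpha_{x+\hat\mu_j,\mu_1\cdots\mathring\mu_j\cdots\mu_{r+1}}-\alpha_{x,\mu_1\cdots\mathring\mu_j\cdots\mu_{r+1}}]$ and $(\partial\alpha)_{x,\mu_1\cdots\mu_r}=\sum_\nu[\alpha_{x,\mu_1\cdots\mu_r\nu}-\alpha_{x-\hat\nu,\mu_1\cdots\mu_r\nu}]$. The cup product of a $p$-form and a $q$-form is $(\alpha\cup\beta)_{x,\mu_1\cdots\mu_{p+q}}=\frac1{p!q!}\sum_\sigma\epsilon_\sigma\,\alpha_{x,\mu_{\sigma(1)}\cdots\mu_{\sigma(p)}}\,\beta_{x+\hat\mu_{\sigma(1)}+\cdots+\hat\mu_{\sigma(p)},\mu_{\sigma(p+1)}\cdots\mu_{\sigma(p+q)}}$,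 and $(\alpha\cup_1\beta)_{x,\mu_1\cdots\mu_{p+q-1}}=(-1)^q\sum_a(-1)^a\,P_{\mu_a}(P_{\mu_a}\iota_{\mu_a}\alpha\cup P_{\mu_a}\iota_{\mu_a}\beta)_{x,\mu_1\cdots\mathring\mu_a\cdots\mu_{p+q-1}}$ for $\mu_1<\mu_2<\cdots$, where $(\iota_\mu\alpha)_{x,\mu_1\cdots}=\alpha_{x,\mu\mu_1\cdots}$ and $P_\mu$ is the action on forms of the reflection of all coordinates $x_\nu$ with $\nu\ge\mu$. Let $P_\partial$ be the orthogonal projection of real 2-forms onto the image of $\partial$, and for an integer-valued 2-form $n$ let $\mathfrak P(n)=\sum_x(n\cup n+n\cup_1dn)$. For real $\beta>0$ and $\theta$, a real 1-form $A^e$, a real 3-form $A^m$ and an integer-valued 2-form $n$, let $F^e=dA^e+2\pi n$, $Q_0=\frac1{8\pi^2}\sum_xF^e\cup F^e$, $Q=\sum_x\big(\frac1{8\pi^2}F^e\cup F^e+\frac1{4\pi}F^e\cup_1dn\big)$. Let $\int DA^e\,DA^m$ be the integral over all components in $[-\pi,\pi)$ with measure $\frac{dA}{2\pi}$ for each component,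 and $$Z[\beta,\theta]=\int DA^e\,DA^m\sum_n\exp\Big(-\tfrac\beta2F^e\cdot F^e-i\theta Q_0+\tfrac i{2\pi}\,\partial A^m\cdot F^e\Big).$$ For a contour $\gamma$ (a closed path along oriented links) let $\dot\gamma_{x,\mu}$ be the net number of times $\gamma$ traverses the link $(x,\mu)$. For integers $q_e,q_m$ and $p$, the expectation value of the dyonic Wilson loop $W_d^{(q_e,q_m)}(\gamma)=\exp\big(i\sum_x(q_e\dot\gamma A^e-q_m\dot\gamma\cup A^m)\big)$ is $$\langle W_d^{(q_e,q_m)}(\gamma)\rangle^p_{\beta,\theta}=\frac1{Z[\beta,\theta]}\int DA^e\,DA^m\sum_n\exp\Big(-\tfrac\beta2F^e\cdot F^e-i\theta Q+\tfrac i{2\pi}\,\partial A^m\cdot F^e-ip\pi\,\mathfrak P(n)\Big)\,W_d^{(q_e,q_m)}(\gamma).$$ **Theorem.** For $\beta>0$ these integrals and sums converge and $Z[\beta,\theta]\ne0$. Let $\gamma$ be a contractible contour. There is an integer-valued 2-form $l$ with $\sum_{\nu<\rho<\sigma}\epsilon_{\mu\nu\rho\sigma}(dl)_{x+\hat\mu,\nu\rho\sigma}=-\dot\gamma_{x,\mu}$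 for all $x,\mu$. For every such $l$ set $u=\sum_xP_\partial l\cup_1dP_\partial l\in\mathbb R$ and $v=\mathfrak P(l)\in\mathbb Z$; then $u$ and the parity of $v$ do not depend on the choice of $l$. For $\tau=\frac\theta{2\pi}+2\pi i\beta$, $q=q_e+\tau q_m$ with $q_e,q_m\in\mathbb Z$, and $\alpha_1,\alpha_2\in\frac12\mathbb Z$ define $$F\begin{bmatrix}\alpha_1\\\alpha_2\end{bmatrix}(q,\tau)=e^{2\pi^2u\beta q_m^2}(-1)^{2\alpha_1vq_e^2}\langle W_d^{(q_e,q_m)}(\gamma)\rangle^{p=2\alpha_2}_{\beta,\theta}.$$ 1. Also $F\begin{bmatrix}\alpha_1\\\alpha_2\end{bmatrix}(q,\tau)=e^{2\pi^2u\beta q_m^2}(-1)^{2\alpha_1vq_e^2+2\alpha_2vq_m^2}\langle W_d^{(q_e,q_m)}(\gamma)\rangle^{p=0}_{\beta,\theta}$, and $F$ depends on $\alpha_1,\alpha_2$ only modulo $\mathbb Z$. 2. $F\begin{bmatrix}\alpha_1\\\alpha_2\end{bmatrix}\big(\tfrac q\tau,-\tfrac1\tau\big)=e^{iu\pi q^2/\tau}\,F\begin{bmatrix}\alpha_2\\-\alpha_1\end{bmatrix}(q,\tau)$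 and $F\begin{bmatrix}\alpha_1\\\alpha_2\end{bmatrix}(q,\tau+1)=F\begin{bmatrix}\alpha_1\\\alpha_1+\alpha_2+\frac12\end{bmatrix}(q,\tau)$. 3. The formula $M(q,\tau)=\big(\frac q{c\tau+d},\frac{a\tau+b}{c\tau+d}\big)$, $M=\begin{pmatrix}a&b\\c&d\end{pmatrix}\in SL(2,\mathbb Z)$, defines an action on pairs with $\operatorname{Im}\tau>0$, which maps the charges $(q_e,q_m)$ to $(aq_e-bq_m,-cq_e+dq_m)$; $e(M,(q,\tau))=\exp\big(iu\pi\frac{cq^2}{c\tau+d}\big)$ satisfies $e(M_1M_2,z)=e(M_1,M_2z)\,e(M_2,z)$; and for all $M$ $$F\begin{bmatrix}\alpha_1\\\alpha_2\end{bmatrix}(M(q,\tau))=e(M,(q,\tau))\;F\begin{bmatrix}a\alpha_1+c\alpha_2+\frac{ac}2\\b\alpha_1+d\alpha_2+\frac{bd}2\end{bmatrix}(q,\tau).$$ 4. The map $(\alpha_1,\alpha_2)\mapsto(a\alpha_1+c\alpha_2+\frac{ac}2,\,b\alpha_1+d\alpha_2+\frac{bd}2)$ is a right action of $SL(2,\mathbb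 Z)$ on $(\frac12\mathbb Z/\mathbb Z)^2$. It factors through the surjective reduction $SL(2,\mathbb Z)\to SL(2,\mathbb Z_2)\cong\mathfrak S_3$. Its orbits are $\{(\frac12,\frac12)\}$ and $\{(0,0),(0,\frac12),(\frac12,0)\}$, and $SL(2,\mathbb Z_2)$ acts on the latter as its full permutation group. 5. If $v$ is even, the functions $F\begin{bmatrix}\alpha_1\\\alpha_2\end{bmatrix}$ for all $\alpha_1,\alpha_2\in\frac12\mathbb Z$ coincide. -/

import Mathlib

open Complex MeasureTheory
open scoped Real BigOperators

noncomputable section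

namespace LatticeMaxwell

/-! ### Differential forms on the periodic hypercubic lattice -/

/-- Sites of the four-dimensional periodic lattice with `N` sites in each direction. -/
abbrev Site (N : ℕ) : Type := Fin 4 → ZMod N

/-- An `r`-cell: a site together with `r` directions `μ₁ < ⋯ < μᵣ`, recorded as a set. -/
abbrev Cell (N r : ℕ) : Type := Site N × {S : Finset (Fin 4) // S.card = r}

/-- `K`-valued `r`-forms, given by their independent components `α_{x, μ₁⋯μᵣ}`, `μ₁ < ⋯ < μᵣ`. -/
abbrev Form (N r : ℕ) (K : Type) : Type := Cell N r → K

/-- The site `∑_{μ ∈ S} μ̂`. -/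
def hat {N : ℕ} (S : Finset (Fin 4)) : Site N := fun μ => if μ ∈ S then 1 else 0

/-- The sign of the permutation that sorts the concatenation of the increasing lists of `A` and `B`
(for disjoint `A`, `B`). Hence, for an antisymmetric form, the component with indices "`A` followed
by `B`" is `shuffleSign A B` times the component of `A ∪ B`, and `shuffleSign A Aᶜ` is the
Levi-Civita symbol `ε_{A Aᶜ}`. -/
def shuffleSign (A B : Finset (Fin 4)) : ℤ :=
  (-1) ^ ((A ×ˢ B).filter fun p => p.2 < p.1).card

section Forms

variable {N : ℕ} {K : Type} [CommRing K]

/-- The component of `α` at the site `x` and the increasing list of directions of `S`. -/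
def comp {r : ℕ} (α : Form N r K) (x : Site N) (S : Finset (Fin 4)) : K :=
  if h : S.card = r then α (x, ⟨S, h⟩) else 0

/-- The exterior derivative. -/
def extd {r : ℕ} (α : Form N r K) : Form N (r + 1) K := fun c =>
  ∑ μ ∈ c.2.1, (shuffleSign {μ} (c.2.1.erase μ) : K) *
    (comp α (c.1 + hat {μ}) (c.2.1.erase μ) - comp α c.1 (c.2.1.erase μ))

/-- The boundary operator `(∂α)_{x,S} = ∑_ν (α_{x,Sν} - α_{x-ν̂,Sν})`. -/
def bdry {r : ℕ} (α : Form N (r + 1) K) : Form N r K := fun c =>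
  ∑ ν ∈ (c.2.1)ᶜ, (shuffleSign c.2.1 {ν} : K) *
    (comp α c.1 (insert ν c.2.1) - comp α (c.1 - hat {ν}) (insert ν c.2.1))

/-- The cup product. -/
def cup {p q : ℕ} (α : Form N p K) (β : Form N q K) : Form N (p + q) K := fun c =>
  ∑ A ∈ c.2.1.powersetCard p, (shuffleSign A (c.2.1 \ A) : K) *
    (comp α c.1 A * comp β (c.1 + hat A) (c.2.1 \ A))

/-- The interior product `(ι_μ α)_{x,S} = α_{x,μS}`. -/
def contract {r : ℕ} (μ : Fin 4) (α : Form N (r + 1) K) : Form N r K := fun c =>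
  if μ ∈ c.2.1 then 0 else (shuffleSign {μ} c.2.1 : K) * comp α c.1 (insert μ c.2.1)

/-- The reflection of the coordinates `ν ≥ μ` of a site. -/
def reflect (μ : Fin 4) (x : Site N) : Site N := fun ν => if μ ≤ ν then -x ν else x ν

/-- The action of the reflection `reflect μ` on forms: a direction `ν ≥ μ` is turned into `-ν`,
and the cell based at `x` in direction `-ν` is minus the cell based at `x - ν̂` in direction `ν`. -/
def parity {r : ℕ} (μ : Fin 4) (α : Form N r K) : Form N r K := fun c =>
  (-1) ^ (c.2.1.filter fun ν => μ ≤ ν).card *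
    comp α (reflect μ c.1 - hat (c.2.1.filter fun ν => μ ≤ ν)) c.2.1

/-- The higher cup product `∪₁` of a `(p+1)`-form and a `(q+1)`-form: the sum over the positions
`a = 1, 2, …` of the directions `μ = μ_a` of the cell, with sign `(-1)^(q+1) (-1)^a`, of
`P_μ (P_μ ι_μ α ∪ P_μ ι_μ β)`. -/
def cup₁ {p q : ℕ} (α : Form N (p + 1) K) (β : Form N (q + 1) K) : Form N (p + q + 1) K := fun c =>
  (-1) ^ (q + 1) * ∑ μ ∈ c.2.1, (-1) ^ ((c.2.1.filter fun ν => ν < μ).card + 1) *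
    comp (parity μ (cup (parity μ (contract μ α)) (parity μ (contract μ β)))) c.1 (c.2.1.erase μ)

end Forms

section Sums

variable {N : ℕ} [NeZero N]

/-- The sum of a 4-form over the lattice. -/
def latticeSum {K : Type} [CommRing K] (ω : Form N 4 K) : K := ∑ x : Site N, comp ω x Finset.univ

/-- The inner product of two `r`-forms. -/
def dot {r : ℕ} {K : Type} [CommRing K] (α β : Form N r K) : K := ∑ c, α c * β c

/-- An integer-valued form, regarded as a real-valued form. -/
def toReal {r : ℕ} (n : Form N r ℤ) : Form N r ℝ := fun c => (n c : ℝ)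

/-- The subspace `Im(∂⁽³⁾)` of the Euclidean space of real 2-forms (`∂` is linear, so the span is
just the image). -/
def coexact (N : ℕ) [NeZero N] : Submodule ℝ (EuclideanSpace ℝ (Cell N 2)) :=
  Submodule.span ℝ (Set.range fun β : Form N 3 ℝ => WithLp.toLp 2 (bdry β))

/-- The orthogonal projection `P_∂` of real 2-forms onto `Im(∂⁽³⁾)`. -/
def coexactProj (α : Form N 2 ℝ) : Form N 2 ℝ :=
  WithLp.ofLp ((coexact N).starProjection (WithLp.toLp 2 α))

/-- The Pontryagin square `𝔓(n) = ∑ₓ (n ∪ n + n ∪₁ dn)` of an integer-valued 2-form. -/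
def pontryagin (n : Form N 2 ℤ) : ℤ := latticeSum (cup n n) + latticeSum (cup₁ n (extd n))

end Sums

/-! ### Contours -/

/-- The oriented step `(μ, true)` goes from `x` to `x + μ̂`, and `(μ, false)` from `x` to `x - μ̂`. -/
abbrev Step : Type := Fin 4 × Bool

/-- The latticeSum displacement in `ℤ⁴` of a list of steps. -/
def displacement (s : List Step) (μ : Fin 4) : ℤ :=
  (s.count (μ, true) : ℤ) - (s.count (μ, false) : ℤ)

/-- The net number of times each link is traversed by the lattice path that starts at `x`. -/
def traversals {N : ℕ} : Site N → List Step → Form N 1 ℤ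
  | _, [] => 0
  | x, (μ, true) :: s =>
      Pi.single (x, ⟨{μ}, Finset.card_singleton μ⟩) 1 + traversals (x + hat {μ}) s
  | x, (μ, false) :: s =>
      -Pi.single (x - hat {μ}, ⟨{μ}, Finset.card_singleton μ⟩) 1 + traversals (x - hat {μ}) s

/-- A contour: a closed path along oriented links of the periodic lattice. -/
structure Contour (N : ℕ) where
  base : Site N
  steps : List Step
  closed : ∀ μ, ((displacement steps μ : ℤ) : ZMod N) = 0

/-- The tangent vector `γ̇`: `+1` on the links that `γ` follows, `-1` on those that it follows
backwards, `0` elsewhere (counted with multiplicity). -/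
def Contour.tangent {N : ℕ} (γ : Contour N) : Form N 1 ℤ := traversals γ.base γ.steps

/-- A closed path on the torus is contractible iff its lift to `ℤ⁴` is closed, that is, iff all its
winding numbers vanish. -/
def Contour.IsContractible {N : ℕ} (γ : Contour N) : Prop := ∀ μ, displacement γ.steps μ = 0

/-- The integer-valued 2-form `l` satisfies `∑_{ν<ρ<σ} ε_{μνρσ} (dl)_{x+μ̂,νρσ} = -γ̇_{x,μ}`. -/
def IsDualSurface {N : ℕ} (γ : Contour N) (l : Form N 2 ℤ) : Prop :=
  ∀ (x : Site N) (μ : Fin 4),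
    shuffleSign {μ} {μ}ᶜ * comp (extd l) (x + hat {μ}) {μ}ᶜ = -comp γ.tangent x {μ}

section PathIntegral

variable {N : ℕ} [NeZero N]

/-- `u = ∑ₓ P_∂ l ∪₁ d P_∂ l`. -/
def uOf (l : Form N 2 ℤ) : ℝ :=
  latticeSum (cup₁ (coexactProj (toReal l)) (extd (coexactProj (toReal l))))

/-- `v = 𝔓(l)`. -/
def vOf (l : Form N 2 ℤ) : ℤ := pontryagin l

/-! ### The modified Villain lattice Maxwell theory -/

/-- The field strength `F = dA + 2πn`. -/
def fieldStrength (A : Form N 1 ℝ) (n : Form N 2 ℤ) : Form N 2 ℝ := fun c =>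
  extd A c + 2 * π * (n c : ℝ)

/-- The topological charge without monopoles, `Q₀ = (1/8π²) ∑ₓ F ∪ F`. -/
def charge₀ (A : Form N 1 ℝ) (n : Form N 2 ℤ) : ℝ :=
  1 / (8 * π ^ 2) * latticeSum (cup (fieldStrength A n) (fieldStrength A n))

/-- The topological charge `Q = ∑ₓ ((1/8π²) F ∪ F + (1/4π) F ∪₁ dn)`. -/
def charge (A : Form N 1 ℝ) (n : Form N 2 ℤ) : ℝ :=
  1 / (8 * π ^ 2) * latticeSum (cup (fieldStrength A n) (fieldStrength A n)) +
    1 / (4 * π) * latticeSum (cup₁ (fieldStrength A n) (toReal (extd n)))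

/-- The measure `∏ dA_c / 2π` on the compact fields `A_c ∈ [-π, π)`, one for each `r`-cell `c`. -/
def fieldMeasure (N r : ℕ) [NeZero N] : Measure (Form N r ℝ) :=
  Measure.pi fun _ => ENNReal.ofReal (1 / (2 * π)) • volume.restrict (Set.Ico (-π) π)

/-- The path integral `∫ DAᵉ DAᵐ ∑_{n} w(Aᵉ, Aᵐ, n)`. -/
def pathIntegral (w : Form N 1 ℝ → Form N 3 ℝ → Form N 2 ℤ → ℂ) : ℂ :=
  ∫ Ae, ∫ Am, ∑' n, w Ae Am n ∂(fieldMeasure N 3) ∂(fieldMeasure N 1)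

/-- Convergence of a path integral. -/
def PathIntegralConverges (w : Form N 1 ℝ → Form N 3 ℝ → Form N 2 ℤ → ℂ) : Prop :=
  (∀ Ae Am, Summable (w Ae Am)) ∧
    Integrable (fun A : Form N 1 ℝ × Form N 3 ℝ => ∑' n, w A.1 A.2 n)
      ((fieldMeasure N 1).prod (fieldMeasure N 3))

/-- The weight `exp(-(β/2) F² - iθ Q₀[F] + (i/2π) ∂Aᵐ·F)`. -/
def partitionWeight (β θ : ℝ) (Ae : Form N 1 ℝ) (Am : Form N 3 ℝ) (n : Form N 2 ℤ) : ℂ :=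
  cexp (-((β / 2 * dot (fieldStrength Ae n) (fieldStrength Ae n) : ℝ) : ℂ)
    - I * ((θ * charge₀ Ae n : ℝ) : ℂ)
    + I * ((1 / (2 * π) * dot (bdry Am) (fieldStrength Ae n) : ℝ) : ℂ))

/-- The partition function `Z[β, θ]`. -/
def partitionFunction (N : ℕ) [NeZero N] (β θ : ℝ) : ℂ :=
  pathIntegral (N := N) (partitionWeight β θ)

/-- The dyonic Wilson loop `W_d^{(q_e,q_m)}(γ) = exp(i ∑ₓ (q_e γ̇·Aᵉ - q_m γ̇ ∪ Aᵐ))`. -/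
def dyonicLoop (γ : Contour N) (qe qm : ℤ) (Ae : Form N 1 ℝ) (Am : Form N 3 ℝ) : ℂ :=
  cexp (I * ((qe * dot (toReal γ.tangent) Ae - qm * latticeSum (cup (toReal γ.tangent) Am) : ℝ) : ℂ))

/-- The weight `exp(-(β/2) F² - iθ Q[F] + (i/2π) ∂Aᵐ·F - ipπ 𝔓(n)) W_d^{(q_e,q_m)}(γ)`. -/
def dyonicWeight (γ : Contour N) (qe qm : ℤ) (β θ p : ℝ)
    (Ae : Form N 1 ℝ) (Am : Form N 3 ℝ) (n : Form N 2 ℤ) : ℂ :=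
  cexp (-((β / 2 * dot (fieldStrength Ae n) (fieldStrength Ae n) : ℝ) : ℂ)
    - I * ((θ * charge Ae n : ℝ) : ℂ)
    + I * ((1 / (2 * π) * dot (bdry Am) (fieldStrength Ae n) : ℝ) : ℂ)
    - I * ((p * π * (pontryagin n : ℝ) : ℝ) : ℂ)) * dyonicLoop γ qe qm Ae Am

/-- The expectation value `⟨W_d^{(q_e,q_m)}(γ)⟩^p_{β,θ}`. -/
def dyonicExpectation (γ : Contour N) (qe qm : ℤ) (β θ p : ℝ) : ℂ :=
  pathIntegral (dyonicWeight γ qe qm β θ p) / partitionFunction N β θ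

/-! ### The functions `F[α₁; α₂](q, τ)` -/

/-- The complex coupling `τ = θ/2π + 2πiβ`. -/
def coupling (β θ : ℝ) : ℂ := ((θ / (2 * π) : ℝ) : ℂ) + 2 * π * I * β

end PathIntegral

/-- The integer `q_m` of a pair `(q, τ)` with `q = q_e + τ q_m`, `Im τ > 0`. -/
def magneticCharge (z : ℂ × ℂ) : ℤ := round (z.1.im / z.2.im)

/-- The integer `q_e` of a pair `(q, τ)` with `q = q_e + τ q_m`, `Im τ > 0`. -/
def electricCharge (z : ℂ × ℂ) : ℤ := round (z.1.re - z.2.re * magneticCharge z)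

theorem magneticCharge_eq (qe qm : ℤ) {τ : ℂ} (hτ : 0 < τ.im) :
    magneticCharge ((qe : ℂ) + τ * qm, τ) = qm := by
  have h : ((qe : ℂ) + τ * qm).im / τ.im = (qm : ℝ) := by
    have : ((qe : ℂ) + τ * qm).im = τ.im * qm := by simp
    rw [this]; field_simp
  simp only [magneticCharge, h, round_intCast]

theorem electricCharge_eq (qe qm : ℤ) {τ : ℂ} (hτ : 0 < τ.im) :
    electricCharge ((qe : ℂ) + τ * qm, τ) = qe := by
  have h : ((qe : ℂ) + τ * qm).re - τ.re * qm = (qe : ℝ) := by simp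
  simp only [electricCharge, magneticCharge_eq qe qm hτ, h, round_intCast]

/-- `F[α₁; α₂](q, τ) = exp(2π²uβq_m²) (-1)^{2α₁ v q_e²} ⟨W_d^{(q_e,q_m)}(γ)⟩^{p=2α₂}_{β,θ}`, where
`q = q_e + τ q_m` and `τ = θ/2π + 2πiβ`. -/
def dyonicF {N : ℕ} [NeZero N] (γ : Contour N) (l : Form N 2 ℤ) (α₁ α₂ : ℝ) (z : ℂ × ℂ) : ℂ :=
  cexp ((2 * π ^ 2 * uOf l * (z.2.im / (2 * π)) * (magneticCharge z : ℝ) ^ 2 : ℝ) : ℂ) *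
    (-1 : ℂ) ^ ((2 * α₁ * vOf l * (electricCharge z : ℝ) ^ 2 : ℝ) : ℂ) *
    dyonicExpectation γ (electricCharge z) (magneticCharge z)
      (z.2.im / (2 * π)) (2 * π * z.2.re) (2 * α₂)

/-- Elements of `½ℤ`. -/
def IsHalfInt (α : ℝ) : Prop := ∃ k : ℤ, α = k / 2

/-! ### The modular group -/

/-- The action `M(q, τ) = (q/(cτ+d), (aτ+b)/(cτ+d))`. -/
def modAct (M : Matrix.SpecialLinearGroup (Fin 2) ℤ) (z : ℂ × ℂ) : ℂ × ℂ :=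
  (z.1 / ((M.1 1 0 : ℂ) * z.2 + M.1 1 1),
    ((M.1 0 0 : ℂ) * z.2 + M.1 0 1) / ((M.1 1 0 : ℂ) * z.2 + M.1 1 1))

/-- The factor `e(M, (q, τ)) = exp(iuπ c q²/(cτ+d))`. -/
def autFactor (u : ℝ) (M : Matrix.SpecialLinearGroup (Fin 2) ℤ) (z : ℂ × ℂ) : ℂ :=
  cexp (I * u * π * ((M.1 1 0 : ℂ) * z.1 ^ 2 / ((M.1 1 0 : ℂ) * z.2 + M.1 1 1)))

/-- Reduction modulo 2, `SL(2,ℤ) → SL(2,ℤ₂)`. -/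
def redTwo : Matrix.SpecialLinearGroup (Fin 2) ℤ →* Matrix.SpecialLinearGroup (Fin 2) (ZMod 2) :=
  Matrix.SpecialLinearGroup.map (Int.castRingHom (ZMod 2))

/-- The (right) action of `SL(2,ℤ₂)` on characteristics, `(α₁, α₂) ↦
(aα₁ + cα₂ + ac/2, bα₁ + dα₂ + bd/2)`; the pair `(α₁, α₂) ∈ (½ℤ/ℤ)²` is recorded by
`(2α₁, 2α₂) ∈ ℤ₂ × ℤ₂`. -/
def charAct (M : Matrix.SpecialLinearGroup (Fin 2) (ZMod 2)) (a : ZMod 2 × ZMod 2) :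
    ZMod 2 × ZMod 2 :=
  (M.1 0 0 * a.1 + M.1 1 0 * a.2 + M.1 0 0 * M.1 1 0,
    M.1 0 1 * a.1 + M.1 1 1 * a.2 + M.1 0 1 * M.1 1 1)

/-- The function `F[α₁; α₂]` whose characteristics `α₁, α₂ ∈ {0, ½}` are `a/2`. -/
def dyonicFChar {N : ℕ} [NeZero N] (γ : Contour N) (l : Form N 2 ℤ) (a : ZMod 2 × ZMod 2)
    (z : ℂ × ℂ) : ℂ :=
  dyonicF γ l ((a.1.val : ℝ) / 2) ((a.2.val : ℝ) / 2) z

end LatticeMaxwell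

end

open LatticeMaxwell

namespace LatticeMaxwell

noncomputable section

/-! ### Components of forms and lattice correlations -/

section Components

variable {N : ℕ} {K : Type} [CommRing K]

/-! The dyonic expectation value can be computed exactly, and the resulting formula is modular
covariant factor by factor.

Integrating over `A^m` imposes `dn = q_m dl` (`pathIntegral_character`), so `n` is replaced by `q_m
l + n` with `n` closed. The combination `n ∪ n + n ∪₁ dn` is designed so that adding a closed form
produces the cross term `2 ∑ a ∪ b` (`pontr_add_of_closed`, resting on `latticeSum_cup_comm`). The
self-term `∑ n ∪ n` of a closed integer form is an even integer, because the intersection form of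
the four-torus is even. Hence the parity of `v` is well defined and the `p`-term reduces to the sign
`(-1)^{p v q_m²}`.

A closed integer form consists of six integer fluxes and an integer form that is exact over the
reals. Compact fields together with the latter sweep out the space of exact real 2-forms with a
translation invariant measure, which is therefore a multiple of Lebesgue measure
(`exists_exactMeasure_eq_smul`). The path integral thus becomes a Gaussian integral over exact forms
and a sum over fluxes (`exists_integral_tsum_closed`). By the Hodge decomposition of `l`, its exact
part is removed by a translation, its coexact part is the source of the Gaussian, and its fluxes `k`
remain in the sum (`integral_reducedWeight`). The cost of the translation is expressed by `v`, `u`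
and the self-pairing of `k` through `pontr_decomposition`.

The flux sum factorises over the three pairs of orthogonal planes. Poisson summation in one flux of
each pair gives a sum over lattice points `n + mτ` shifted by a multiple of `q` (`tsum_planeTerm`),
which is invariant under `SL(2,ℤ)` (`planeTheta_moebius`).

All normalisations cancel against the partition function, and, with `w` the squared norm of the
coexact part of `l`, what is left (`dyonicTheta`) is `exp(-πw|q|²/Im τ - iπu q_m q)` times
`(-1)^{v(2α₁q_e² + q_e q_m + 2α₂q_m²)}` times a ratio of theta functions. The quantity `|q|²/Im τ`
and the ratio are invariant, the `u`-term yields the factor of automorphy, and the action on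
characteristics is the substitution of charges in the quadratic form modulo 2
(`dyonicTheta_moebius`). -/

theorem comp_of_card {r : ℕ} (α : Form N r K) (x : Site N) {S : Finset (Fin 4)} (h : S.card = r) :
    comp α x S = α (x, ⟨S, h⟩) := dif_pos h

theorem comp_of_card_ne {r : ℕ} (α : Form N r K) (x : Site N) {S : Finset (Fin 4)}
    (h : S.card ≠ r) : comp α x S = 0 := dif_neg h

theorem apply_eq_comp {r : ℕ} (α : Form N r K) (c : Cell N r) : α c = comp α c.1 c.2.1 :=
  (comp_of_card α c.1 c.2.2).symm

theorem form_ext {r : ℕ} {α β : Form N r K}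
    (h : ∀ (x : Site N) (S : Finset (Fin 4)), S.card = r → comp α x S = comp β x S) : α = β := by
  funext c
  rw [apply_eq_comp α, apply_eq_comp β, h _ _ c.2.2]

@[simp] theorem comp_add {r : ℕ} (α β : Form N r K) (x : Site N) (S : Finset (Fin 4)) :
    comp (α + β) x S = comp α x S + comp β x S := by
  unfold comp; split_ifs <;> simp

@[simp] theorem comp_sub {r : ℕ} (α β : Form N r K) (x : Site N) (S : Finset (Fin 4)) :
    comp (α - β) x S = comp α x S - comp β x S := by
  unfold comp; split_ifs <;> simp

@[simp] theorem comp_zero {r : ℕ} (x : Site N) (S : Finset (Fin 4)) :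
    comp (0 : Form N r K) x S = 0 := by
  unfold comp; split_ifs <;> simp

@[simp] theorem comp_smul {r : ℕ} (t : K) (α : Form N r K) (x : Site N) (S : Finset (Fin 4)) :
    comp (t • α) x S = t * comp α x S := by
  unfold comp; split_ifs <;> simp

theorem comp_toReal {r : ℕ} (n : Form N r ℤ) (x : Site N) (S : Finset (Fin 4)) :
    comp (toReal n) x S = ((comp n x S : ℤ) : ℝ) := by
  unfold comp toReal; split_ifs <;> simp

theorem comp_extd {r : ℕ} (α : Form N r K) (x : Site N) {S : Finset (Fin 4)}
    (h : S.card = r + 1) :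
    comp (extd α) x S = ∑ μ ∈ S, (shuffleSign {μ} (S.erase μ) : K) *
      (comp α (x + hat {μ}) (S.erase μ) - comp α x (S.erase μ)) := by
  rw [comp_of_card _ _ h]; rfl

theorem comp_bdry {r : ℕ} (α : Form N (r + 1) K) (x : Site N) {S : Finset (Fin 4)}
    (h : S.card = r) :
    comp (bdry α) x S = ∑ ν ∈ Sᶜ, (shuffleSign S {ν} : K) *
      (comp α x (insert ν S) - comp α (x - hat {ν}) (insert ν S)) := by
  rw [comp_of_card _ _ h]; rfl

theorem comp_cup {p q : ℕ} (α : Form N p K) (β : Form N q K) (x : Site N) {S : Finset (Fin 4)}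
    (h : S.card = p + q) :
    comp (cup α β) x S = ∑ A ∈ S.powersetCard p, (shuffleSign A (S \ A) : K) *
      (comp α x A * comp β (x + hat A) (S \ A)) := by
  rw [comp_of_card _ _ h]; rfl

theorem comp_contract {r : ℕ} {μ : Fin 4} (α : Form N (r + 1) K) (x : Site N)
    {S : Finset (Fin 4)} (h : μ ∉ S) :
    comp (contract μ α) x S = (shuffleSign {μ} S : K) * comp α x (insert μ S) := by
  by_cases hc : S.card = r
  · rw [comp_of_card _ _ hc]; simp [contract, h]
  · rw [comp_of_card_ne _ _ hc, comp_of_card_ne, mul_zero]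
    rw [Finset.card_insert_of_notMem h]; omega

theorem comp_parity {r : ℕ} (μ : Fin 4) (α : Form N r K) (x : Site N) (S : Finset (Fin 4)) :
    comp (parity μ α) x S = (-1) ^ (S.filter fun ν => μ ≤ ν).card *
      comp α (reflect μ x - hat (S.filter fun ν => μ ≤ ν)) S := by
  by_cases hc : S.card = r
  · rw [comp_of_card _ _ hc]; rfl
  · rw [comp_of_card_ne _ _ hc, comp_of_card_ne _ _ hc, mul_zero]

/-- The reflections in `P_μ (P_μ α ∪ P_μ β)` undo each other up to a translation, since a reflected
cell is based at its opposite corner. This translation is the one seen by `α`; the next lemma gives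
the one seen by `β`. -/
theorem reflect_reflect_sub_hat (μ : Fin 4) (x : Site N) {A S : Finset (Fin 4)} (h : A ⊆ S) :
    reflect μ (reflect μ x - hat (S.filter fun ν => μ ≤ ν)) - hat (A.filter fun ν => μ ≤ ν) =
      x + hat ((S \ A).filter fun ν => μ ≤ ν) := by
  funext ν
  have := @h ν
  by_cases h1 : μ ≤ ν <;> by_cases h2 : ν ∈ A <;> by_cases h3 : ν ∈ S <;>
    simp_all [reflect, hat, not_le.2, add_comm]

theorem reflect_reflect_add_hat (μ : Fin 4) (x : Site N) {A S : Finset (Fin 4)} (h : A ⊆ S) :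
    reflect μ (reflect μ x - hat (S.filter fun ν => μ ≤ ν) + hat A) -
        hat ((S \ A).filter fun ν => μ ≤ ν) =
      x + hat (A.filter fun ν => ν < μ) := by
  funext ν
  have := @h ν
  by_cases h1 : μ ≤ ν <;> by_cases h2 : ν ∈ A <;> by_cases h3 : ν ∈ S <;>
    simp_all [reflect, hat, not_le.2, add_comm]

/-- Each reflected direction of `S` produces a sign in the outer reflection and another in the
factor that contains it, so all signs cancel and only the base points differ from those of the
ordinary cup product. -/
theorem comp_parity_cup_parity {p q : ℕ} (μ : Fin 4) (α : Form N p K) (β : Form N q K) (x : Site N)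
    {S : Finset (Fin 4)} (h : S.card = p + q) :
    comp (parity μ (cup (parity μ α) (parity μ β))) x S =
      ∑ A ∈ S.powersetCard p, (shuffleSign A (S \ A) : K) *
        (comp α (x + hat ((S \ A).filter fun ν => μ ≤ ν)) A *
          comp β (x + hat (A.filter fun ν => ν < μ)) (S \ A)) := by
  rw [comp_parity, comp_cup _ _ _ h, Finset.mul_sum]
  refine Finset.sum_congr rfl fun A hA => ?_
  have hAS := (Finset.mem_powersetCard.1 hA).1
  rw [comp_parity, comp_parity, reflect_reflect_sub_hat μ x hAS, reflect_reflect_add_hat μ x hAS]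
  have hcard : (S.filter fun ν => μ ≤ ν).card =
      (A.filter fun ν => μ ≤ ν).card + ((S \ A).filter fun ν => μ ≤ ν).card := by
    rw [← Finset.card_union_of_disjoint, ← Finset.filter_union, Finset.union_sdiff_of_subset hAS]
    exact Finset.disjoint_filter_filter Finset.disjoint_sdiff
  rw [hcard, pow_add]
  have sq (n : ℕ) : ((-1 : K) ^ n) * (-1) ^ n = 1 := by rw [← mul_pow]; simp
  linear_combination ((shuffleSign A (S \ A) : K) *
    (comp α (x + hat ((S \ A).filter fun ν => μ ≤ ν)) A *
          comp β (x + hat (A.filter fun ν => ν < μ)) (S \ A))) *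
    ((-1) ^ ((S \ A).filter fun ν => μ ≤ ν).card * (-1) ^ ((S \ A).filter fun ν => μ ≤ ν).card *
        sq (A.filter fun ν => μ ≤ ν).card + sq ((S \ A).filter fun ν => μ ≤ ν).card)

theorem comp_cup₁_univ {p q : ℕ} (α : Form N (p + 1) K) (β : Form N (q + 1) K) (x : Site N)
    (h : p + q = 3) :
    comp (cup₁ α β) x Finset.univ =
      (-1) ^ (q + 1) * ∑ μ, (-1) ^ (((Finset.univ : Finset (Fin 4)).filter fun ν => ν < μ).card + 1) *
        ∑ A ∈ ((Finset.univ : Finset (Fin 4)).erase μ).powersetCard p,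
          ((shuffleSign A ((Finset.univ.erase μ) \ A) * shuffleSign {μ} A *
              shuffleSign {μ} ((Finset.univ.erase μ) \ A) : ℤ) : K) *
            (comp α (x + hat ((((Finset.univ : Finset (Fin 4)).erase μ) \ A).filter fun ν => μ ≤ ν))
                (insert μ A) *
              comp β (x + hat (A.filter fun ν => ν < μ))
                (insert μ ((Finset.univ.erase μ) \ A))) := by
  rw [comp_of_card _ _ (by rw [h]; rfl)]
  unfold cup₁
  congr 1
  refine Finset.sum_congr rfl fun μ _ => ?_
  congr 1
  rw [comp_parity_cup_parity]
  · refine Finset.sum_congr rfl fun A hA => ?_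
    have hAS := (Finset.mem_powersetCard.1 hA).1
    rw [comp_contract, comp_contract]
    · push_cast; ring
    · simp
    · exact fun h => by simpa using hAS h
  · exact (Finset.card_erase_of_mem (Finset.mem_univ μ)).trans (by rw [h]; rfl)

end Components

/-- The site with the given integer coordinates. -/
def siteOf {N : ℕ} (a b c d : ℤ) : Site N := ![(a : ZMod N), b, c, d]

section Correlations

variable {N : ℕ} {K : Type} [CommRing K]

/-- With integer coordinates, shifts are brought to normal form by `norm_num`, after which `ring`
treats the correlations as atoms. The identities between lattice sums below are verified in this
way. -/
theorem hat_eq_siteOf (S : Finset (Fin 4)) :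
    (hat S : Site N) = siteOf (if 0 ∈ S then 1 else 0) (if 1 ∈ S then 1 else 0)
      (if 2 ∈ S then 1 else 0) (if 3 ∈ S then 1 else 0) := by
  funext ν; fin_cases ν <;> simp [hat, siteOf]

theorem siteOf_add (a b c d a' b' c' d' : ℤ) :
    (siteOf a b c d + siteOf a' b' c' d' : Site N) = siteOf (a + a') (b + b') (c + c') (d + d') := by
  funext ν; fin_cases ν <;> simp [siteOf]

theorem siteOf_sub (a b c d a' b' c' d' : ℤ) :
    (siteOf a b c d - siteOf a' b' c' d' : Site N) = siteOf (a - a') (b - b') (c - c') (d - d') := by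
  funext ν; fin_cases ν <;> simp [siteOf]

theorem siteOf_zero : (siteOf 0 0 0 0 : Site N) = 0 := by
  funext ν; fin_cases ν <;> simp [siteOf]

variable [NeZero N]

/-- The lattice sum `∑ₓ α_{x,S} β_{x+z,T}`. -/
def corr {p q : ℕ} (α : Form N p K) (β : Form N q K) (S T : Finset (Fin 4)) (z : Site N) : K :=
  ∑ x, comp α x S * comp β (x + z) T

theorem sum_comp_mul_comp {p q : ℕ} (α : Form N p K) (β : Form N q K) (S T : Finset (Fin 4))
    (s t : Site N) :
    ∑ x, comp α (x + s) S * comp β (x + t) T = corr α β S T (t - s) := by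
  unfold corr
  rw [← Equiv.sum_comp (Equiv.addRight s) fun x => comp α x S * comp β (x + (t - s)) T]
  refine Finset.sum_congr rfl fun x _ => ?_
  simp [add_assoc]

theorem corr_extd_right {p q : ℕ} (α : Form N p K) (β : Form N q K) (S : Finset (Fin 4))
    {T : Finset (Fin 4)} (h : T.card = q + 1) (z : Site N) :
    corr α (extd β) S T z = ∑ μ ∈ T, (shuffleSign {μ} (T.erase μ) : K) *
      (corr α β S (T.erase μ) (z + hat {μ}) - corr α β S (T.erase μ) z) := by
  unfold corr
  simp_rw [comp_extd _ _ h, Finset.mul_sum]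
  rw [Finset.sum_comm]
  refine Finset.sum_congr rfl fun μ _ => ?_
  rw [← Finset.sum_sub_distrib, Finset.mul_sum]
  refine Finset.sum_congr rfl fun x _ => ?_
  rw [add_assoc]; ring

/-- Summation by parts: by translation invariance, a forward shift of the first factor is a backward
shift of the offset. -/
theorem corr_extd_left {p q : ℕ} (α : Form N p K) (β : Form N q K) {S : Finset (Fin 4)}
    (T : Finset (Fin 4)) (h : S.card = p + 1) (z : Site N) :
    corr (extd α) β S T z = ∑ μ ∈ S, (shuffleSign {μ} (S.erase μ) : K) *
      (corr α β (S.erase μ) T (z - hat {μ}) - corr α β (S.erase μ) T z) := by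
  have key (μ) : corr α β (S.erase μ) T (z - hat {μ}) =
      ∑ x, comp α (x + hat {μ}) (S.erase μ) * comp β (x + z) T := (sum_comp_mul_comp ..).symm
  simp_rw [key]
  unfold corr
  simp_rw [comp_extd _ _ h, Finset.sum_mul]
  rw [Finset.sum_comm]
  refine Finset.sum_congr rfl fun μ _ => ?_
  rw [← Finset.sum_sub_distrib, Finset.mul_sum]
  refine Finset.sum_congr rfl fun x _ => ?_
  ring

theorem latticeSum_cup {p q : ℕ} (α : Form N p K) (β : Form N q K) (h : p + q = 4) :
    ∑ x, comp (cup α β) x Finset.univ =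
      ∑ A ∈ (Finset.univ : Finset (Fin 4)).powersetCard p,
        (shuffleSign A (Finset.univ \ A) : K) * corr α β A (Finset.univ \ A) (hat A) := by
  unfold corr
  simp_rw [Finset.mul_sum]
  rw [Finset.sum_comm]
  refine Finset.sum_congr rfl fun x _ => ?_
  rw [comp_cup]; rw [h]; simp

theorem latticeSum_cup₁ {p q : ℕ} (α : Form N (p + 1) K) (β : Form N (q + 1) K) (h : p + q = 3) :
    ∑ x, comp (cup₁ α β) x Finset.univ =
      (-1) ^ (q + 1) * ∑ μ, (-1) ^ (((Finset.univ : Finset (Fin 4)).filter fun ν => ν < μ).card + 1) *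
        ∑ A ∈ ((Finset.univ : Finset (Fin 4)).erase μ).powersetCard p,
          ((shuffleSign A ((Finset.univ.erase μ) \ A) * shuffleSign {μ} A *
              shuffleSign {μ} ((Finset.univ.erase μ) \ A) : ℤ) : K) *
            corr α β (insert μ A) (insert μ ((Finset.univ.erase μ) \ A))
              (hat (A.filter fun ν => ν < μ) -
                hat ((((Finset.univ : Finset (Fin 4)).erase μ) \ A).filter fun ν => μ ≤ ν)) := by
  simp_rw [comp_cup₁_univ α β _ h, ← sum_comp_mul_comp, Finset.mul_sum]
  rw [Finset.sum_comm]
  refine Finset.sum_congr rfl fun μ _ => ?_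
  rw [Finset.sum_comm]

end Correlations

/-! ### Explicit lattice sums -/

section Explicit

theorem sum_univ_powersetCard_two {K : Type*} [AddCommMonoid K] (f : Finset (Fin 4) → K) :
    ∑ A ∈ (Finset.univ : Finset (Fin 4)).powersetCard 2, f A =
      f {0, 1} + (f {0, 2} + (f {0, 3} + (f {1, 2} + (f {1, 3} + f {2, 3})))) := by
  rw [show (Finset.univ : Finset (Fin 4)).powersetCard 2 =
    {{0, 1}, {0, 2}, {0, 3}, {1, 2}, {1, 3}, {2, 3}} by decide]
  repeat rw [Finset.sum_insert (by decide)]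
  rw [Finset.sum_singleton]

theorem sum_univ_powersetCard_three {K : Type*} [AddCommMonoid K] (f : Finset (Fin 4) → K) :
    ∑ A ∈ (Finset.univ : Finset (Fin 4)).powersetCard 3, f A =
      f {0, 1, 2} + (f {0, 1, 3} + (f {0, 2, 3} + f {1, 2, 3})) := by
  rw [show (Finset.univ : Finset (Fin 4)).powersetCard 3 =
    {{0, 1, 2}, {0, 1, 3}, {0, 2, 3}, {1, 2, 3}} by decide]
  repeat rw [Finset.sum_insert (by decide)]
  rw [Finset.sum_singleton]

theorem sum_univ_powersetCard_one {K : Type*} [AddCommMonoid K] (f : Finset (Fin 4) → K) :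
    ∑ A ∈ (Finset.univ : Finset (Fin 4)).powersetCard 1, f A = f {0} + (f {1} + (f {2} + f {3})) := by
  rw [show (Finset.univ : Finset (Fin 4)).powersetCard 1 = {{0}, {1}, {2}, {3}} by decide]
  repeat rw [Finset.sum_insert (by decide)]
  rw [Finset.sum_singleton]

theorem sum_triple {K : Type*} [AddCommMonoid K] {s : Finset (Finset (Fin 4))}
    (A B C : Finset (Fin 4)) (f : Finset (Fin 4) → K)
    (h : s = {A, B, C}) (h₁ : A ∉ ({B, C} : Finset (Finset (Fin 4)))) (h₂ : B ≠ C) :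
    ∑ A ∈ s, f A = f A + (f B + f C) := by
  rw [h, Finset.sum_insert h₁, Finset.sum_pair h₂]

theorem sum_pair_directions {K : Type*} [AddCommMonoid K] {S : Finset (Fin 4)} (i j : Fin 4)
    (f : Fin 4 → K) (h : S = {i, j}) (hij : i ≠ j) : ∑ μ ∈ S, f μ = f i + f j := by
  rw [h, Finset.sum_pair hij]

theorem sum_triple_directions {K : Type*} [AddCommMonoid K] {S : Finset (Fin 4)} (i j k : Fin 4)
    (f : Fin 4 → K) (h : S = {i, j, k}) (h₁ : i ∉ ({j, k} : Finset (Fin 4))) (h₂ : j ≠ k) :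
    ∑ μ ∈ S, f μ = f i + (f j + f k) := by
  rw [h, Finset.sum_insert h₁, Finset.sum_pair h₂]

variable {N : ℕ} {K : Type} [CommRing K]

theorem hat_zero : (hat {0} : Site N) = siteOf 1 0 0 0 := by
  rw [hat_eq_siteOf]; congr 1

theorem hat_one : (hat {1} : Site N) = siteOf 0 1 0 0 := by
  rw [hat_eq_siteOf]; congr 1

theorem hat_two : (hat {2} : Site N) = siteOf 0 0 1 0 := by
  rw [hat_eq_siteOf]; congr 1

theorem hat_three : (hat {3} : Site N) = siteOf 0 0 0 1 := by
  rw [hat_eq_siteOf]; congr 1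

section Extd

variable {r : ℕ} (α : Form N r K) (x : Site N)

theorem comp_extd_pair {α : Form N 1 K} (i j : Fin 4) (h : i < j) :
    comp (extd α) x {i, j} =
      (comp α (x + hat {i}) {j} - comp α x {j}) - (comp α (x + hat {j}) {i} - comp α x {i}) := by
  rw [comp_extd _ _ (Finset.card_pair h.ne), sum_pair_directions i j _ rfl h.ne,
    show ({i, j} : Finset (Fin 4)).erase i = {j} by revert i j; decide,
    show ({i, j} : Finset (Fin 4)).erase j = {i} by revert i j; decide,
    show shuffleSign {i} {j} = 1 by revert i j; decide,
    show shuffleSign {j} {i} = -1 by revert i j; decide]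
  push_cast; ring

theorem comp_extd_triple {α : Form N 2 K} (i j k : Fin 4) (h : i < j) (h' : j < k) :
    comp (extd α) x {i, j, k} =
      (comp α (x + hat {i}) {j, k} - comp α x {j, k}) -
        (comp α (x + hat {j}) {i, k} - comp α x {i, k}) +
        (comp α (x + hat {k}) {i, j} - comp α x {i, j}) := by
  rw [comp_extd _ _ (by revert i j k; decide),
    sum_triple_directions i j k _ rfl (by revert i j k; decide) h'.ne,
    show ({i, j, k} : Finset (Fin 4)).erase i = {j, k} by revert i j k; decide,
    show ({i, j, k} : Finset (Fin 4)).erase j = {i, k} by revert i j k; decide,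
    show ({i, j, k} : Finset (Fin 4)).erase k = {i, j} by revert i j k; decide,
    show shuffleSign {i} {j, k} = 1 by revert i j k; decide,
    show shuffleSign {j} {i, k} = -1 by revert i j k; decide,
    show shuffleSign {k} {i, j} = 1 by revert i j k; decide]
  push_cast; ring

end Extd

theorem extd_extd (A : Form N 1 K) : extd (extd A) = 0 := by
  refine form_ext fun x S hS => ?_
  have key (i j k : Fin 4) (h : i < j) (h' : j < k) : comp (extd (extd A)) x {i, j, k} = 0 := by
    rw [comp_extd_triple _ _ _ _ h h', comp_extd_pair _ _ _ h, comp_extd_pair _ _ _ h',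
      comp_extd_pair _ _ _ h, comp_extd_pair _ _ _ h', comp_extd_pair _ _ _ (h.trans h'),
      comp_extd_pair _ _ _ (h.trans h'), add_right_comm x (hat {j}) (hat {i}),
      add_right_comm x (hat {k}) (hat {i}), add_right_comm x (hat {k}) (hat {j})]
    ring
  have : S ∈ ({{0, 1, 2}, {0, 1, 3}, {0, 2, 3}, {1, 2, 3}} : Finset (Finset (Fin 4))) := by
    revert S; decide
  simp only [Finset.mem_insert, Finset.mem_singleton] at this
  rw [comp_zero]
  rcases this with rfl | rfl | rfl | rfl <;> exact key _ _ _ (by decide) (by decide)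

variable [NeZero N]

theorem latticeSum_cup_two (a b : Form N 2 K) :
    latticeSum (cup a b) =
      corr a b {0, 1} {2, 3} (siteOf 1 1 0 0) - corr a b {0, 2} {1, 3} (siteOf 1 0 1 0)
      + corr a b {0, 3} {1, 2} (siteOf 1 0 0 1) + corr a b {1, 2} {0, 3} (siteOf 0 1 1 0)
      - corr a b {1, 3} {0, 2} (siteOf 0 1 0 1) + corr a b {2, 3} {0, 1} (siteOf 0 0 1 1) := by
  refine (latticeSum_cup a b rfl).trans ?_
  rw [sum_univ_powersetCard_two]
  simp only [hat_eq_siteOf]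
  rw [show (Finset.univ \ {0, 1} : Finset (Fin 4)) = {2, 3} by decide,
    show (Finset.univ \ {0, 2} : Finset (Fin 4)) = {1, 3} by decide,
    show (Finset.univ \ {0, 3} : Finset (Fin 4)) = {1, 2} by decide,
    show (Finset.univ \ {1, 2} : Finset (Fin 4)) = {0, 3} by decide,
    show (Finset.univ \ {1, 3} : Finset (Fin 4)) = {0, 2} by decide,
    show (Finset.univ \ {2, 3} : Finset (Fin 4)) = {0, 1} by decide,
    show shuffleSign {0, 1} {2, 3} = 1 by decide, show shuffleSign {0, 2} {1, 3} = -1 by decide,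
    show shuffleSign {0, 3} {1, 2} = 1 by decide, show shuffleSign {1, 2} {0, 3} = 1 by decide,
    show shuffleSign {1, 3} {0, 2} = -1 by decide, show shuffleSign {2, 3} {0, 1} = 1 by decide]
  simp
  ring

theorem latticeSum_cup_one_three (a : Form N 1 K) (b : Form N 3 K) :
    latticeSum (cup a b) =
      corr a b {0} {1, 2, 3} (siteOf 1 0 0 0) - corr a b {1} {0, 2, 3} (siteOf 0 1 0 0)
      + corr a b {2} {0, 1, 3} (siteOf 0 0 1 0) - corr a b {3} {0, 1, 2} (siteOf 0 0 0 1) := by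
  refine (latticeSum_cup a b rfl).trans ?_
  rw [sum_univ_powersetCard_one]
  simp only [hat_eq_siteOf]
  rw [show (Finset.univ \ {0} : Finset (Fin 4)) = {1, 2, 3} by decide,
    show (Finset.univ \ {1} : Finset (Fin 4)) = {0, 2, 3} by decide,
    show (Finset.univ \ {2} : Finset (Fin 4)) = {0, 1, 3} by decide,
    show (Finset.univ \ {3} : Finset (Fin 4)) = {0, 1, 2} by decide,
    show shuffleSign {0} {1, 2, 3} = 1 by decide, show shuffleSign {1} {0, 2, 3} = -1 by decide,
    show shuffleSign {2} {0, 1, 3} = 1 by decide, show shuffleSign {3} {0, 1, 2} = -1 by decide]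
  simp
  ring

theorem corr_extd_pair_left {q : ℕ} (a : Form N 1 K) (b : Form N q K) (T : Finset (Fin 4))
    (z : Site N) (i j : Fin 4) (h : i < j) :
    corr (extd a) b {i, j} T z =
      (corr a b {j} T (z - hat {i}) - corr a b {j} T z) -
        (corr a b {i} T (z - hat {j}) - corr a b {i} T z) := by
  rw [corr_extd_left _ _ _ (Finset.card_pair h.ne), sum_pair_directions i j _ rfl h.ne,
    show ({i, j} : Finset (Fin 4)).erase i = {j} by revert i j; decide,
    show ({i, j} : Finset (Fin 4)).erase j = {i} by revert i j; decide,
    show shuffleSign {i} {j} = 1 by revert i j; decide,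
    show shuffleSign {j} {i} = -1 by revert i j; decide]
  push_cast; ring

theorem corr_extd_triple_left {q : ℕ} (a : Form N 2 K) (b : Form N q K) (T : Finset (Fin 4))
    (z : Site N) (i j k : Fin 4) (h : i < j) (h' : j < k) :
    corr (extd a) b {i, j, k} T z =
      (corr a b {j, k} T (z - hat {i}) - corr a b {j, k} T z) -
        (corr a b {i, k} T (z - hat {j}) - corr a b {i, k} T z) +
        (corr a b {i, j} T (z - hat {k}) - corr a b {i, j} T z) := by
  rw [corr_extd_left _ _ _ (by revert i j k; decide),
    sum_triple_directions i j k _ rfl (by revert i j k; decide) h'.ne,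
    show ({i, j, k} : Finset (Fin 4)).erase i = {j, k} by revert i j k; decide,
    show ({i, j, k} : Finset (Fin 4)).erase j = {i, k} by revert i j k; decide,
    show ({i, j, k} : Finset (Fin 4)).erase k = {i, j} by revert i j k; decide,
    show shuffleSign {i} {j, k} = 1 by revert i j k; decide,
    show shuffleSign {j} {i, k} = -1 by revert i j k; decide,
    show shuffleSign {k} {i, j} = 1 by revert i j k; decide]
  push_cast; ring

theorem corr_extd_triple_right {p : ℕ} (a : Form N p K) (b : Form N 2 K) (S : Finset (Fin 4))
    (z : Site N) (i j k : Fin 4) (h : i < j) (h' : j < k) :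
    corr a (extd b) S {i, j, k} z =
      (corr a b S {j, k} (z + hat {i}) - corr a b S {j, k} z) -
        (corr a b S {i, k} (z + hat {j}) - corr a b S {i, k} z) +
        (corr a b S {i, j} (z + hat {k}) - corr a b S {i, j} z) := by
  rw [corr_extd_right _ _ _ (by revert i j k; decide),
    sum_triple_directions i j k _ rfl (by revert i j k; decide) h'.ne,
    show ({i, j, k} : Finset (Fin 4)).erase i = {j, k} by revert i j k; decide,
    show ({i, j, k} : Finset (Fin 4)).erase j = {i, k} by revert i j k; decide,
    show ({i, j, k} : Finset (Fin 4)).erase k = {i, j} by revert i j k; decide,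
    show shuffleSign {i} {j, k} = 1 by revert i j k; decide,
    show shuffleSign {j} {i, k} = -1 by revert i j k; decide,
    show shuffleSign {k} {i, j} = 1 by revert i j k; decide]
  push_cast; ring

/-- Summation by parts: `∑ₓ dA ∪ b = ∑ₓ A ∪ db`. -/
theorem latticeSum_extd_cup (A : Form N 1 K) (b : Form N 2 K) :
    latticeSum (cup (extd A) b) = latticeSum (cup A (extd b)) := by
  rw [latticeSum_cup_two, latticeSum_cup_one_three,
    corr_extd_pair_left _ _ _ _ 0 1 (by decide), corr_extd_pair_left _ _ _ _ 0 2 (by decide),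
    corr_extd_pair_left _ _ _ _ 0 3 (by decide), corr_extd_pair_left _ _ _ _ 1 2 (by decide),
    corr_extd_pair_left _ _ _ _ 1 3 (by decide), corr_extd_pair_left _ _ _ _ 2 3 (by decide),
    corr_extd_triple_right _ _ _ _ 0 1 2 (by decide) (by decide),
    corr_extd_triple_right _ _ _ _ 0 1 3 (by decide) (by decide),
    corr_extd_triple_right _ _ _ _ 0 2 3 (by decide) (by decide),
    corr_extd_triple_right _ _ _ _ 1 2 3 (by decide) (by decide)]
  simp only [hat_zero, hat_one, hat_two, hat_three, siteOf_add, siteOf_sub]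
  norm_num
  ring

/-- Collects the data of one summand as hypotheses about `Fin 4` and integers, each within reach of
`decide`; the offset itself lives on a lattice of unspecified size. -/
theorem cup₁_summand {p q : ℕ} (a : Form N (p + 1) K) (b : Form N (q + 1) K) {μ : Fin 4}
    {A : Finset (Fin 4)} (s : ℤ) (S T : Finset (Fin 4)) (z₀ z₁ z₂ z₃ : ℤ)
    (hs : shuffleSign A ((Finset.univ.erase μ) \ A) * shuffleSign {μ} A *
              shuffleSign {μ} ((Finset.univ.erase μ) \ A) = s)
    (hS : insert μ A = S) (hT : insert μ ((Finset.univ.erase μ) \ A) = T)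
    (hz : ∀ ν, (if ν ∈ A.filter (fun ν => ν < μ) then (1 : ℤ) else 0) -
      (if ν ∈ (((Finset.univ : Finset (Fin 4)).erase μ) \ A).filter (fun ν => μ ≤ ν) then 1 else 0) =
        (![z₀, z₁, z₂, z₃] : Fin 4 → ℤ) ν) :
    ((shuffleSign A ((Finset.univ.erase μ) \ A) * shuffleSign {μ} A *
              shuffleSign {μ} ((Finset.univ.erase μ) \ A) : ℤ) : K) *
            corr a b (insert μ A) (insert μ ((Finset.univ.erase μ) \ A))
              (hat (A.filter fun ν => ν < μ) -
                hat ((((Finset.univ : Finset (Fin 4)).erase μ) \ A).filter fun ν => μ ≤ ν)) =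
      s * corr a b S T (siteOf z₀ z₁ z₂ z₃) := by
  have h0 := hz 0
  have h1 := hz 1
  have h2 := hz 2
  have h3 := hz 3
  simp only [Matrix.cons_val] at h0 h1 h2 h3
  rw [hs, hS, hT, hat_eq_siteOf, hat_eq_siteOf, siteOf_sub, h0, h1, h2, h3]

set_option maxHeartbeats 1000000 in
theorem latticeSum_cup₁_two_three (a : Form N 2 K) (b : Form N 3 K) :
    latticeSum (cup₁ a b) =
      corr a b {0, 1} {0, 2, 3} (siteOf 0 0 (-1) (-1))
      - corr a b {0, 2} {0, 1, 3} (siteOf 0 (-1) 0 (-1))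
      + corr a b {0, 3} {0, 1, 2} (siteOf 0 (-1) (-1) 0)
      + corr a b {0, 1} {1, 2, 3} (siteOf 1 0 (-1) (-1))
      - corr a b {1, 2} {0, 1, 3} (siteOf 0 0 0 (-1))
      + corr a b {1, 3} {0, 1, 2} (siteOf 0 0 (-1) 0)
      + corr a b {0, 2} {1, 2, 3} (siteOf 1 0 0 (-1))
      - corr a b {1, 2} {0, 2, 3} (siteOf 0 1 0 (-1))
      + corr a b {2, 3} {0, 1, 2} (siteOf 0 0 0 0)
      + corr a b {0, 3} {1, 2, 3} (siteOf 1 0 0 0)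
      - corr a b {1, 3} {0, 2, 3} (siteOf 0 1 0 0)
      + corr a b {2, 3} {0, 1, 3} (siteOf 0 0 1 0) := by
  refine (latticeSum_cup₁ a b rfl).trans ?_
  rw [Fin.sum_univ_four, sum_triple {1} {2} {3} _ (by decide) (by decide) (by decide),
    sum_triple {0} {2} {3} _ (by decide) (by decide) (by decide),
    sum_triple {0} {1} {3} _ (by decide) (by decide) (by decide),
    sum_triple {0} {1} {2} _ (by decide) (by decide) (by decide)]
  rw [cup₁_summand a b (A := {1}) (μ := 0) (1) {0, 1} {0, 2, 3} 0 0 (-1) (-1) (by decide) (by decide) (by decide)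
      (by decide),
    cup₁_summand a b (A := {2}) (μ := 0) (-1) {0, 2} {0, 1, 3} 0 (-1) 0 (-1) (by decide) (by decide) (by decide)
      (by decide),
    cup₁_summand a b (A := {3}) (μ := 0) (1) {0, 3} {0, 1, 2} 0 (-1) (-1) 0 (by decide) (by decide) (by decide)
      (by decide),
    cup₁_summand a b (A := {0}) (μ := 1) (-1) {0, 1} {1, 2, 3} 1 0 (-1) (-1) (by decide) (by decide) (by decide)
      (by decide),
    cup₁_summand a b (A := {2}) (μ := 1) (1) {1, 2} {0, 1, 3} 0 0 0 (-1) (by decide) (by decide) (by decide)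
      (by decide),
    cup₁_summand a b (A := {3}) (μ := 1) (-1) {1, 3} {0, 1, 2} 0 0 (-1) 0 (by decide) (by decide) (by decide)
      (by decide),
    cup₁_summand a b (A := {0}) (μ := 2) (1) {0, 2} {1, 2, 3} 1 0 0 (-1) (by decide) (by decide) (by decide)
      (by decide),
    cup₁_summand a b (A := {1}) (μ := 2) (-1) {1, 2} {0, 2, 3} 0 1 0 (-1) (by decide) (by decide) (by decide)
      (by decide),
    cup₁_summand a b (A := {3}) (μ := 2) (1) {2, 3} {0, 1, 2} 0 0 0 0 (by decide) (by decide) (by decide)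
      (by decide),
    cup₁_summand a b (A := {0}) (μ := 3) (-1) {0, 3} {1, 2, 3} 1 0 0 0 (by decide) (by decide) (by decide)
      (by decide),
    cup₁_summand a b (A := {1}) (μ := 3) (1) {1, 3} {0, 2, 3} 0 1 0 0 (by decide) (by decide) (by decide)
      (by decide),
    cup₁_summand a b (A := {2}) (μ := 3) (-1) {2, 3} {0, 1, 3} 0 0 1 0 (by decide) (by decide) (by decide)
      (by decide)]
  rw [show ((Finset.univ : Finset (Fin 4)).filter fun ν => ν < 0).card = 0 by decide,
    show ((Finset.univ : Finset (Fin 4)).filter fun ν => ν < 1).card = 1 by decide,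
    show ((Finset.univ : Finset (Fin 4)).filter fun ν => ν < 2).card = 2 by decide,
    show ((Finset.univ : Finset (Fin 4)).filter fun ν => ν < 3).card = 3 by decide]
  push_cast
  ring

set_option maxHeartbeats 1000000 in
theorem latticeSum_cup₁_three_two (a : Form N 3 K) (b : Form N 2 K) :
    latticeSum (cup₁ a b) =
      -corr a b {0, 1, 2} {0, 3} (siteOf 0 0 0 (-1))
      + corr a b {0, 1, 3} {0, 2} (siteOf 0 0 (-1) 0)
      - corr a b {0, 2, 3} {0, 1} (siteOf 0 (-1) 0 0)
      - corr a b {0, 1, 2} {1, 3} (siteOf 1 0 0 (-1))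
      + corr a b {0, 1, 3} {1, 2} (siteOf 1 0 (-1) 0)
      - corr a b {1, 2, 3} {0, 1} (siteOf 0 0 0 0)
      - corr a b {0, 1, 2} {2, 3} (siteOf 1 1 0 (-1))
      + corr a b {0, 2, 3} {1, 2} (siteOf 1 0 0 0)
      - corr a b {1, 2, 3} {0, 2} (siteOf 0 1 0 0)
      - corr a b {0, 1, 3} {2, 3} (siteOf 1 1 0 0)
      + corr a b {0, 2, 3} {1, 3} (siteOf 1 0 1 0)
      - corr a b {1, 2, 3} {0, 3} (siteOf 0 1 1 0) := by
  refine (latticeSum_cup₁ a b rfl).trans ?_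
  rw [Fin.sum_univ_four, sum_triple {1, 2} {1, 3} {2, 3} _ (by decide) (by decide) (by decide),
    sum_triple {0, 2} {0, 3} {2, 3} _ (by decide) (by decide) (by decide),
    sum_triple {0, 1} {0, 3} {1, 3} _ (by decide) (by decide) (by decide),
    sum_triple {0, 1} {0, 2} {1, 2} _ (by decide) (by decide) (by decide)]
  rw [cup₁_summand a b (A := {1, 2}) (μ := 0) (1) {0, 1, 2} {0, 3} 0 0 0 (-1) (by decide) (by decide) (by decide)
      (by decide),
    cup₁_summand a b (A := {1, 3}) (μ := 0) (-1) {0, 1, 3} {0, 2} 0 0 (-1) 0 (by decide) (by decide) (by decide)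
      (by decide),
    cup₁_summand a b (A := {2, 3}) (μ := 0) (1) {0, 2, 3} {0, 1} 0 (-1) 0 0 (by decide) (by decide) (by decide)
      (by decide),
    cup₁_summand a b (A := {0, 2}) (μ := 1) (-1) {0, 1, 2} {1, 3} 1 0 0 (-1) (by decide) (by decide) (by decide)
      (by decide),
    cup₁_summand a b (A := {0, 3}) (μ := 1) (1) {0, 1, 3} {1, 2} 1 0 (-1) 0 (by decide) (by decide) (by decide)
      (by decide),
    cup₁_summand a b (A := {2, 3}) (μ := 1) (-1) {1, 2, 3} {0, 1} 0 0 0 0 (by decide) (by decide) (by decide)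
      (by decide),
    cup₁_summand a b (A := {0, 1}) (μ := 2) (1) {0, 1, 2} {2, 3} 1 1 0 (-1) (by decide) (by decide) (by decide)
      (by decide),
    cup₁_summand a b (A := {0, 3}) (μ := 2) (-1) {0, 2, 3} {1, 2} 1 0 0 0 (by decide) (by decide) (by decide)
      (by decide),
    cup₁_summand a b (A := {1, 3}) (μ := 2) (1) {1, 2, 3} {0, 2} 0 1 0 0 (by decide) (by decide) (by decide)
      (by decide),
    cup₁_summand a b (A := {0, 1}) (μ := 3) (-1) {0, 1, 3} {2, 3} 1 1 0 0 (by decide) (by decide) (by decide)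
      (by decide),
    cup₁_summand a b (A := {0, 2}) (μ := 3) (1) {0, 2, 3} {1, 3} 1 0 1 0 (by decide) (by decide) (by decide)
      (by decide),
    cup₁_summand a b (A := {1, 2}) (μ := 3) (-1) {1, 2, 3} {0, 3} 0 1 1 0 (by decide) (by decide) (by decide)
      (by decide)]
  rw [show ((Finset.univ : Finset (Fin 4)).filter fun ν => ν < 0).card = 0 by decide,
    show ((Finset.univ : Finset (Fin 4)).filter fun ν => ν < 1).card = 1 by decide,
    show ((Finset.univ : Finset (Fin 4)).filter fun ν => ν < 2).card = 2 by decide,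
    show ((Finset.univ : Finset (Fin 4)).filter fun ν => ν < 3).card = 3 by decide]
  push_cast
  ring

set_option maxHeartbeats 1000000 in
/-- The cup product of 2-forms is commutative up to the `∪₁` products with the differentials. -/
theorem latticeSum_cup_comm (a b : Form N 2 K) :
    latticeSum (cup b a) = latticeSum (cup a b) - latticeSum (cup₁ a (extd b)) -
      latticeSum (cup₁ (extd a) b) := by
  -- Exchanging the factors reverses the offset, so both sides become combinations of correlations
  -- of `a` with `b`.
  have hc (S T : Finset (Fin 4)) (z₀ z₁ z₂ z₃ : ℤ) : corr b a S T (siteOf z₀ z₁ z₂ z₃) =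
      corr a b T S (siteOf (-z₀) (-z₁) (-z₂) (-z₃)) := by
    have := sum_comp_mul_comp b a S T (-siteOf z₀ z₁ z₂ z₃) 0
    have h' := sum_comp_mul_comp a b T S 0 (-siteOf z₀ z₁ z₂ z₃)
    rw [zero_sub, neg_neg] at this
    rw [← this]
    simp_rw [mul_comm (comp b _ _)]
    rw [h', sub_zero, ← zero_sub, ← siteOf_zero, siteOf_sub]
    simp
  rw [latticeSum_cup_two, latticeSum_cup_two, latticeSum_cup₁_two_three, latticeSum_cup₁_three_two]
  simp only [hc, corr_extd_triple_right _ _ _ _ 0 1 2 (by decide) (by decide),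
    corr_extd_triple_left _ _ _ _ 0 1 2 (by decide) (by decide), corr_extd_triple_right _ _ _ _ 0 1 3 (by decide) (by decide),
    corr_extd_triple_left _ _ _ _ 0 1 3 (by decide) (by decide), corr_extd_triple_right _ _ _ _ 0 2 3 (by decide) (by decide),
    corr_extd_triple_left _ _ _ _ 0 2 3 (by decide) (by decide), corr_extd_triple_right _ _ _ _ 1 2 3 (by decide) (by decide),
    corr_extd_triple_left _ _ _ _ 1 2 3 (by decide) (by decide)]
  simp only [hat_zero, hat_one, hat_two, hat_three, siteOf_add, siteOf_sub]
  norm_num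
  ring

end Explicit

/-! ### Inner products, the boundary operator and the Hodge star -/

section Star

variable {N : ℕ} {K : Type} [CommRing K]

/-- The lattice Hodge star of a 2-form, characterized by `∑ₓ a ∪ b = a · ⋆b`. -/
def star₂ (b : Form N 2 K) : Form N 2 K := fun c =>
  (shuffleSign c.2.1 (c.2.1)ᶜ : K) * comp b (c.1 + hat c.2.1) (c.2.1)ᶜ

/-- The lattice Hodge star of a 3-form, characterized by `∑ₓ a ∪ b = -a · ⋆b`. -/
def star₃ (b : Form N 3 K) : Form N 1 K := fun c =>
  -((shuffleSign c.2.1 (c.2.1)ᶜ : K) * comp b (c.1 + hat c.2.1) (c.2.1)ᶜ)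

theorem comp_star₂ (b : Form N 2 K) (x : Site N) {S : Finset (Fin 4)} (h : S.card = 2) :
    comp (star₂ b) x S = (shuffleSign S Sᶜ : K) * comp b (x + hat S) Sᶜ := by
  rw [comp_of_card _ _ h]; rfl

theorem comp_star₃ (b : Form N 3 K) (x : Site N) {S : Finset (Fin 4)} (h : S.card = 1) :
    comp (star₃ b) x S = -((shuffleSign S Sᶜ : K) * comp b (x + hat S) Sᶜ) := by
  rw [comp_of_card _ _ h]; rfl

theorem comp_bdry_of_compl {r : ℕ} (B : Form N (r + 1) K) (x : Site N) {S : Finset (Fin 4)}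
    (k l : Fin 4) (S₁ S₂ : Finset (Fin 4)) (s₁ s₂ : ℤ) (h : S.card = r) (hkl : k ≠ l)
    (hS : Sᶜ = {k, l}) (hS₁ : insert k S = S₁) (hS₂ : insert l S = S₂)
    (hs₁ : shuffleSign S {k} = s₁) (hs₂ : shuffleSign S {l} = s₂) :
    comp (bdry B) x S = s₁ * (comp B x S₁ - comp B (x - hat {k}) S₁) +
      s₂ * (comp B x S₂ - comp B (x - hat {l}) S₂) := by
  rw [comp_bdry _ _ h, hS, Finset.sum_pair hkl, hS₁, hS₂, hs₁, hs₂]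

/-- The translation by `hat S` built into the star turns the backward differences of `∂` into the
forward differences of `d`. This has two uses: cup products of coexact forms sum to zero, and the
coexact part of `l` acts as a source lying inside the space of exact forms. -/
theorem star₂_bdry (B : Form N 3 K) : star₂ (bdry B) = extd (star₃ B) := by
  refine form_ext fun x S hS => ?_
  have key (i j k l : Fin 4) (hij : i < j) (s s₁ s₂ : ℤ)
      (hc : ({i, j} : Finset (Fin 4))ᶜ = {k, l}) (hkl : k ≠ l)
      (hc' : ({k, l} : Finset (Fin 4))ᶜ = {i, j})
      (hs : shuffleSign {i, j} {k, l} = s) (h₁ : shuffleSign {k, l} {i} = s₁)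
      (h₂ : shuffleSign {k, l} {j} = s₂) (hi : shuffleSign {i} {i}ᶜ = s * s₂)
      (hj : shuffleSign {j} {j}ᶜ = - (s * s₁))
      (hki : insert i {k, l} = ({j} : Finset (Fin 4))ᶜ)
      (hkj : insert j {k, l} = ({i} : Finset (Fin 4))ᶜ)
      (hh : (hat {i, j} : Site N) = hat {i} + hat {j}) :
      comp (star₂ (bdry B)) x {i, j} = comp (extd (star₃ B)) x {i, j} := by
    rw [comp_star₂ _ _ (Finset.card_pair hij.ne), comp_extd_pair _ _ _ hij, hc, hs,
      comp_bdry_of_compl B _ i j _ _ s₁ s₂ (Finset.card_pair hkl) hij.ne hc' hki hkj h₁ h₂,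
      comp_star₃ _ _ (Finset.card_singleton _), comp_star₃ _ _ (Finset.card_singleton _),
      comp_star₃ _ _ (Finset.card_singleton _), comp_star₃ _ _ (Finset.card_singleton _),
      hi, hj, hh, show x + (hat {i} + hat {j}) - hat {i} = x + hat {j} by abel,
      show x + (hat {i} + hat {j}) - hat {j} = x + hat {i} by abel, add_right_comm x (hat {j}),
      ← add_assoc]
    push_cast
    ring
  have : S ∈ ({{0, 1}, {0, 2}, {0, 3}, {1, 2}, {1, 3}, {2, 3}} : Finset (Finset (Fin 4))) := by
    revert S; decide
  simp only [Finset.mem_insert, Finset.mem_singleton] at this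
  have hh (i j : Fin 4) (hij : i < j) : (hat {i, j} : Site N) = hat {i} + hat {j} := by
    funext ν
    have := hij.ne
    simp only [hat, Pi.add_apply, Finset.mem_insert, Finset.mem_singleton]
    split_ifs <;> simp_all
  rcases this with rfl | rfl | rfl | rfl | rfl | rfl
  · exact key 0 1 2 3 (by decide) 1 1 1 (by decide) (by decide) (by decide) (by decide) (by decide)
      (by decide) (by decide) (by decide) (by decide) (by decide) (hh _ _ (by decide))
  · exact key 0 2 1 3 (by decide) (-1) 1 (-1) (by decide) (by decide) (by decide) (by decide)
      (by decide) (by decide) (by decide) (by decide) (by decide) (by decide) (hh _ _ (by decide))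
  · exact key 0 3 1 2 (by decide) 1 1 1 (by decide) (by decide) (by decide) (by decide) (by decide)
      (by decide) (by decide) (by decide) (by decide) (by decide) (hh _ _ (by decide))
  · exact key 1 2 0 3 (by decide) 1 (-1) (-1) (by decide) (by decide) (by decide) (by decide)
      (by decide) (by decide) (by decide) (by decide) (by decide) (by decide) (hh _ _ (by decide))
  · exact key 1 3 0 2 (by decide) (-1) (-1) 1 (by decide) (by decide) (by decide) (by decide)
      (by decide) (by decide) (by decide) (by decide) (by decide) (by decide) (hh _ _ (by decide))
  · exact key 2 3 0 1 (by decide) 1 1 1 (by decide) (by decide) (by decide) (by decide)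
      (by decide) (by decide) (by decide) (by decide) (by decide) (by decide) (hh _ _ (by decide))

variable [NeZero N]

theorem sum_cell {r : ℕ} {M : Type*} [AddCommMonoid M] (f : Site N → Finset (Fin 4) → M) :
    ∑ c : Cell N r, f c.1 c.2.1 =
      ∑ S ∈ (Finset.univ : Finset (Fin 4)).powersetCard r, ∑ x, f x S := by
  rw [Fintype.sum_prod_type, Finset.sum_comm]
  symm
  exact Finset.sum_subtype _ (by simp [Finset.mem_powersetCard]) _

theorem dot_eq_sum_corr {r : ℕ} (a b : Form N r K) :
    dot a b = ∑ S ∈ (Finset.univ : Finset (Fin 4)).powersetCard r, corr a b S S 0 := by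
  unfold dot corr
  simp only [add_zero, apply_eq_comp a, apply_eq_comp b]
  exact sum_cell (r := r) fun x S => comp a x S * comp b x S

theorem latticeSum_cup_eq_dot (a b : Form N 2 K) : latticeSum (cup a b) = dot a (star₂ b) := by
  refine (latticeSum_cup a b rfl).trans ?_
  rw [dot_eq_sum_corr]
  refine Finset.sum_congr rfl fun S hS => ?_
  unfold corr
  rw [Finset.mul_sum]
  refine Finset.sum_congr rfl fun x _ => ?_
  rw [comp_star₂ _ _ (Finset.mem_powersetCard.1 hS).2, add_zero, ← Finset.compl_eq_univ_sdiff]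
  ring

theorem latticeSum_cup_one_three_eq_dot (a : Form N 1 K) (b : Form N 3 K) :
    latticeSum (cup a b) = -dot a (star₃ b) := by
  refine (latticeSum_cup a b rfl).trans ?_
  rw [dot_eq_sum_corr, ← Finset.sum_neg_distrib]
  refine Finset.sum_congr rfl fun S hS => ?_
  unfold corr
  rw [Finset.mul_sum, ← Finset.sum_neg_distrib]
  refine Finset.sum_congr rfl fun x _ => ?_
  rw [comp_star₃ _ _ (Finset.mem_powersetCard.1 hS).2, add_zero, ← Finset.compl_eq_univ_sdiff]
  ring

theorem corr_shift {p q : ℕ} (a : Form N p K) (b : Form N q K) (S T : Finset (Fin 4))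
    (s : Site N) : ∑ x, comp a (x + s) S * comp b (x + s) T = corr a b S T 0 := by
  rw [sum_comp_mul_comp, sub_self]

theorem shuffleSign_mul_self (A B : Finset (Fin 4)) :
    (shuffleSign A B : K) * shuffleSign A B = 1 := by
  unfold shuffleSign
  rw [← Int.cast_mul, ← mul_pow]; simp

/-- The star permutes the cells up to signs, and the signs square to one. -/
theorem dot_star₂ (a b : Form N 2 K) : dot (star₂ a) (star₂ b) = dot a b := by
  have h (S : Finset (Fin 4)) (hS : S.card = 2) :
      corr (star₂ a) (star₂ b) S S 0 = corr a b Sᶜ Sᶜ 0 := by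
    rw [← corr_shift a b _ _ (hat S)]
    refine Finset.sum_congr rfl fun x _ => ?_
    rw [comp_star₂ _ _ hS, comp_star₂ _ _ hS, add_zero]
    linear_combination (comp a (x + hat S) Sᶜ * comp b (x + hat S) Sᶜ) *
      shuffleSign_mul_self (K := K) S Sᶜ
  rw [dot_eq_sum_corr, dot_eq_sum_corr, Finset.sum_congr rfl fun S hS =>
    h S (Finset.mem_powersetCard.1 hS).2]
  refine Finset.sum_nbij' compl compl ?_ ?_ (by simp) (by simp) (by simp) <;>
  · intro S hS
    rw [Finset.mem_powersetCard] at hS ⊢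
    refine ⟨Finset.subset_univ _, ?_⟩
    rw [Finset.card_compl, hS.2]; rfl

theorem dot_star₃ (a b : Form N 3 K) : dot (star₃ a) (star₃ b) = dot a b := by
  have h (S : Finset (Fin 4)) (hS : S.card = 1) :
      corr (star₃ a) (star₃ b) S S 0 = corr a b Sᶜ Sᶜ 0 := by
    rw [← corr_shift a b _ _ (hat S)]
    refine Finset.sum_congr rfl fun x _ => ?_
    rw [comp_star₃ _ _ hS, comp_star₃ _ _ hS, add_zero]
    linear_combination (comp a (x + hat S) Sᶜ * comp b (x + hat S) Sᶜ) *
      shuffleSign_mul_self (K := K) S Sᶜ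
  rw [dot_eq_sum_corr, dot_eq_sum_corr, Finset.sum_congr rfl fun S hS =>
    h S (Finset.mem_powersetCard.1 hS).2]
  refine Finset.sum_nbij' compl compl ?_ ?_ (by simp) (by simp) (by simp) <;>
  · intro S hS
    rw [Finset.mem_powersetCard] at hS ⊢
    refine ⟨Finset.subset_univ _, ?_⟩
    rw [Finset.card_compl, hS.2]; rfl

theorem corr_bdry_left {r q : ℕ} (B : Form N (r + 1) K) (b : Form N q K) {S : Finset (Fin 4)}
    (T : Finset (Fin 4)) (h : S.card = r) (z : Site N) :
    corr (bdry B) b S T z = ∑ ν ∈ Sᶜ, (shuffleSign S {ν} : K) *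
      (corr B b (insert ν S) T z - corr B b (insert ν S) T (z + hat {ν})) := by
  have key (ν) : corr B b (insert ν S) T (z + hat {ν}) =
      ∑ x, comp B (x - hat {ν}) (insert ν S) * comp b (x + z) T := by
    simp_rw [sub_eq_add_neg _ (hat {ν} : Site N)]
    rw [sum_comp_mul_comp, sub_neg_eq_add]
  simp_rw [key]
  unfold corr
  simp_rw [comp_bdry _ _ h, Finset.sum_mul]
  rw [Finset.sum_comm]
  refine Finset.sum_congr rfl fun ν _ => ?_
  rw [← Finset.sum_sub_distrib, Finset.mul_sum]
  refine Finset.sum_congr rfl fun x _ => ?_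
  ring

theorem corr_bdry_left_of_compl {r q : ℕ} {B : Form N (r + 1) K} {b : Form N q K}
    {S T : Finset (Fin 4)} {z : Site N} (k l : Fin 4) (S₁ S₂ : Finset (Fin 4)) (s₁ s₂ : ℤ)
    (h : S.card = r) (hkl : k ≠ l)
    (hS : Sᶜ = {k, l}) (hS₁ : insert k S = S₁) (hS₂ : insert l S = S₂)
    (hs₁ : shuffleSign S {k} = s₁) (hs₂ : shuffleSign S {l} = s₂) :
    corr (bdry B) b S T z = s₁ * (corr B b S₁ T z - corr B b S₁ T (z + hat {k})) +
      s₂ * (corr B b S₂ T z - corr B b S₂ T (z + hat {l})) := by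
  rw [corr_bdry_left _ _ _ h, hS, Finset.sum_pair hkl, hS₁, hS₂, hs₁, hs₂]

theorem corr_bdry_left_singleton {r q : ℕ} {B : Form N (r + 1) K} {b : Form N q K}
    {S T : Finset (Fin 4)} {z : Site N} (j k l : Fin 4) (S₁ S₂ S₃ : Finset (Fin 4)) (s₁ s₂ s₃ : ℤ)
    (h : S.card = r) (hS : Sᶜ = {j, k, l}) (hj : j ∉ ({k, l} : Finset (Fin 4))) (hkl : k ≠ l)
    (hS₁ : insert j S = S₁) (hS₂ : insert k S = S₂) (hS₃ : insert l S = S₃)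
    (hs₁ : shuffleSign S {j} = s₁) (hs₂ : shuffleSign S {k} = s₂) (hs₃ : shuffleSign S {l} = s₃) :
    corr (bdry B) b S T z = s₁ * (corr B b S₁ T z - corr B b S₁ T (z + hat {j})) +
      s₂ * (corr B b S₂ T z - corr B b S₂ T (z + hat {k})) +
      s₃ * (corr B b S₃ T z - corr B b S₃ T (z + hat {l})) := by
  rw [corr_bdry_left _ _ _ h, sum_triple_directions j k l _ hS hj hkl, hS₁, hS₂, hS₃, hs₁, hs₂, hs₃]
  ring

end Star

/-! ### Adjointness and the Laplacian -/

section Laplacian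

variable {N : ℕ} [NeZero N] {K : Type} [CommRing K]

theorem corr_extd_pair_right {p : ℕ} (a : Form N p K) (b : Form N 1 K) (S : Finset (Fin 4))
    (z : Site N) (i j : Fin 4) (h : i < j) :
    corr a (extd b) S {i, j} z =
      (corr a b S {j} (z + hat {i}) - corr a b S {j} z) -
        (corr a b S {i} (z + hat {j}) - corr a b S {i} z) := by
  rw [corr_extd_right _ _ _ (Finset.card_pair h.ne), sum_pair_directions i j _ rfl h.ne,
    show ({i, j} : Finset (Fin 4)).erase i = {j} by revert i j; decide,
    show ({i, j} : Finset (Fin 4)).erase j = {i} by revert i j; decide,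
    show shuffleSign {i} {j} = 1 by revert i j; decide,
    show shuffleSign {j} {i} = -1 by revert i j; decide]
  push_cast; ring

/-- The adjoint of `d` on `r`-forms is `(-1)^(r+1) ∂`: backward differences are minus the adjoints
of forward ones, and `∂` appends the new direction at the end while `d` takes it first. Hence the
minus sign for `r = 2` and its absence in `dot_bdry_two`. -/
theorem dot_bdry_three (B : Form N 3 K) (a : Form N 2 K) : dot (bdry B) a = -dot B (extd a) := by
  rw [dot_eq_sum_corr, dot_eq_sum_corr, sum_univ_powersetCard_two, sum_univ_powersetCard_three]
  simp only [corr_bdry_left_of_compl (r := 2) (S := {0, 1}) 2 3 {0, 1, 2} {0, 1, 3} 1 1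
      (by decide) (by decide) (by decide) (by decide) (by decide) (by decide) (by decide),
    corr_bdry_left_of_compl (r := 2) (S := {0, 2}) 1 3 {0, 1, 2} {0, 2, 3} (-1) 1
      (by decide) (by decide) (by decide) (by decide) (by decide) (by decide) (by decide),
    corr_bdry_left_of_compl (r := 2) (S := {0, 3}) 1 2 {0, 1, 3} {0, 2, 3} (-1) (-1)
      (by decide) (by decide) (by decide) (by decide) (by decide) (by decide) (by decide),
    corr_bdry_left_of_compl (r := 2) (S := {1, 2}) 0 3 {0, 1, 2} {1, 2, 3} 1 1
      (by decide) (by decide) (by decide) (by decide) (by decide) (by decide) (by decide),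
    corr_bdry_left_of_compl (r := 2) (S := {1, 3}) 0 2 {0, 1, 3} {1, 2, 3} 1 (-1)
      (by decide) (by decide) (by decide) (by decide) (by decide) (by decide) (by decide),
    corr_bdry_left_of_compl (r := 2) (S := {2, 3}) 0 1 {0, 2, 3} {1, 2, 3} 1 1
      (by decide) (by decide) (by decide) (by decide) (by decide) (by decide) (by decide)]
  simp only [corr_extd_triple_right _ _ _ _ 0 1 2 (by decide) (by decide),
    corr_extd_triple_right _ _ _ _ 0 1 3 (by decide) (by decide),
    corr_extd_triple_right _ _ _ _ 0 2 3 (by decide) (by decide),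
    corr_extd_triple_right _ _ _ _ 1 2 3 (by decide) (by decide)]
  simp only [hat_zero, hat_one, hat_two, hat_three, siteOf_add, ← siteOf_zero]
  norm_num
  ring

theorem dot_bdry_two (b : Form N 2 K) (A : Form N 1 K) : dot (bdry b) A = dot b (extd A) := by
  rw [dot_eq_sum_corr, dot_eq_sum_corr, sum_univ_powersetCard_one, sum_univ_powersetCard_two]
  simp only [corr_bdry_left_singleton (r := 1) (S := {0}) 1 2 3 {0, 1} {0, 2} {0, 3} 1 1 1
      (by decide) (by decide) (by decide) (by decide) (by decide) (by decide) (by decide)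
      (by decide) (by decide) (by decide),
    corr_bdry_left_singleton (r := 1) (S := {1}) 0 2 3 {0, 1} {1, 2} {1, 3} (-1) 1 1
      (by decide) (by decide) (by decide) (by decide) (by decide) (by decide) (by decide)
      (by decide) (by decide) (by decide),
    corr_bdry_left_singleton (r := 1) (S := {2}) 0 1 3 {0, 2} {1, 2} {2, 3} (-1) (-1) 1
      (by decide) (by decide) (by decide) (by decide) (by decide) (by decide) (by decide)
      (by decide) (by decide) (by decide),
    corr_bdry_left_singleton (r := 1) (S := {3}) 0 1 2 {0, 3} {1, 3} {2, 3} (-1) (-1) (-1)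
      (by decide) (by decide) (by decide) (by decide) (by decide) (by decide) (by decide)
      (by decide) (by decide) (by decide)]
  simp only [corr_extd_pair_right _ _ _ _ 0 1 (by decide),
    corr_extd_pair_right _ _ _ _ 0 2 (by decide),
    corr_extd_pair_right _ _ _ _ 0 3 (by decide),
    corr_extd_pair_right _ _ _ _ 1 2 (by decide),
    corr_extd_pair_right _ _ _ _ 1 3 (by decide),
    corr_extd_pair_right _ _ _ _ 2 3 (by decide)]
  simp only [hat_zero, hat_one, hat_two, hat_three, siteOf_add, ← siteOf_zero]
  norm_num
  ring

set_option maxHeartbeats 1000000 in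
/-- `d∂ - ∂d` is minus the lattice Laplacian, componentwise. -/
theorem dot_laplacian (a b : Form N 2 K) :
    dot (r := 2) (extd (bdry a)) b - dot (bdry (extd a)) b =
      ∑ S ∈ (Finset.univ : Finset (Fin 4)).powersetCard 2, ∑ μ : Fin 4,
        (2 * corr a b S S 0 - corr a b S S (hat {μ}) - corr a b S S (0 - hat {μ})) := by
  rw [dot_eq_sum_corr, dot_eq_sum_corr]
  simp only [sum_univ_powersetCard_two, Fin.sum_univ_four]
  simp only [corr_bdry_left_of_compl (r := 2) (S := {0, 1}) 2 3 {0, 1, 2} {0, 1, 3} 1 1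
      (by decide) (by decide) (by decide) (by decide) (by decide) (by decide) (by decide),
    corr_bdry_left_of_compl (r := 2) (S := {0, 2}) 1 3 {0, 1, 2} {0, 2, 3} (-1) 1
      (by decide) (by decide) (by decide) (by decide) (by decide) (by decide) (by decide),
    corr_bdry_left_of_compl (r := 2) (S := {0, 3}) 1 2 {0, 1, 3} {0, 2, 3} (-1) (-1)
      (by decide) (by decide) (by decide) (by decide) (by decide) (by decide) (by decide),
    corr_bdry_left_of_compl (r := 2) (S := {1, 2}) 0 3 {0, 1, 2} {1, 2, 3} 1 1
      (by decide) (by decide) (by decide) (by decide) (by decide) (by decide) (by decide),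
    corr_bdry_left_of_compl (r := 2) (S := {1, 3}) 0 2 {0, 1, 3} {1, 2, 3} 1 (-1)
      (by decide) (by decide) (by decide) (by decide) (by decide) (by decide) (by decide),
    corr_bdry_left_of_compl (r := 2) (S := {2, 3}) 0 1 {0, 2, 3} {1, 2, 3} 1 1
      (by decide) (by decide) (by decide) (by decide) (by decide) (by decide) (by decide)]
  rw [corr_extd_pair_left _ _ _ _ 0 1 (by decide),
    corr_extd_pair_left _ _ _ _ 0 2 (by decide),
    corr_extd_pair_left _ _ _ _ 0 3 (by decide),
    corr_extd_pair_left _ _ _ _ 1 2 (by decide),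
    corr_extd_pair_left _ _ _ _ 1 3 (by decide),
    corr_extd_pair_left _ _ _ _ 2 3 (by decide)]
  simp only [corr_bdry_left_singleton (r := 1) (S := {0}) 1 2 3 {0, 1} {0, 2} {0, 3} 1 1 1
      (by decide) (by decide) (by decide) (by decide) (by decide) (by decide) (by decide)
      (by decide) (by decide) (by decide),
    corr_bdry_left_singleton (r := 1) (S := {1}) 0 2 3 {0, 1} {1, 2} {1, 3} (-1) 1 1
      (by decide) (by decide) (by decide) (by decide) (by decide) (by decide) (by decide)
      (by decide) (by decide) (by decide),
    corr_bdry_left_singleton (r := 1) (S := {2}) 0 1 3 {0, 2} {1, 2} {2, 3} (-1) (-1) 1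
      (by decide) (by decide) (by decide) (by decide) (by decide) (by decide) (by decide)
      (by decide) (by decide) (by decide),
    corr_bdry_left_singleton (r := 1) (S := {3}) 0 1 2 {0, 3} {1, 3} {2, 3} (-1) (-1) (-1)
      (by decide) (by decide) (by decide) (by decide) (by decide) (by decide) (by decide)
      (by decide) (by decide) (by decide),
    corr_extd_triple_left _ _ _ _ 0 1 2 (by decide) (by decide),
    corr_extd_triple_left _ _ _ _ 0 1 3 (by decide) (by decide),
    corr_extd_triple_left _ _ _ _ 0 2 3 (by decide) (by decide),
    corr_extd_triple_left _ _ _ _ 1 2 3 (by decide) (by decide)]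
  simp only [hat_zero, hat_one, hat_two, hat_three, siteOf_add, siteOf_sub, ← siteOf_zero]
  norm_num
  ring

end Laplacian

/-! ### Linearity -/

section Linearity

variable {N : ℕ} {K : Type} [CommRing K]

theorem extd_add {r : ℕ} (a b : Form N r K) : extd (a + b) = extd a + extd b := by
  funext c
  simp only [extd, comp_add, Pi.add_apply, ← Finset.sum_add_distrib]
  exact Finset.sum_congr rfl fun μ _ => by ring

theorem extd_smul {r : ℕ} (t : K) (a : Form N r K) : extd (t • a) = t • extd a := by
  funext c
  simp only [extd, comp_smul, Pi.smul_apply, smul_eq_mul, Finset.mul_sum]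
  exact Finset.sum_congr rfl fun μ _ => by ring

theorem bdry_add {r : ℕ} (a b : Form N (r + 1) K) : bdry (a + b) = bdry a + bdry b := by
  funext c
  simp only [bdry, comp_add, Pi.add_apply, ← Finset.sum_add_distrib]
  exact Finset.sum_congr rfl fun μ _ => by ring

theorem bdry_smul {r : ℕ} (t : K) (a : Form N (r + 1) K) : bdry (t • a) = t • bdry a := by
  funext c
  simp only [bdry, comp_smul, Pi.smul_apply, smul_eq_mul, Finset.mul_sum]
  exact Finset.sum_congr rfl fun μ _ => by ring

theorem star₂_add (a b : Form N 2 K) : star₂ (a + b) = star₂ a + star₂ b := by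
  funext c; simp only [star₂, comp_add, Pi.add_apply]; ring

theorem star₂_smul (t : K) (a : Form N 2 K) : star₂ (t • a) = t • star₂ a := by
  funext c; simp only [star₂, comp_smul, Pi.smul_apply, smul_eq_mul]; ring

theorem star₃_add (a b : Form N 3 K) : star₃ (a + b) = star₃ a + star₃ b := by
  funext c; simp only [star₃, comp_add, Pi.add_apply]; ring

theorem star₃_smul (t : K) (a : Form N 3 K) : star₃ (t • a) = t • star₃ a := by
  funext c; simp only [star₃, comp_smul, Pi.smul_apply, smul_eq_mul]; ring

/-- The exterior derivative as a linear map. -/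
def extdₗ (N r : ℕ) (K : Type) [CommRing K] : Form N r K →ₗ[K] Form N (r + 1) K where
  toFun := extd
  map_add' := extd_add
  map_smul' := extd_smul

/-- The boundary operator as a linear map. -/
def bdryₗ (N r : ℕ) (K : Type) [CommRing K] : Form N (r + 1) K →ₗ[K] Form N r K where
  toFun := bdry
  map_add' := bdry_add
  map_smul' := bdry_smul

theorem extd_zero {r : ℕ} : extd (0 : Form N r K) = 0 := (extdₗ N r K).map_zero

theorem extd_sub {r : ℕ} (a b : Form N r K) : extd (a - b) = extd a - extd b :=
  (extdₗ N r K).map_sub a b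

theorem star₃_sub (a b : Form N 3 K) : star₃ (a - b) = star₃ a - star₃ b := by
  funext c; simp only [star₃, comp_sub, Pi.sub_apply]; ring

theorem toReal_add {r : ℕ} (a b : Form N r ℤ) : toReal (a + b) = toReal a + toReal b := by
  funext c; simp [toReal]

theorem toReal_zsmul {r : ℕ} (k : ℤ) (a : Form N r ℤ) : toReal (k • a) = (k : ℝ) • toReal a := by
  funext c; simp [toReal]

theorem toReal_sub {r : ℕ} (a b : Form N r ℤ) : toReal (a - b) = toReal a - toReal b := by
  funext c; simp [toReal]

theorem toReal_zero {r : ℕ} : toReal (0 : Form N r ℤ) = 0 := by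
  funext c; simp [toReal]

theorem extd_toReal {r : ℕ} (n : Form N r ℤ) : extd (toReal n) = toReal (extd n) := by
  funext c
  simp only [extd, toReal, Int.cast_sum, Int.cast_mul, Int.cast_sub]
  refine Finset.sum_congr rfl fun μ _ => ?_
  rw [comp_toReal, comp_toReal]
  simp

variable [NeZero N]

theorem dot_add_left {r : ℕ} (a b c : Form N r K) : dot (a + b) c = dot a c + dot b c := by
  simp [dot, add_mul, Finset.sum_add_distrib]

theorem dot_add_right {r : ℕ} (a b c : Form N r K) : dot a (b + c) = dot a b + dot a c := by
  simp [dot, mul_add, Finset.sum_add_distrib]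

theorem dot_smul_left {r : ℕ} (t : K) (a b : Form N r K) : dot (t • a) b = t * dot a b := by
  simp [dot, Finset.mul_sum, mul_assoc]

theorem dot_smul_right {r : ℕ} (t : K) (a b : Form N r K) : dot a (t • b) = t * dot a b := by
  simp [dot, Finset.mul_sum, mul_left_comm]

theorem dot_comm {r : ℕ} (a b : Form N r K) : dot a b = dot b a := by
  simp [dot, mul_comm]

theorem dot_zero_left {r : ℕ} (b : Form N r K) : dot 0 b = 0 := by simp [dot]

theorem dot_zero_right {r : ℕ} (b : Form N r K) : dot b 0 = 0 := by simp [dot]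

theorem dot_sub_left {r : ℕ} (a b c : Form N r K) : dot (a - b) c = dot a c - dot b c := by
  simp [dot, sub_mul]

theorem dot_sub_right {r : ℕ} (a b c : Form N r K) : dot a (b - c) = dot a b - dot a c := by
  simp [dot, mul_sub]

theorem dot_self_eq_zero {r : ℕ} {K : Type} [CommRing K] [LinearOrder K] [IsStrictOrderedRing K]
    {a : Form N r K} (h : dot a a = 0) : a = 0 := by
  funext c
  have := (Finset.sum_eq_zero_iff_of_nonneg fun c _ => mul_self_nonneg (a c)).1 h c (Finset.mem_univ c)
  simpa using this

theorem star₃_injective {K : Type} [CommRing K] [LinearOrder K] [IsStrictOrderedRing K] :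
    Function.Injective (star₃ : Form N 3 K → Form N 1 K) := by
  intro a b h
  rw [← sub_eq_zero]
  refine dot_self_eq_zero ?_
  rw [← dot_star₃, star₃_sub, h, sub_self, dot_zero_left]

theorem corr_add_left {p q : ℕ} (a a' : Form N p K) (b : Form N q K) (S T : Finset (Fin 4))
    (z : Site N) : corr (a + a') b S T z = corr a b S T z + corr a' b S T z := by
  simp [corr, add_mul, Finset.sum_add_distrib]

theorem corr_smul_left {p q : ℕ} (t : K) (a : Form N p K) (b : Form N q K) (S T : Finset (Fin 4))
    (z : Site N) : corr (t • a) b S T z = t * corr a b S T z := by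
  simp [corr, Finset.mul_sum, mul_assoc]

theorem corr_smul_right {p q : ℕ} (t : K) (a : Form N p K) (b : Form N q K) (S T : Finset (Fin 4))
    (z : Site N) : corr a (t • b) S T z = t * corr a b S T z := by
  simp [corr, Finset.mul_sum, mul_left_comm]

theorem corr_zero_left {p q : ℕ} (b : Form N q K) (S T : Finset (Fin 4))
    (z : Site N) : corr (0 : Form N p K) b S T z = 0 := by
  simp [corr]

theorem corr_zero_right {p q : ℕ} (a : Form N p K) (S T : Finset (Fin 4))
    (z : Site N) : corr a (0 : Form N q K) S T z = 0 := by
  simp [corr]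

theorem corr_toReal {p q : ℕ} (a : Form N p ℤ) (b : Form N q ℤ) (S T : Finset (Fin 4))
    (z : Site N) : corr (toReal a) (toReal b) S T z = ((corr a b S T z : ℤ) : ℝ) := by
  simp [corr, comp_toReal]

theorem latticeSum_cup_add_left (a a' b : Form N 2 K) :
    latticeSum (cup (a + a') b) = latticeSum (cup a b) + latticeSum (cup a' b) := by
  simp only [latticeSum_cup_eq_dot, dot_add_left]

theorem latticeSum_cup_add_right (a b b' : Form N 2 K) :
    latticeSum (cup a (b + b')) = latticeSum (cup a b) + latticeSum (cup a b') := by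
  simp only [latticeSum_cup_eq_dot, star₂_add, dot_add_right]

theorem latticeSum_cup_smul_left (t : K) (a b : Form N 2 K) :
    latticeSum (cup (t • a) b) = t * latticeSum (cup a b) := by
  simp only [latticeSum_cup_eq_dot, dot_smul_left]

theorem latticeSum_cup_smul_right (t : K) (a b : Form N 2 K) :
    latticeSum (cup a (t • b)) = t * latticeSum (cup a b) := by
  simp only [latticeSum_cup_eq_dot, star₂_smul, dot_smul_right]

theorem latticeSum_cup_toReal (a b : Form N 2 ℤ) :
    latticeSum (cup (toReal a) (toReal b)) = ((latticeSum (cup a b) : ℤ) : ℝ) := by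
  simp only [latticeSum_cup_two, corr_toReal]
  push_cast; rfl

theorem latticeSum_cup₁_add_left (a a' : Form N 2 K) (b : Form N 3 K) :
    latticeSum (cup₁ (a + a') b) = latticeSum (cup₁ a b) + latticeSum (cup₁ a' b) := by
  simp only [latticeSum_cup₁_two_three, corr_add_left]; ring

theorem latticeSum_cup₁_smul_left (t : K) (a : Form N 2 K) (b : Form N 3 K) :
    latticeSum (cup₁ (t • a) b) = t * latticeSum (cup₁ a b) := by
  simp only [latticeSum_cup₁_two_three, corr_smul_left]; ring

theorem latticeSum_cup₁_smul_right (t : K) (a : Form N 2 K) (b : Form N 3 K) :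
    latticeSum (cup₁ a (t • b)) = t * latticeSum (cup₁ a b) := by
  simp only [latticeSum_cup₁_two_three, corr_smul_right]; ring

theorem latticeSum_cup₁_zero_right (a : Form N 2 K) : latticeSum (cup₁ a (0 : Form N 3 K)) = 0 := by
  simp only [latticeSum_cup₁_two_three, corr_zero_right]; ring

theorem latticeSum_cup₁_zero_left (b : Form N 2 K) : latticeSum (cup₁ (0 : Form N 3 K) b) = 0 := by
  simp only [latticeSum_cup₁_three_two, corr_zero_left]; ring

theorem latticeSum_cup₁_toReal (a : Form N 2 ℤ) (b : Form N 3 ℤ) :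
    latticeSum (cup₁ (toReal a) (toReal b)) = ((latticeSum (cup₁ a b) : ℤ) : ℝ) := by
  simp only [latticeSum_cup₁_two_three, corr_toReal]
  push_cast; rfl

/-- The Pontryagin square of a 2-form with values in any commutative ring. -/
def pontr (a : Form N 2 K) : K := latticeSum (cup a a) + latticeSum (cup₁ a (extd a))

/-- For closed `a`, the failure of `∑ a ∪ b` to be symmetric equals `∑ a ∪₁ db`, which is precisely
the cross term supplied by the `∪₁` part of the Pontryagin square. The cross terms therefore add up
to twice one cup product. -/
theorem pontr_add_of_closed {a : Form N 2 K} (b : Form N 2 K) (ha : extd a = 0) :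
    pontr (a + b) = latticeSum (cup a a) + pontr b + 2 * latticeSum (cup a b) := by
  unfold pontr
  have h := latticeSum_cup_comm a b
  rw [ha, latticeSum_cup₁_zero_left] at h
  rw [extd_add, ha, zero_add, latticeSum_cup_add_left, latticeSum_cup_add_right,
    latticeSum_cup_add_right, latticeSum_cup₁_add_left, h]
  ring

theorem pontr_smul (t : K) (a : Form N 2 K) : pontr (t • a) = t ^ 2 * pontr a := by
  unfold pontr
  rw [extd_smul, latticeSum_cup_smul_left, latticeSum_cup_smul_right, latticeSum_cup₁_smul_left,
    latticeSum_cup₁_smul_right]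
  ring

theorem pontr_toReal (n : Form N 2 ℤ) : pontr (toReal n) = ((pontryagin n : ℤ) : ℝ) := by
  unfold pontr pontryagin
  rw [extd_toReal, latticeSum_cup_toReal, latticeSum_cup₁_toReal]
  push_cast; rfl

theorem latticeSum_extd_cup_of_closed (A : Form N 1 K) {b : Form N 2 K} (hb : extd b = 0) :
    latticeSum (cup (extd A) b) = 0 := by
  rw [latticeSum_extd_cup, hb, latticeSum_cup_one_three_eq_dot]
  simp [dot, star₃]

end Linearity

/-! ### The Hodge decomposition of 2-forms on the torus -/

/-- The pairs of directions. -/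
abbrev Plane : Type := {S : Finset (Fin 4) // S.card = 2}

section Hodge

variable {N : ℕ} [NeZero N]

/-- The site on the `μ`-axis with coordinate `s`. -/
def axis (μ : Fin 4) (s : ZMod N) : Site N := fun ν => if ν = μ then s else 0

omit [NeZero N] in
theorem axis_one_add (μ : Fin 4) (s : ZMod N) : axis μ (1 + s) = hat {μ} + axis μ s := by
  funext ν; by_cases h : ν = μ <;> simp [axis, hat, h]

omit [NeZero N] in
theorem axis_zero (μ : Fin 4) : (axis μ 0 : Site N) = 0 := by
  funext ν; simp [axis]

theorem eq_of_shift_invariant {M : Type*} (g : Site N → M) (hg : ∀ x μ, g (x + hat {μ}) = g x)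
    (x y : Site N) : g x = g y := by
  have h1 (μ : Fin 4) (k : ℕ) (x : Site N) : g (x + axis μ (k : ZMod N)) = g x := by
    induction k with
    | zero => simp [axis_zero]
    | succ k ih =>
      rw [Nat.cast_succ, add_comm (k : ZMod N), axis_one_add, add_left_comm, add_comm, hg, ih]
  have h2 (μ : Fin 4) (s : ZMod N) (x : Site N) : g (x + axis μ s) = g x := by
    simpa using h1 μ s.val x
  have h3 (x : Site N) : g x = g 0 := by
    have : x = 0 + axis 0 (x 0) + axis 1 (x 1) + axis 2 (x 2) + axis 3 (x 3) := by
      funext ν; fin_cases ν <;> simp [axis]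
    rw [this, h2, h2, h2, h2]
  rw [h3, h3 y]

/-- The constant 2-form with total flux `h`. -/
def constForm (N : ℕ) (h : Plane → ℝ) : Form N 2 ℝ := fun c => h c.2 / N ^ 2

/-- The flux of a 2-form through the planes of the lattice, averaged over parallel planes. -/
def flux (a : Form N 2 ℝ) : Plane → ℝ := fun S => (∑ x, a (x, S)) / N ^ 2

theorem natCast_ne_zero_of_neZero : (N : ℝ) ≠ 0 := Nat.cast_ne_zero.2 (NeZero.ne N)

theorem card_site : Fintype.card (Site N) = N ^ 4 := by
  simp [ZMod.card]

theorem flux_constForm (h : Plane → ℝ) : flux (constForm N h) = h := by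
  have := natCast_ne_zero_of_neZero (N := N)
  funext S
  simp only [flux, constForm, Finset.sum_const, Finset.card_univ, card_site, nsmul_eq_mul]
  push_cast
  field_simp

theorem flux_add (a b : Form N 2 ℝ) : flux (a + b) = flux a + flux b := by
  funext S; simp [flux, Finset.sum_add_distrib, add_div]

theorem flux_smul (t : ℝ) (a : Form N 2 ℝ) : flux (t • a) = t • flux a := by
  funext S; simp [flux, ← Finset.mul_sum, mul_div_assoc]

omit [NeZero N] in
theorem constForm_add (h k : Plane → ℝ) : constForm N (h + k) = constForm N h + constForm N k := by
  funext c; simp [constForm, add_div]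

omit [NeZero N] in
theorem constForm_smul (t : ℝ) (h : Plane → ℝ) : constForm N (t • h) = t • constForm N h := by
  funext c; simp [constForm, mul_div_assoc]

theorem dot_constForm_left (h : Plane → ℝ) (a : Form N 2 ℝ) :
    dot (constForm N h) a = ∑ S, h S * flux a S := by
  unfold dot
  rw [Fintype.sum_prod_type, Finset.sum_comm]
  refine Finset.sum_congr rfl fun S _ => ?_
  simp only [constForm, flux, ← Finset.mul_sum]
  ring

theorem sum_comp_shift_sub {r : ℕ} {K : Type} [CommRing K] (a : Form N r K) (S : Finset (Fin 4))
    (z : Site N) : ∑ x, (comp a (x + z) S - comp a x S) = 0 := by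
  rw [Finset.sum_sub_distrib, sub_eq_zero]
  exact Equiv.sum_comp (Equiv.addRight z) fun x => comp a x S

theorem flux_extd (A : Form N 1 ℝ) : flux (extd A) = 0 := by
  funext S
  unfold flux
  rw [Pi.zero_apply, div_eq_zero_iff]
  left
  simp only [extd]
  rw [Finset.sum_comm]
  refine Finset.sum_eq_zero fun μ _ => ?_
  rw [← Finset.mul_sum, sum_comp_shift_sub, mul_zero]

theorem flux_bdry (B : Form N 3 ℝ) : flux (bdry B) = 0 := by
  funext S
  unfold flux
  rw [Pi.zero_apply, div_eq_zero_iff]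
  left
  simp only [bdry]
  rw [Finset.sum_comm]
  refine Finset.sum_eq_zero fun μ _ => ?_
  rw [← Finset.mul_sum]
  have := sum_comp_shift_sub B (insert μ S.1) (-hat {μ})
  simp only [← sub_eq_add_neg] at this
  rw [← neg_eq_zero, ← mul_neg, ← Finset.sum_neg_distrib]
  simp only [neg_sub, this, mul_zero]

omit [NeZero N] in
theorem extd_constForm (h : Plane → ℝ) : extd (constForm N h) = 0 := by
  funext c
  simp only [extd]
  refine Finset.sum_eq_zero fun μ _ => ?_
  have (x y : Site N) (S : Finset (Fin 4)) : comp (constForm N h) x S = comp (constForm N h) y S := by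
    unfold comp constForm; rfl
  rw [this _ c.1, sub_self, mul_zero]

theorem dot_bdry_extd (B : Form N 3 ℝ) (A : Form N 1 ℝ) : dot (bdry B) (extd A) = 0 := by
  rw [dot_bdry_three, extd_extd, dot_zero_right, neg_zero]

theorem dot_self_nonneg {r : ℕ} (a : Form N r ℝ) : 0 ≤ dot a a :=
  Finset.sum_nonneg fun c _ => mul_self_nonneg (a c)

/-- Harmonic 2-forms are constant. -/
theorem eq_constForm_of_harmonic {a : Form N 2 ℝ} (h₁ : extd a = 0) (h₂ : bdry a = 0) :
    a = constForm N (flux a) := by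
  have hL := dot_laplacian a a
  rw [h₁, h₂, extd_zero, dot_zero_left, show bdry (0 : Form N 3 ℝ) = 0 from (bdryₗ N 2 ℝ).map_zero,
    dot_zero_left, sub_zero] at hL
  -- The Laplacian is a sum of squared differences as a quadratic form, so its vanishing makes every
  -- component invariant under unit shifts.
  have hsq (S : Finset (Fin 4)) (μ : Fin 4) :
      2 * corr a a S S 0 - corr a a S S (hat {μ}) - corr a a S S (0 - hat {μ}) =
        ∑ x, (comp a (x + hat {μ}) S - comp a x S) ^ 2 := by
    have e1 := sum_comp_mul_comp a a S S (hat {μ}) (hat {μ})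
    have e2 : ∑ x, comp a x S * comp a x S = corr a a S S 0 := by simp [corr]
    have e3 := sum_comp_mul_comp a a S S (hat {μ}) 0
    have e4 : ∑ x, comp a x S * comp a (x + hat {μ}) S = corr a a S S (hat {μ}) := rfl
    rw [sub_self] at e1
    simp only [add_zero] at e3
    rw [← e3, ← e4, two_mul]
    nth_rw 1 [← e1]
    rw [← e2, ← Finset.sum_add_distrib, ← Finset.sum_sub_distrib, ← Finset.sum_sub_distrib]
    exact Finset.sum_congr rfl fun x _ => by ring
  simp only [hsq] at hL
  have hnn (S : Finset (Fin 4)) (μ : Fin 4) :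
      0 ≤ ∑ x, (comp a (x + hat {μ}) S - comp a x S) ^ 2 :=
    Finset.sum_nonneg fun x _ => sq_nonneg _
  have hinv (S : Plane) (x : Site N) (μ : Fin 4) : a (x + hat {μ}, S) = a (x, S) := by
    have h3 := (Finset.sum_eq_zero_iff_of_nonneg fun S _ =>
      Finset.sum_nonneg fun μ _ => hnn S μ).1 hL.symm S.1
        (Finset.mem_powersetCard.2 ⟨Finset.subset_univ _, S.2⟩)
    have h4 := (Finset.sum_eq_zero_iff_of_nonneg fun μ _ => hnn S μ).1 h3 μ (Finset.mem_univ _)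
    have h5 := (Finset.sum_eq_zero_iff_of_nonneg fun x _ => sq_nonneg _).1 h4 x (Finset.mem_univ _)
    rw [comp_of_card _ _ S.2, comp_of_card _ _ S.2] at h5
    exact sub_eq_zero.1 (pow_eq_zero_iff two_ne_zero |>.1 h5)
  funext c
  obtain ⟨x, S⟩ := c
  have hc (y : Site N) : a (y, S) = a (x, S) :=
    eq_of_shift_invariant (fun y => a (y, S)) (hinv S) y x
  have := natCast_ne_zero_of_neZero (N := N)
  simp only [constForm, flux, hc, Finset.sum_const, Finset.card_univ, card_site, nsmul_eq_mul]
  push_cast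
  field_simp

/-- The space of exact 2-forms. -/
def exact₂ (N : ℕ) [NeZero N] : Submodule ℝ (EuclideanSpace ℝ (Cell N 2)) :=
  LinearMap.range ((WithLp.linearEquiv 2 ℝ (Form N 2 ℝ)).symm.toLinearMap ∘ₗ extdₗ N 1 ℝ)

theorem mem_exact₂ {a : EuclideanSpace ℝ (Cell N 2)} :
    a ∈ exact₂ N ↔ ∃ A : Form N 1 ℝ, WithLp.toLp 2 (extd A) = a := Iff.rfl

theorem mem_coexact {a : EuclideanSpace ℝ (Cell N 2)} :
    a ∈ coexact N ↔ ∃ B : Form N 3 ℝ, WithLp.toLp 2 (bdry B) = a := by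
  have : coexact N =
      LinearMap.range ((WithLp.linearEquiv 2 ℝ (Form N 2 ℝ)).symm.toLinearMap ∘ₗ bdryₗ N 2 ℝ) := by
    rw [← Submodule.span_eq (LinearMap.range _), LinearMap.coe_range]; rfl
  rw [this]; rfl

theorem inner_toLp (a b : Form N 2 ℝ) :
    inner ℝ (WithLp.toLp 2 a : EuclideanSpace ℝ (Cell N 2)) (WithLp.toLp 2 b) = dot a b := by
  simp [PiLp.inner_apply, dot, mul_comm]

theorem exists_coexactProj_eq (a : Form N 2 ℝ) : ∃ B : Form N 3 ℝ, coexactProj a = bdry B := by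
  obtain ⟨B, hB⟩ := mem_coexact.1 ((coexact N).starProjection_apply_mem (WithLp.toLp 2 a))
  exact ⟨B, by unfold coexactProj; rw [← hB]⟩

theorem coexactProj_add (a b : Form N 2 ℝ) :
    coexactProj (a + b) = coexactProj a + coexactProj b := by
  unfold coexactProj; rw [WithLp.toLp_add, map_add, WithLp.ofLp_add]

theorem dot_sub_coexactProj (a : Form N 2 ℝ) (B : Form N 3 ℝ) :
    dot (a - coexactProj a) (bdry B) = 0 := by
  rw [← inner_toLp]
  exact (coexact N).starProjection_inner_eq_zero (WithLp.toLp 2 a) _ (mem_coexact.2 ⟨B, rfl⟩)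

/-- Closed forms are orthogonal to the image of `∂` by adjointness. This is why `u` does not see the
choice of `l`. -/
theorem coexactProj_of_closed {a : Form N 2 ℝ} (ha : extd a = 0) : coexactProj a = 0 := by
  obtain ⟨B, hB⟩ := exists_coexactProj_eq a
  have h := dot_sub_coexactProj a B
  rw [hB, dot_sub_left, dot_comm a, dot_bdry_three, ha, dot_zero_right, neg_zero, zero_sub,
    neg_eq_zero] at h
  rw [hB, dot_self_eq_zero h]

/-- Exact and coexact forms are orthogonal because `d² = 0`. What remains after projecting to both
is orthogonal to both, hence annihilated by `d` and `∂`, hence constant; it carries the whole flux,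
since the other two parts have none. -/
theorem hodge_decomposition (a : Form N 2 ℝ) :
    ∃ A : Form N 1 ℝ, a = extd A + constForm N (flux a) + coexactProj a := by
  obtain ⟨A, hA⟩ := mem_exact₂.1 ((exact₂ N).starProjection_apply_mem (WithLp.toLp 2 a))
  obtain ⟨B, hB⟩ := exists_coexactProj_eq a
  have hE (A' : Form N 1 ℝ) : dot (a - extd A) (extd A') = 0 := by
    rw [← inner_toLp, WithLp.toLp_sub, hA]
    exact (exact₂ N).starProjection_inner_eq_zero (WithLp.toLp 2 a) _ (mem_exact₂.2 ⟨A', rfl⟩)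
  have hC := dot_sub_coexactProj a
  rw [hB] at hC
  set r := a - extd A - bdry B with hr
  have h1 (A' : Form N 1 ℝ) : dot r (extd A') = 0 := by
    rw [hr, dot_sub_left, hE, dot_bdry_extd, sub_zero]
  have h2 (B' : Form N 3 ℝ) : dot r (bdry B') = 0 := by
    rw [hr, sub_right_comm, dot_sub_left, hC, dot_comm, dot_bdry_extd, sub_zero]
  have hb : bdry r = 0 := by
    refine dot_self_eq_zero ?_
    rw [dot_bdry_two, h1]
  have hd : extd r = 0 := by
    refine dot_self_eq_zero ?_
    have := h2 (extd r)
    rw [dot_comm, dot_bdry_three, neg_eq_zero] at this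
    exact this
  have hc := eq_constForm_of_harmonic hd hb
  have ha : a = extd A + r + bdry B := by rw [hr]; abel
  have hf : flux a = flux r := by
    rw [ha, flux_add, flux_add, flux_extd, flux_bdry, zero_add, add_zero]
  exact ⟨A, by rw [hf, ← hc, hB]; exact ha⟩

theorem exists_eq_of_closed {a : Form N 2 ℝ} (ha : extd a = 0) :
    ∃ A : Form N 1 ℝ, a = extd A + constForm N (flux a) := by
  obtain ⟨A, hA⟩ := hodge_decomposition a
  rw [coexactProj_of_closed ha, add_zero] at hA
  exact ⟨A, hA⟩

theorem latticeSum_cup_bdry_bdry (B B' : Form N 3 ℝ) :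
    latticeSum (cup (bdry B) (bdry B')) = 0 := by
  rw [latticeSum_cup_eq_dot, star₂_bdry, dot_bdry_extd]

theorem latticeSum_cup_constForm_bdry (h : Plane → ℝ) (B : Form N 3 ℝ) :
    latticeSum (cup (constForm N h) (bdry B)) = 0 := by
  rw [latticeSum_cup_eq_dot, star₂_bdry, dot_constForm_left]
  simp [flux_extd]

theorem latticeSum_extd_cup_extd (A A' : Form N 1 ℝ) :
    latticeSum (cup (extd A) (extd A')) = 0 :=
  latticeSum_extd_cup_of_closed A (extd_extd A')

/-- The plane spanned by the directions `i ≠ j`. -/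
def plane (i j : Fin 4) (h : i ≠ j) : Plane := ⟨{i, j}, Finset.card_pair h⟩

/-- The pairing of fluxes induced by the cup product. -/
def fluxPairing {R : Type*} [CommRing R] (h k : Plane → R) : R :=
  h (plane 0 1 (by decide)) * k (plane 2 3 (by decide)) -
    h (plane 0 2 (by decide)) * k (plane 1 3 (by decide)) +
    h (plane 0 3 (by decide)) * k (plane 1 2 (by decide)) +
    h (plane 1 2 (by decide)) * k (plane 0 3 (by decide)) -
    h (plane 1 3 (by decide)) * k (plane 0 2 (by decide)) +
    h (plane 2 3 (by decide)) * k (plane 0 1 (by decide))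

theorem latticeSum_cup_constForm (h k : Plane → ℝ) :
    latticeSum (cup (constForm N h) (constForm N k)) = fluxPairing h k := by
  have := natCast_ne_zero_of_neZero (N := N)
  have key (S T : Plane) (z : Site N) :
      corr (constForm N h) (constForm N k) S.1 T.1 z = h S * k T := by
    have e (h : Plane → ℝ) (S : Plane) (x : Site N) : comp (constForm N h) x S.1 = h S / N ^ 2 := by
      rw [comp_of_card _ _ S.2]; rfl
    simp only [corr, e, Finset.sum_const, Finset.card_univ, card_site, nsmul_eq_mul]
    push_cast
    field_simp
  rw [latticeSum_cup_two]
  unfold fluxPairing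
  simp only [← key _ _ (siteOf 0 0 0 0), plane]
  have key' (S T : Finset (Fin 4)) (hS : S.card = 2) (hT : T.card = 2) (z : Site N) :
      corr (constForm N h) (constForm N k) S T z =
        corr (constForm N h) (constForm N k) S T (siteOf 0 0 0 0) :=
    (key ⟨S, hS⟩ ⟨T, hT⟩ z).trans (key ⟨S, hS⟩ ⟨T, hT⟩ _).symm
  rw [key' {0, 1} {2, 3} rfl rfl, key' {0, 2} {1, 3} rfl rfl, key' {0, 3} {1, 2} rfl rfl,
    key' {1, 2} {0, 3} rfl rfl, key' {1, 3} {0, 2} rfl rfl, key' {2, 3} {0, 1} rfl rfl]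

end Hodge

/-! ### Fluxes of closed integer-valued 2-forms -/

section IntegerFlux

variable {N : ℕ} [NeZero N]

theorem sum_axis_shift (f : Site N → ℤ) (x : Site N) (k : Fin 4) :
    ∑ s : ZMod N, f (x + hat {k} + axis k s) = ∑ s : ZMod N, f (x + axis k s) := by
  rw [← Equiv.sum_comp (Equiv.addLeft (1 : ZMod N)) fun s => f (x + axis k s)]
  refine Finset.sum_congr rfl fun s _ => ?_
  rw [Equiv.coe_addLeft, axis_one_add, add_assoc]

/-- The sum of a function over the lattice plane through `x` in the directions `i`, `j`. -/
def planeSum (f : Site N → ℤ) (i j : Fin 4) (x : Site N) : ℤ :=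
  ∑ s : ZMod N, ∑ t : ZMod N, f (x + axis i s + axis j t)

theorem planeSum_shift_left (f : Site N → ℤ) (i j : Fin 4) (x : Site N) :
    planeSum f i j (x + hat {i}) = planeSum f i j x :=
  sum_axis_shift (fun y => ∑ t : ZMod N, f (y + axis j t)) x i

theorem planeSum_shift_right (f : Site N → ℤ) (i j : Fin 4) (x : Site N) :
    planeSum f i j (x + hat {j}) = planeSum f i j x := by
  refine Finset.sum_congr rfl fun s _ => ?_
  rw [← sum_axis_shift f (x + axis i s) j]
  refine Finset.sum_congr rfl fun t _ => ?_
  rw [add_right_comm x (hat {j})]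

theorem planeSum_comp_shift (f : Site N → ℤ) (i j : Fin 4) (x z : Site N) :
    planeSum (fun y => f (y + z)) i j x = planeSum f i j (x + z) := by
  refine Finset.sum_congr rfl fun s _ => Finset.sum_congr rfl fun t _ => ?_
  exact congrArg f (by abel)

theorem sum_planeSum (f : Site N → ℤ) (i j : Fin 4) :
    ∑ x, planeSum f i j x = (N : ℤ) ^ 2 * ∑ x, f x := by
  unfold planeSum
  rw [Finset.sum_comm]
  have h2 (s t : ZMod N) : ∑ x : Site N, f (x + axis i s + axis j t) = ∑ x, f x := by
    simp only [add_assoc]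
    exact Equiv.sum_comp (Equiv.addRight (axis i s + axis j t : Site N)) f
  have h1 (s : ZMod N) : ∑ x : Site N, ∑ t : ZMod N, f (x + axis i s + axis j t) = N * ∑ x, f x := by
    rw [Finset.sum_comm]
    simp [h2, ZMod.card]
  simp only [h1, Finset.sum_const, Finset.card_univ, ZMod.card, nsmul_eq_mul]
  ring

omit [NeZero N] in
theorem exists_comp_shift_sub_eq {n : Form N 2 ℤ} (hn : extd n = 0) {i j k : Fin 4} (hij : i < j)
    (hki : k ≠ i) (hkj : k ≠ j) :
    ∃ u v : ℤ, ∀ x : Site N, comp n (x + hat {k}) {i, j} - comp n x {i, j} =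
      u * (comp n (x + hat {i}) {j, k} - comp n x {j, k}) +
        v * (comp n (x + hat {j}) {i, k} - comp n x {i, k}) := by
  rcases lt_or_gt_of_ne hki with h1 | h1
  · refine ⟨1, -1, fun x => ?_⟩
    have := comp_extd_triple (α := n) x k i j h1 hij
    rw [hn, comp_zero] at this
    rw [Finset.pair_comm j k, Finset.pair_comm i k]
    linarith
  rcases lt_or_gt_of_ne hkj with h2 | h2
  · refine ⟨1, 1, fun x => ?_⟩
    have := comp_extd_triple (α := n) x i k j h1 h2
    rw [hn, comp_zero] at this
    rw [Finset.pair_comm j k]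
    linarith
  · refine ⟨-1, 1, fun x => ?_⟩
    have := comp_extd_triple (α := n) x i j k hij h2
    rw [hn, comp_zero] at this
    linarith

/-- A shift inside the plane reindexes the sum. For a transverse shift, closedness on the cube `{i,
j, k}` rewrites the change as differences along the plane, which telescope around the torus. -/
theorem planeSum_shift {n : Form N 2 ℤ} (hn : extd n = 0) {i j : Fin 4} (hij : i < j)
    (x : Site N) (k : Fin 4) :
    planeSum (fun y => comp n y {i, j}) i j (x + hat {k}) =
      planeSum (fun y => comp n y {i, j}) i j x := by
  rcases eq_or_ne k i with rfl | hki
  · exact planeSum_shift_left _ _ _ x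
  rcases eq_or_ne k j with rfl | hkj
  · exact planeSum_shift_right _ _ _ x
  obtain ⟨u, v, huv⟩ := exists_comp_shift_sub_eq hn hij hki hkj
  have h1 := planeSum_shift_left (fun y => comp n y {j, k}) i j x
  have h2 := planeSum_shift_right (fun y => comp n y {i, k}) i j x
  rw [← planeSum_comp_shift, ← sub_eq_zero] at h1 h2 ⊢
  unfold planeSum at h1 h2 ⊢
  simp only [← Finset.sum_sub_distrib] at h1 h2 ⊢
  simp only [huv, Finset.sum_add_distrib, ← Finset.mul_sum]
  rw [h1, h2]
  ring

/-- All parallel planes carry the same integer flux, so their average is that integer. -/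
theorem exists_int_flux {n : Form N 2 ℤ} (hn : extd n = 0) (i j : Fin 4) (hij : i < j) :
    flux (toReal n) (plane i j hij.ne) = (planeSum (fun y => comp n y {i, j}) i j 0 : ℝ) := by
  have hconst (x : Site N) := eq_of_shift_invariant _ (planeSum_shift hn hij) x 0
  have htot := sum_planeSum (fun y => comp n y {i, j}) i j
  simp only [hconst, Finset.sum_const, Finset.card_univ, card_site, nsmul_eq_mul] at htot
  have hN := natCast_ne_zero_of_neZero (N := N)
  have h4 : (N : ℝ) ^ 2 ≠ 0 := pow_ne_zero 2 hN
  have htot' : (N : ℝ) ^ 4 * (planeSum (fun y => comp n y {i, j}) i j 0 : ℝ) =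
      (N : ℝ) ^ 2 * ((∑ x, comp n x {i, j} : ℤ) : ℝ) := by
    exact_mod_cast htot
  have hsum : ∑ x, toReal n (x, plane i j hij.ne) = ((∑ x, comp n x {i, j} : ℤ) : ℝ) := by
    rw [Int.cast_sum]
    refine Finset.sum_congr rfl fun x _ => ?_
    rw [comp_of_card n x (Finset.card_pair hij.ne)]; rfl
  unfold flux
  rw [hsum, div_eq_iff h4]
  apply mul_left_cancel₀ h4
  linear_combination -htot'

theorem plane_cases (S : Plane) : ∃ i j : Fin 4, ∃ h : i < j, S = plane i j h.ne := by
  obtain ⟨S, hS⟩ := S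
  have : S ∈ ({{0, 1}, {0, 2}, {0, 3}, {1, 2}, {1, 3}, {2, 3}} : Finset (Finset (Fin 4))) := by
    revert S; decide
  simp only [Finset.mem_insert, Finset.mem_singleton] at this
  rcases this with rfl | rfl | rfl | rfl | rfl | rfl
  · exact ⟨0, 1, by decide, rfl⟩
  · exact ⟨0, 2, by decide, rfl⟩
  · exact ⟨0, 3, by decide, rfl⟩
  · exact ⟨1, 2, by decide, rfl⟩
  · exact ⟨1, 3, by decide, rfl⟩
  · exact ⟨2, 3, by decide, rfl⟩

/-- The fluxes of closed integer-valued forms are integers. -/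
theorem exists_int_flux_eq {n : Form N 2 ℤ} (hn : extd n = 0) :
    ∃ h : Plane → ℤ, flux (toReal n) = fun S => (h S : ℝ) := by
  have (S : Plane) : ∃ k : ℤ, flux (toReal n) S = k := by
    obtain ⟨i, j, hij, rfl⟩ := plane_cases S
    exact ⟨_, exists_int_flux hn i j hij⟩
  choose h hh using this
  exact ⟨h, funext hh⟩

/-- A closed integer-valued form with fluxes `h`. -/
def intForm (N : ℕ) (h : Plane → ℤ) : Form N 2 ℤ := fun c =>
  if ∀ μ ∈ c.2.1, c.1 μ = 0 then h c.2 else 0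

-- Each component depends only on the coordinates inside its own plane, while `d` takes differences
-- in transverse directions.
omit [NeZero N] in
theorem extd_intForm (h : Plane → ℤ) : extd (intForm N h) = 0 := by
  funext c
  simp only [extd]
  refine Finset.sum_eq_zero fun μ _ => ?_
  have : comp (intForm N h) (c.1 + hat {μ}) (c.2.1.erase μ) =
      comp (intForm N h) c.1 (c.2.1.erase μ) := by
    unfold comp intForm
    split_ifs with h1 h2 h3 h3
    · rfl
    · exact absurd (fun ν hν => by simpa [hat, Finset.ne_of_mem_erase hν] using h2 ν hν) h3
    · exact absurd (fun ν hν => by simpa [hat, Finset.ne_of_mem_erase hν] using h3 ν hν) h2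
    · rfl
    · rfl
  rw [this, sub_self, mul_zero]

theorem flux_intForm (h : Plane → ℤ) : flux (toReal (intForm N h)) = fun S => (h S : ℝ) := by
  funext S
  obtain ⟨i, j, hij, rfl⟩ := plane_cases S
  rw [exists_int_flux (extd_intForm h) i j hij]
  congr 1
  have key (s t : ZMod N) : comp (intForm N h) (0 + axis i s + axis j t) {i, j} =
      if s = 0 then if t = 0 then h (plane i j hij.ne) else 0 else 0 := by
    rw [comp_of_card _ _ (Finset.card_pair hij.ne)]
    unfold intForm
    simp only [plane, Finset.mem_insert, Finset.mem_singleton, forall_eq_or_imp, forall_eq,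
      Pi.add_apply, axis, hij.ne, hij.ne', if_true, if_false,
      add_zero, zero_add, ite_and]
  unfold planeSum
  simp only [key]
  simp

theorem fluxPairing_intCast (h k : Plane → ℤ) :
    fluxPairing (fun S => (h S : ℝ)) (fun S => (k S : ℝ)) = ((fluxPairing h k : ℤ) : ℝ) := by
  simp [fluxPairing]

/-- The intersection form of the torus is a sum of three hyperbolic planes. Its evenness is what
makes the parity of `v` an invariant of the contour. -/
theorem even_fluxPairing_self (h : Plane → ℤ) : Even (fluxPairing h h) := by
  refine ⟨h (plane 0 1 (by decide)) * h (plane 2 3 (by decide)) -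
    h (plane 0 2 (by decide)) * h (plane 1 3 (by decide)) +
    h (plane 0 3 (by decide)) * h (plane 1 2 (by decide)), ?_⟩
  unfold fluxPairing
  ring

theorem latticeSum_cup_self_of_closed {a : Form N 2 ℝ} (ha : extd a = 0) :
    latticeSum (cup a a) = fluxPairing (flux a) (flux a) := by
  obtain ⟨A, hA⟩ := exists_eq_of_closed ha
  have h0 := latticeSum_extd_cup_of_closed A (extd_constForm (N := N) (flux a))
  have h1 := latticeSum_cup_comm (extd A) (constForm N (flux a))
  rw [extd_constForm, extd_extd, latticeSum_cup₁_zero_left, latticeSum_cup₁_zero_right, h0] at h1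
  nth_rw 1 2 [hA]
  rw [latticeSum_cup_add_left, latticeSum_cup_add_right, latticeSum_cup_add_right, h0, h1,
    latticeSum_extd_cup_extd, latticeSum_cup_constForm]
  ring

theorem even_latticeSum_cup_self {n : Form N 2 ℤ} (hn : extd n = 0) :
    Even (latticeSum (cup n n)) := by
  obtain ⟨h, hh⟩ := exists_int_flux_eq hn
  have hc : extd (toReal n) = 0 := by rw [extd_toReal, hn, toReal_zero]
  have := latticeSum_cup_self_of_closed hc
  rw [latticeSum_cup_toReal, hh, fluxPairing_intCast, Int.cast_inj] at this
  rw [this]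
  exact even_fluxPairing_self h

/-- Adding a closed integer-valued form does not change the parity of the Pontryagin square. -/
theorem pontryagin_add_closed {n : Form N 2 ℤ} (m : Form N 2 ℤ) (hn : extd n = 0) :
    pontryagin (n + m) ≡ pontryagin m [ZMOD 2] := by
  have h : pontryagin (n + m) = latticeSum (cup n n) + pontryagin m + 2 * latticeSum (cup n m) :=
    pontr_add_of_closed m hn
  obtain ⟨k, hk⟩ := even_latticeSum_cup_self hn
  rw [h, hk]
  refine (Int.modEq_iff_dvd.2 ⟨-k - latticeSum (cup n m), by ring⟩)

theorem pontryagin_smul (k : ℤ) (n : Form N 2 ℤ) : pontryagin (k • n) = k ^ 2 * pontryagin n :=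
  pontr_smul k n

end IntegerFlux

/-! ### Dual surfaces of contractible contours -/

section DualSurface

variable {N : ℕ}

theorem star₂_surjective {K : Type} [CommRing K] (a : Form N 2 K) : ∃ b, star₂ b = a := by
  refine ⟨fun c => (shuffleSign (c.2.1)ᶜ c.2.1 : K) * comp a (c.1 - hat (c.2.1)ᶜ) (c.2.1)ᶜ, ?_⟩
  refine form_ext fun x S hS => ?_
  have hS' : Sᶜ.card = 2 := by rw [Finset.card_compl, hS]; rfl
  rw [comp_star₂ _ _ hS, comp_of_card _ _ hS']
  simp only [compl_compl, add_sub_cancel_right]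
  rw [← mul_assoc, shuffleSign_mul_self, one_mul]

theorem isDualSurface_iff (γ : Contour N) (l : Form N 2 ℤ) :
    IsDualSurface γ l ↔ star₃ (extd l) = γ.tangent := by
  have key (x : Site N) (μ : Fin 4) : comp (star₃ (extd l)) x {μ} =
      -(shuffleSign {μ} {μ}ᶜ * comp (extd l) (x + hat {μ}) {μ}ᶜ) :=
    comp_star₃ _ _ (Finset.card_singleton μ)
  constructor
  · intro h
    refine form_ext fun x S hS => ?_
    obtain ⟨μ, rfl⟩ := Finset.card_eq_one.1 hS
    rw [key, h, neg_neg]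
  · intro h x μ
    rw [← h, key, neg_neg]

variable [NeZero N]

theorem dot_single_left {r : ℕ} {K : Type} [CommRing K] (c : Cell N r) (t : K) (a : Form N r K) :
    dot (Pi.single c t) a = t * a c := by
  unfold dot
  rw [Finset.sum_eq_single c]
  · rw [Pi.single_eq_same]
  · intro b _ hb; rw [Pi.single_eq_of_ne hb, zero_mul]
  · simp

theorem eq_of_dot_eq {r : ℕ} {K : Type} [CommRing K] {a b : Form N r K}
    (h : ∀ c, dot a c = dot b c) : a = b := by
  funext c
  have := h (Pi.single c 1)
  rwa [dot_comm, dot_single_left, dot_comm, dot_single_left, one_mul, one_mul] at this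

/-- The dual form of summation by parts, tested against all 1-forms. It reduces the existence of `l`
to the statement that the tangent is the boundary of an integer-valued 2-form. -/
theorem star₃_extd {K : Type} [CommRing K] (l : Form N 2 K) :
    star₃ (extd l) = -bdry (star₂ l) := by
  refine eq_of_dot_eq fun A => ?_
  have h := latticeSum_extd_cup A l
  rw [latticeSum_cup_eq_dot, latticeSum_cup_one_three_eq_dot, dot_comm, ← dot_bdry_two] at h
  rw [dot_comm, ← neg_inj, ← h]
  simp [dot]

/-- The 1-form supported on a link. -/
def link (x : Site N) (μ : Fin 4) : Form N 1 ℤ := Pi.single (x, ⟨{μ}, Finset.card_singleton μ⟩) 1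

theorem dot_link (x : Site N) (μ : Fin 4) (A : Form N 1 ℤ) : dot (link x μ) A = comp A x {μ} := by
  rw [link, dot_single_left, one_mul, comp_of_card _ _ (Finset.card_singleton μ)]

theorem bdry_plaquette (x : Site N) {μ ν : Fin 4} (h : μ < ν) :
    bdry (Pi.single (x, plane μ ν h.ne) 1 : Form N 2 ℤ) =
      link x μ + link (x + hat {μ}) ν - link (x + hat {ν}) μ - link x ν := by
  refine eq_of_dot_eq fun A => ?_
  rw [dot_bdry_two, dot_single_left, one_mul, dot_sub_left, dot_sub_left, dot_add_left, dot_link,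
    dot_link, dot_link, dot_link]
  have := comp_extd_pair (α := A) x μ ν h
  rw [comp_of_card _ _ (Finset.card_pair h.ne)] at this
  rw [plane, this]
  ring

/-- The boundaries of integer-valued 2-forms. -/
def boundaries (N : ℕ) : AddSubgroup (Form N 1 ℤ) :=
  (bdryₗ N 1 ℤ).toAddMonoidHom.range

/-- Links modulo boundaries. -/
def linkClass (x : Site N) (μ : Fin 4) : Form N 1 ℤ ⧸ boundaries N :=
  QuotientAddGroup.mk (link x μ)

/-- The two ways around a plaquette differ by its boundary. -/
theorem linkClass_add (x : Site N) (μ ν : Fin 4) :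
    linkClass x μ + linkClass (x + hat {μ}) ν = linkClass x ν + linkClass (x + hat {ν}) μ := by
  have key {μ ν : Fin 4} (h : μ < ν) :
      linkClass x μ + linkClass (x + hat {μ}) ν = linkClass x ν + linkClass (x + hat {ν}) μ := by
    unfold linkClass
    rw [← QuotientAddGroup.mk_add, ← QuotientAddGroup.mk_add, QuotientAddGroup.eq]
    refine ⟨-Pi.single (x, plane μ ν h.ne) 1, ?_⟩
    refine ((bdryₗ N 1 ℤ).map_neg _).trans ?_
    refine (congrArg Neg.neg (bdry_plaquette x h)).trans ?_
    abel
  rcases lt_trichotomy μ ν with h | rfl | h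
  · exact key h
  · rfl
  · exact (key h).symm

/-- Parallel transport along a link. -/
def transport (N : ℕ) [NeZero N] (μ : Fin 4) :
    Equiv.Perm (Site N × (Form N 1 ℤ ⧸ boundaries N)) where
  toFun p := (p.1 + hat {μ}, p.2 + linkClass p.1 μ)
  invFun p := (p.1 - hat {μ}, p.2 - linkClass (p.1 - hat {μ}) μ)
  left_inv p := by simp
  right_inv p := by simp

theorem transport_commute (μ ν : Fin 4) : Commute (transport N μ) (transport N ν) := by
  refine Equiv.ext fun p => Prod.ext ?_ ?_
  · simp [transport, add_right_comm]
  · simp only [transport, Equiv.Perm.mul_apply, Equiv.coe_fn_mk]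
    rw [add_assoc, add_assoc, linkClass_add]

theorem list_prod_steps {G : Type*} [CommGroup G] (t : Fin 4 → G) (s : List Step) :
    (s.map fun a => if a.2 then t a.1 else (t a.1)⁻¹).prod = ∏ μ, t μ ^ displacement s μ := by
  induction s with
  | nil => simp [displacement]
  | cons a s ih =>
    have h : ∀ μ, t μ ^ displacement (a :: s) μ =
        (if μ = a.1 then (if a.2 then t a.1 else (t a.1)⁻¹) else 1) * t μ ^ displacement s μ := by
      intro μ
      obtain ⟨ν, b⟩ := a
      by_cases hμ : μ = ν
      · subst hμ
        cases b
        · simp [displacement, ← sub_sub, zpow_sub_one, mul_comm]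
        · simp [displacement, add_sub_right_comm, zpow_add_one, mul_comm]
      · simp [displacement, hμ, Ne.symm hμ]
    rw [List.map_cons, List.prod_cons, ih, Finset.prod_congr rfl fun μ _ => h μ,
      Finset.prod_mul_distrib, Finset.prod_ite_eq' Finset.univ a.1]
    simp

-- The generators span a commutative subgroup, in which a product of steps depends only on the net
-- number of steps in each direction.
open scoped IsMulCommutative in
theorem list_prod_steps_of_commute {G : Type*} [Group G] (t : Fin 4 → G)
    (ht : ∀ μ ν, Commute (t μ) (t ν)) (s : List Step) (hs : ∀ μ, displacement s μ = 0) :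
    (s.map fun a => if a.2 then t a.1 else (t a.1)⁻¹).prod = 1 := by
  have := Subgroup.isMulCommutative_closure (k := Set.range t) (by
    rintro _ ⟨μ, rfl⟩ _ ⟨ν, rfl⟩; exact ht μ ν)
  have := list_prod_steps (fun μ => (⟨t μ, Subgroup.subset_closure ⟨μ, rfl⟩⟩ :
    Subgroup.closure (Set.range t))) s
  simp only [hs, zpow_zero, Finset.prod_const_one] at this
  have h2 := congrArg (Subgroup.closure (Set.range t)).subtype this
  rw [map_list_prod, map_one, List.map_map] at h2
  rw [← h2]
  congr 2
  funext a
  cases h : a.2 <;> simp [h]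

/-- The second component accumulates the class of the traversed links. A product of permutations
applies its last factor first, whence the reversal of the list. -/
theorem transport_path (s : List Step) (p : Site N × (Form N 1 ℤ ⧸ boundaries N)) :
    ((s.reverse.map fun a => if a.2 then transport N a.1 else (transport N a.1)⁻¹).prod p).2 =
      p.2 + QuotientAddGroup.mk (traversals p.1 s) := by
  induction s generalizing p with
  | nil => simp [traversals]
  | cons a s ih =>
    obtain ⟨μ, b⟩ := a
    rw [List.reverse_cons, List.map_append, List.prod_append, Equiv.Perm.mul_apply, ih]
    cases b
    · simp only [List.map_cons, List.map_nil, List.prod_singleton, traversals]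
      rw [QuotientAddGroup.mk_add, QuotientAddGroup.mk_neg, ← add_assoc, ← sub_eq_add_neg]
      rfl
    · simp only [List.map_cons, List.map_nil, List.prod_singleton, traversals]
      rw [QuotientAddGroup.mk_add, ← add_assoc]
      rfl

/-- Transports along the four directions commute, so a path with zero displacement acts trivially.
Its tangent is therefore zero modulo boundaries, and no homotopy of paths is needed. -/
theorem exists_isDualSurface (γ : Contour N) (hγ : γ.IsContractible) :
    ∃ l : Form N 2 ℤ, IsDualSurface γ l := by
  have h1 := transport_path γ.steps (γ.base, 0)
  rw [list_prod_steps_of_commute _ transport_commute _ fun μ => by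
    have := hγ μ
    simp only [displacement, List.count_reverse] at this ⊢
    exact this] at h1
  have h2 : (QuotientAddGroup.mk γ.tangent : Form N 1 ℤ ⧸ boundaries N) = 0 := by
    rw [zero_add] at h1; exact h1.symm
  obtain ⟨b, hb⟩ := (QuotientAddGroup.eq_zero_iff _).1 h2
  -- The sign compensates the one in `star₃_extd`.
  obtain ⟨l, hl⟩ := star₂_surjective (-b)
  refine ⟨l, (isDualSurface_iff γ l).2 ?_⟩
  rw [star₃_extd, hl, ← hb]
  exact (congrArg Neg.neg ((bdryₗ N 1 ℤ).map_neg b)).trans (neg_neg _)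

theorem extd_eq_of_isDualSurface {γ : Contour N} {l l' : Form N 2 ℤ} (h : IsDualSurface γ l)
    (h' : IsDualSurface γ l') : extd l = extd l' :=
  star₃_injective (((isDualSurface_iff γ l).1 h).trans ((isDualSurface_iff γ l').1 h').symm)

/-- Two dual surfaces of the same contour differ by a closed integer form, which the coexact
projection kills and to which the parity of the Pontryagin square is blind. -/
theorem uOf_eq_and_vOf_modEq {γ : Contour N} {l l' : Form N 2 ℤ} (h : IsDualSurface γ l)
    (h' : IsDualSurface γ l') : uOf l = uOf l' ∧ vOf l ≡ vOf l' [ZMOD 2] := by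
  have hc : extd (l - l') = 0 := by
    rw [extd_sub, extd_eq_of_isDualSurface h h', sub_self]
  have hl : l = (l - l') + l' := by abel
  refine ⟨?_, ?_⟩
  · have : coexactProj (toReal l) = coexactProj (toReal l') := by
      rw [hl, toReal_add, coexactProj_add, coexactProj_of_closed, zero_add]
      rw [extd_toReal, hc, toReal_zero]
    unfold uOf
    rw [this]
  · unfold vOf
    rw [hl]
    exact pontryagin_add_closed l' hc

/-- Summation by parts against a dual surface. -/
theorem latticeSum_extd_cup_of_isDualSurface {γ : Contour N} {l : Form N 2 ℤ}
    (h : IsDualSurface γ l) (A : Form N 1 ℝ) :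
    latticeSum (cup (extd A) (toReal l)) = -dot (toReal γ.tangent) A := by
  rw [latticeSum_extd_cup, latticeSum_cup_one_three_eq_dot, extd_toReal,
    ← (isDualSurface_iff γ l).1 h, dot_comm]
  congr 2
  funext c
  have := comp_toReal (extd l) (c.1 + hat c.2.1) (c.2.1)ᶜ
  simp only [star₃, this, toReal]
  push_cast; rfl

/-- Turns the magnetic loop into a character in `A^m` with integer frequencies, so that it merely
shifts the constraint `dn = 0` to `dn = q_m dl`. -/
theorem latticeSum_tangent_cup {γ : Contour N} {l : Form N 2 ℤ}
    (h : IsDualSurface γ l) (B : Form N 3 ℝ) :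
    latticeSum (cup (toReal γ.tangent) B) = -dot B (toReal (extd l)) := by
  have h3 : toReal γ.tangent = star₃ (toReal (extd l)) := by
    rw [← (isDualSurface_iff γ l).1 h]
    funext c
    have := comp_toReal (extd l) (c.1 + hat c.2.1) (c.2.1)ᶜ
    simp only [star₃, this, toReal]
    push_cast; rfl
  rw [latticeSum_cup_one_three_eq_dot, h3, dot_star₃, dot_comm]

end DualSurface

/-! ### The decomposition of a real 2-form -/

section Decomposition

variable {N : ℕ} [NeZero N]

/-- The Pontryagin square in terms of the exact, constant and coexact parts. -/
theorem pontr_decomposition {a : Form N 2 ℝ} {A : Form N 1 ℝ}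
    (h : a = extd A + constForm N (flux a) + coexactProj a) :
    pontr a = fluxPairing (flux a) (flux a) +
      latticeSum (cup₁ (coexactProj a) (extd (coexactProj a))) +
      2 * latticeSum (cup (extd A) a) := by
  obtain ⟨B, hB⟩ := exists_coexactProj_eq a
  have h1 : latticeSum (cup (extd A) a) =
      latticeSum (cup (extd A) (constForm N (flux a) + coexactProj a)) := by
    nth_rw 1 [h]
    rw [add_assoc, latticeSum_cup_add_right, latticeSum_extd_cup_extd, zero_add]
  rw [h1]
  nth_rw 1 [h]
  rw [add_assoc, pontr_add_of_closed _ (extd_extd A), latticeSum_extd_cup_extd,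
    pontr_add_of_closed _ (extd_constForm _), latticeSum_cup_constForm, hB,
    latticeSum_cup_constForm_bdry]
  unfold pontr
  rw [latticeSum_cup_bdry_bdry]
  ring

end Decomposition

/-! ### Gaussian sums and compact fields -/

section GaussianSums

theorem summable_pi_prod {ι : Type*} [Fintype ι] [DecidableEq ι] {f : ℤ → ℝ} (hf : ∀ k, 0 ≤ f k)
    (hs : Summable f) : Summable fun n : ι → ℤ => ∏ i, f (n i) := by
  refine summable_of_sum_le (c := ∏ _i : ι, ∑' k, f k)
    (fun n => Finset.prod_nonneg fun i _ => hf _) fun u => ?_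
  let t : ι → Finset ℤ := fun i => u.image fun n => n i
  have hu : u ⊆ Fintype.piFinset t := fun n hn =>
    Fintype.mem_piFinset.2 fun i => Finset.mem_image_of_mem _ hn
  calc ∑ n ∈ u, ∏ i, f (n i) ≤ ∑ n ∈ Fintype.piFinset t, ∏ i, f (n i) :=
        Finset.sum_le_sum_of_subset_of_nonneg hu fun n _ _ => Finset.prod_nonneg fun i _ => hf _
    _ = ∏ i, ∑ k ∈ t i, f k := (Finset.prod_univ_sum t fun _ k => f k).symm
    _ ≤ ∏ _i : ι, ∑' k, f k := Finset.prod_le_prod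
        (fun i _ => Finset.sum_nonneg fun k _ => hf k) fun i _ => hs.sum_le_tsum _ fun k _ => hf k

theorem summable_exp_neg_mul_sq {c : ℝ} (hc : 0 < c) :
    Summable fun k : ℤ => Real.exp (-c * (k : ℝ) ^ 2) := by
  have h : Summable fun k : ℕ => Real.exp (-c * (k : ℝ) ^ 2) := by
    refine Summable.of_nonneg_of_le (fun k => (Real.exp_pos _).le) (fun k => ?_)
      (summable_geometric_of_lt_one (Real.exp_pos (-c)).le (by simpa using hc))
    rw [← Real.exp_nat_mul]
    refine Real.exp_le_exp.2 ?_
    have : (k : ℝ) ≤ (k : ℝ) ^ 2 := by exact_mod_cast Nat.le_self_pow two_ne_zero k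
    nlinarith
  refine Summable.of_nat_of_neg (by simpa using h) (by simpa using h)

/-- The Gaussian on integer-valued functions. -/
def gaussZ {ι : Type*} [Fintype ι] (c : ℝ) (n : ι → ℤ) : ℝ := Real.exp (-c * ∑ i, (n i : ℝ) ^ 2)

theorem summable_gaussZ {ι : Type*} [Fintype ι] {c : ℝ} (hc : 0 < c) :
    Summable (gaussZ (ι := ι) c) := by
  classical
  refine (summable_pi_prod (ι := ι) (fun k => (Real.exp_pos _).le)
    (summable_exp_neg_mul_sq hc)).congr fun n => ?_
  rw [gaussZ, Finset.mul_sum, Real.exp_sum]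

/-- The majorant is not uniform in `x`; dividing the terms by `exp (g x)` makes it so, and the
factor is restored after summation. -/
theorem continuous_tsum_of_exp_bound {X ι : Type*} [TopologicalSpace X] {w : X → ι → ℂ} {g : X → ℝ}
    {s : ι → ℝ} (hw : ∀ n, Continuous fun x => w x n) (hg : Continuous g) (hs : Summable s)
    (hb : ∀ x n, ‖w x n‖ ≤ Real.exp (g x) * s n) : Continuous fun x => ∑' n, w x n := by
  have h1 : Continuous fun x => ∑' n, (Real.exp (-g x) : ℂ) * w x n := by
    refine continuous_tsum (fun n => ?_) hs fun n x => ?_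
    · have := hw n
      fun_prop
    · rw [norm_mul, Complex.norm_real, Real.norm_eq_abs, Real.abs_exp]
      calc Real.exp (-g x) * ‖w x n‖ ≤ Real.exp (-g x) * (Real.exp (g x) * s n) :=
            mul_le_mul_of_nonneg_left (hb x n) (Real.exp_pos _).le
        _ = s n := by rw [← mul_assoc, ← Real.exp_add]; simp
  have h2 : (fun x => ∑' n, w x n) =
      fun x => (Real.exp (g x) : ℂ) * ∑' n, (Real.exp (-g x) : ℂ) * w x n := by
    funext x
    rw [tsum_mul_left, ← mul_assoc, ← Complex.ofReal_mul, ← Real.exp_add]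
    simp
  rw [h2]
  fun_prop

end GaussianSums

section CompactFields

variable (N r : ℕ) [NeZero N]

instance : IsProbabilityMeasure
    (ENNReal.ofReal (1 / (2 * π)) • (volume : Measure ℝ).restrict (Set.Ico (-π) π)) := by
  constructor
  rw [Measure.smul_apply, Measure.restrict_apply_univ, Real.volume_Ico, smul_eq_mul,
    ← ENNReal.ofReal_mul (by positivity)]
  rw [show 1 / (2 * π) * (π - -π) = 1 by field_simp; ring, ENNReal.ofReal_one]

instance : IsProbabilityMeasure (fieldMeasure N r) := by
  unfold fieldMeasure; infer_instance

/-- The cube of compact fields. -/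
def fieldCube (N r : ℕ) : Set (Form N r ℝ) := Set.pi Set.univ fun _ => Set.Ico (-π) π

theorem fieldMeasure_eq_smul : ∃ c : ENNReal, c ≠ 0 ∧ c ≠ ⊤ ∧
    fieldMeasure N r = c • volume.restrict (fieldCube N r) := by
  refine ⟨∏ _c : Cell N r, ENNReal.ofReal (1 / (2 * π)), ?_, ?_, ?_⟩
  · rw [Finset.prod_ne_zero_iff]
    intro _ _
    rw [ne_eq, ENNReal.ofReal_eq_zero, not_le]
    positivity
  · exact ENNReal.prod_ne_top fun _ _ => ENNReal.ofReal_ne_top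
  · unfold fieldMeasure
    refine Measure.pi_eq fun s hs => ?_
    rw [fieldCube, volume_pi, Measure.restrict_pi_pi, Measure.smul_apply, Measure.pi_pi, smul_eq_mul,
      ← Finset.prod_mul_distrib]
    rfl

theorem ae_mem_fieldCube : ∀ᵐ A ∂(fieldMeasure N r), A ∈ fieldCube N r := by
  obtain ⟨c, hc, hc', h⟩ := fieldMeasure_eq_smul N r
  rw [h]
  exact Measure.ae_smul_measure (ae_restrict_mem
    (MeasurableSet.univ_pi fun _ => measurableSet_Ico)) c

omit [NeZero N] in
theorem fieldCube_subset : fieldCube N r ⊆ Set.pi Set.univ fun _ => Set.Icc (-π) π :=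
  Set.pi_mono fun _ _ => Set.Ico_subset_Icc_self

omit [NeZero N] in
theorem exists_bound_on_fieldCube {g : Form N r ℝ → ℝ} (hg : Continuous g) :
    ∃ M, ∀ A ∈ fieldCube N r, g A ≤ M := by
  obtain ⟨M, hM⟩ := (isCompact_univ_pi fun _ : Cell N r =>
    isCompact_Icc (a := -π) (b := π)).bddAbove_image hg.continuousOn
  exact ⟨M, fun A hA => hM ⟨A, fieldCube_subset N r hA, rfl⟩⟩

/-- The lattice of periods of the compact fields. -/
def periods (ι : Type) : AddSubgroup (ι → ℝ) :=
  AddMonoidHom.range (G := ι → ℤ)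
    { toFun := fun m i => 2 * π * (m i : ℝ)
      map_zero' := by funext i; simp
      map_add' := fun m m' => by funext i; simp [mul_add] }

instance (ι : Type) [Finite ι] : Countable (periods ι) := by
  have : Countable (ι → ℤ) := inferInstance
  exact (Set.countable_range _).to_subtype

/-- Translated cubes are fundamental domains of the lattice of periods. -/
theorem isAddFundamentalDomain_cube (ι : Type) [Fintype ι] (a : ι → ℝ) :
    IsAddFundamentalDomain (periods ι) (Set.pi Set.univ fun i => Set.Ico (a i) (a i + 2 * π))
      (volume : Measure (ι → ℝ)) := by
  refine IsAddFundamentalDomain.mk'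
    (MeasurableSet.univ_pi fun _ => measurableSet_Ico).nullMeasurableSet fun x => ?_
  have h (i : ι) := existsUnique_add_zsmul_mem_Ico Real.two_pi_pos (x i) (a i)
  choose m hm hm' using h
  refine ⟨⟨_, m, rfl⟩, fun i _ => ?_, ?_⟩
  · have : x i + m i • (2 * π) ∈ Set.Ico (a i) (a i + 2 * π) := hm i
    rw [zsmul_eq_mul, add_comm (x i), mul_comm (m i : ℝ)] at this
    exact this
  · rintro ⟨_, k, rfl⟩ hk
    congr 2
    funext i
    refine hm' i (k i) ?_
    have : 2 * π * (k i : ℝ) + x i ∈ Set.Ico (a i) (a i + 2 * π) := hk i (Set.mem_univ i)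
    rw [add_comm _ (x i), mul_comm _ (k i : ℝ), ← zsmul_eq_mul] at this
    exact this

/-- A translate of the cube is another fundamental domain of the period lattice, and a periodic
function has the same integral over both. -/
theorem lintegral_fieldMeasure_translate {g : Form N r ℝ → ENNReal}
    (hg : ∀ (A : Form N r ℝ) (m : Form N r ℤ), g (A + (2 * π) • toReal m) = g A)
    (B : Form N r ℝ) :
    ∫⁻ A, g (A + B) ∂(fieldMeasure N r) = ∫⁻ A, g A ∂(fieldMeasure N r) := by
  obtain ⟨c, hc, hc', h⟩ := fieldMeasure_eq_smul N r
  rw [h, lintegral_smul_measure, lintegral_smul_measure]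
  congr 1
  have h1 (a : Form N r ℝ) : fieldCube N r =
      Set.pi Set.univ fun _ => Set.Ico (-π) (-π + 2 * π) := by
    unfold fieldCube; congr 1; funext _; congr 1; ring
  have hpre : fieldCube N r = (fun A => A + B) ⁻¹'
      (Set.pi Set.univ fun i => Set.Ico (-π + B i) (-π + B i + 2 * π)) := by
    ext A
    simp only [fieldCube, Set.mem_pi, Set.mem_univ, forall_const, Set.mem_preimage, Set.mem_Ico,
      Pi.add_apply]
    refine forall_congr' fun i => ⟨fun h => ⟨by linarith [h.1], by linarith [h.2]⟩,
      fun h => ⟨by linarith [h.1], by linarith [h.2]⟩⟩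
  rw [hpre]
  rw [(measurePreserving_add_right volume B).setLIntegral_comp_preimage_emb
    (measurableEmbedding_addRight B) g]
  rw [← hpre, h1 B]
  refine (isAddFundamentalDomain_cube (Cell N r) fun i => -π + B i).setLIntegral_eq
    (isAddFundamentalDomain_cube (Cell N r) fun _ => -π) g ?_
  rintro ⟨_, m, rfl⟩ x
  change g ((fun i => 2 * π * (m i : ℝ)) + x) = g x
  rw [add_comm, ← hg x m]
  rfl

theorem integral_cexp_circle (k : ℤ) :
    ∫ a : ℝ, cexp (-(I * ((a * k : ℝ) : ℂ)))
        ∂(ENNReal.ofReal (1 / (2 * π)) • (volume : Measure ℝ).restrict (Set.Ico (-π) π)) =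
      if k = 0 then 1 else 0 := by
  rw [integral_smul_measure, integral_Ico_eq_integral_Ioc,
    ← intervalIntegral.integral_of_le (by linarith [Real.pi_pos])]
  rw [ENNReal.toReal_ofReal (by positivity)]
  split_ifs with h
  · subst h
    have hpi := Real.pi_ne_zero
    simp only [Int.cast_zero, mul_zero, Complex.ofReal_zero, neg_zero, Complex.exp_zero,
      intervalIntegral.integral_const]
    rw [smul_smul, show 1 / (2 * π) * (π - -π) = 1 by field_simp; ring, one_smul]
  · have hk : (-(I * k) : ℂ) ≠ 0 := by simp [h]
    have h1 (a : ℝ) : cexp (-(I * ((a * k : ℝ) : ℂ))) = cexp (-(I * k) * a) := by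
      congr 1; push_cast; ring
    simp only [h1]
    rw [integral_exp_mul_complex hk]
    have h2 : cexp (-(I * k) * (π : ℝ)) = cexp (-(I * k) * ((-π : ℝ) : ℂ)) := by
      rw [Complex.exp_eq_exp_iff_exists_int]
      exact ⟨-k, by push_cast; ring⟩
    rw [h2, sub_self, zero_div, smul_zero]

/-- Integrating a character over compact fields gives a Kronecker delta. -/
theorem integral_fieldMeasure_character (m : Form N r ℤ) :
    ∫ A, cexp (-(I * ((dot A (toReal m) : ℝ) : ℂ))) ∂(fieldMeasure N r) = if m = 0 then 1 else 0 := by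
  have h (A : Form N r ℝ) : cexp (-(I * ((dot A (toReal m) : ℝ) : ℂ))) =
      ∏ c, cexp (-(I * ((A c * m c : ℝ) : ℂ))) := by
    rw [← Complex.exp_sum, dot]
    congr 1
    push_cast
    rw [Finset.mul_sum, ← Finset.sum_neg_distrib]
    rfl
  simp only [h]
  unfold fieldMeasure
  rw [integral_fintype_prod_eq_prod (𝕜 := ℂ) fun c (a : ℝ) => cexp (-(I * ((a * m c : ℝ) : ℂ)))]
  simp only [integral_cexp_circle]
  split_ifs with h0
  · subst h0; simp
  · obtain ⟨c, hc⟩ := Function.ne_iff.1 h0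
    exact Finset.prod_eq_zero (Finset.mem_univ c) (if_neg hc)

end CompactFields

/-! ### Integration over exact 2-forms -/

section ExactIntegration

variable {N : ℕ} [NeZero N]

omit [NeZero N] in
theorem fieldStrength_eq (A : Form N 1 ℝ) (n : Form N 2 ℤ) :
    fieldStrength A n = extd A + (2 * π) • toReal n := by
  funext c; simp [fieldStrength, toReal]

theorem norm_toLp_sq (a : Form N 2 ℝ) :
    ‖(WithLp.toLp 2 a : EuclideanSpace ℝ (Cell N 2))‖ ^ 2 = dot a a := by
  rw [← inner_toLp, real_inner_self_eq_norm_sq]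

theorem continuous_extd (r : ℕ) : Continuous (extd : Form N r ℝ → Form N (r + 1) ℝ) :=
  (extdₗ N r ℝ).continuous_of_finiteDimensional

theorem continuous_dot {X : Type*} [TopologicalSpace X] {r : ℕ} {f g : X → Form N r ℝ}
    (hf : Continuous f) (hg : Continuous g) : Continuous fun x => dot (f x) (g x) := by
  unfold dot
  fun_prop

/-- Gaussians of shifted lattice vectors are bounded by Gaussians of lattice vectors. -/
theorem exp_neg_dot_le {r : ℕ} {b : ℝ} (hb : 0 ≤ b) (a : Form N r ℝ) (n : Form N r ℤ) :
    Real.exp (-b * dot (a + (2 * π) • toReal n) (a + (2 * π) • toReal n)) ≤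
      Real.exp (b * dot a a) * gaussZ (2 * π ^ 2 * b) n := by
  rw [gaussZ, ← Real.exp_add]
  refine Real.exp_le_exp.2 ?_
  have h : 2 * π ^ 2 * ∑ c, (n c : ℝ) ^ 2 ≤
      dot (a + (2 * π) • toReal n) (a + (2 * π) • toReal n) + dot a a := by
    unfold dot
    rw [Finset.mul_sum, ← Finset.sum_add_distrib]
    refine Finset.sum_le_sum fun c _ => ?_
    simp only [Pi.add_apply, Pi.smul_apply, smul_eq_mul, toReal]
    nlinarith [sq_nonneg (2 * a c + 2 * π * n c)]
  nlinarith [mul_le_mul_of_nonneg_left h hb]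

/-- The integer-valued 2-forms that are exact as real forms. -/
def ExactInt (N : ℕ) [NeZero N] : Type := {n : Form N 2 ℤ // extd n = 0 ∧ flux (toReal n) = 0}

instance : Countable (ExactInt N) := by
  have : Countable (Form N 2 ℤ) := inferInstance
  exact Subtype.countable

theorem toLp_mem_exact₂ {a : Form N 2 ℝ} (h : extd a = 0) (h' : flux a = 0) :
    WithLp.toLp 2 a ∈ exact₂ N := by
  obtain ⟨A, hA⟩ := exists_eq_of_closed h
  refine mem_exact₂.2 ⟨A, ?_⟩
  have : constForm N (0 : Plane → ℝ) = 0 := by funext c; simp [constForm]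
  rw [h', this, add_zero] at hA
  rw [hA]

theorem closed_of_mem_exact₂ (e : exact₂ N) : extd (e.1.ofLp) = 0 ∧ flux e.1.ofLp = 0 := by
  obtain ⟨A, hA⟩ := mem_exact₂.1 e.2
  rw [← hA]
  exact ⟨extd_extd A, flux_extd A⟩

omit [NeZero N] in
theorem extd_fieldStrength (A : Form N 1 ℝ) {n : Form N 2 ℤ} :
    extd (extd A + (2 * π) • toReal n) = (2 * π) • toReal (extd n) := by
  rw [extd_add, extd_extd, extd_smul, extd_toReal, zero_add]

/-- The exact form `dA + 2πn`. -/
def exactField (n : ExactInt N) (A : Form N 1 ℝ) : exact₂ N :=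
  ⟨WithLp.toLp 2 (extd A + (2 * π) • toReal n.1), toLp_mem_exact₂
    (by rw [extd_fieldStrength, n.2.1, toReal_zero, smul_zero])
    (by rw [flux_add, flux_extd, flux_smul, n.2.2, smul_zero, add_zero])⟩

theorem continuous_exactField (n : ExactInt N) : Continuous (exactField n) := by
  refine Continuous.subtype_mk ?_ _
  refine (PiLp.continuous_toLp 2 _).comp ?_
  exact (continuous_extd 1).add continuous_const

theorem measurable_exactField (n : ExactInt N) : Measurable (exactField n) :=
  (continuous_exactField n).measurable

/-- The measure on exact forms induced by the compact fields and the exact integer forms. -/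
def exactMeasure (N : ℕ) [NeZero N] : Measure (exact₂ N) :=
  Measure.sum fun n : ExactInt N => (fieldMeasure N 1).map (exactField n)

/-- Translation by `dB` amounts to replacing `A` by `A + B`. After summation over exact integer
forms the integrand is periodic in `A`, so the compact measure does not notice the replacement. -/
instance : Measure.IsAddLeftInvariant (exactMeasure N) := by
  constructor
  rintro ⟨_, B, rfl⟩
  refine Measure.ext fun S hS => ?_
  have hS' : MeasurableSet ((fun e => (⟨_, B, rfl⟩ : exact₂ N) + e) ⁻¹' S) :=
    measurable_const_add _ hS
  rw [Measure.map_apply (measurable_const_add _) hS]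
  unfold exactMeasure
  rw [Measure.sum_apply _ hS, Measure.sum_apply _ hS']
  have key (T : Set (exact₂ N)) (hT : MeasurableSet T) :
      ∑' n : ExactInt N, ((fieldMeasure N 1).map (exactField n)) T =
        ∫⁻ A, ∑' n : ExactInt N, T.indicator (1 : exact₂ N → ENNReal) (exactField n A) ∂(fieldMeasure N 1) := by
    rw [lintegral_tsum (f := fun (n : ExactInt N) A =>
      T.indicator (1 : exact₂ N → ENNReal) (exactField n A)) fun n =>
      ((measurable_one.indicator hT).comp (measurable_exactField n)).aemeasurable]
    refine tsum_congr fun n => ?_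
    rw [Measure.map_apply (measurable_exactField n) hT,
      ← lintegral_indicator_one (measurable_exactField n hT)]
    rfl
  rw [key S hS, key _ hS']
  have hshift (A : Form N 1 ℝ) :
      ∑' n : ExactInt N, ((fun e => (⟨_, B, rfl⟩ : exact₂ N) + e) ⁻¹' S).indicator (1 : exact₂ N → ENNReal)
          (exactField n A) =
        ∑' n : ExactInt N, S.indicator (1 : exact₂ N → ENNReal) (exactField n (A + B)) := by
    refine tsum_congr fun n => ?_
    have : exactField n (A + B) = (⟨_, B, rfl⟩ : exact₂ N) + exactField n A := by
      refine Subtype.ext ?_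
      change WithLp.toLp 2 _ = WithLp.toLp 2 _ + WithLp.toLp 2 _
      rw [← WithLp.toLp_add, extd_add]
      congr 1
      change _ = extd B + _
      abel
    rw [this]; rfl
  simp only [hshift]
  refine lintegral_fieldMeasure_translate N 1
    (g := fun A => ∑' n : ExactInt N, S.indicator (1 : exact₂ N → ENNReal) (exactField n A))
    (fun A m => ?_) B
  -- A period `2πm` of `A` is absorbed by relabelling `n` as `n + dm`; fluxes and closedness are
  -- unaffected.
  let φ : ExactInt N ≃ ExactInt N :=
    { toFun := fun n => ⟨n.1 + extd m, by rw [extd_add, n.2.1, extd_extd, add_zero],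
        by rw [toReal_add, flux_add, n.2.2, ← extd_toReal, flux_extd, add_zero]⟩
      invFun := fun n => ⟨n.1 - extd m, by rw [extd_sub, n.2.1, extd_extd, sub_zero],
        by rw [sub_eq_add_neg, ← neg_one_zsmul, toReal_add, toReal_zsmul, flux_add, n.2.2,
          flux_smul, ← extd_toReal, flux_extd, smul_zero, add_zero]⟩
      left_inv := fun n => Subtype.ext (add_sub_cancel_right _ _)
      right_inv := fun n => Subtype.ext (sub_add_cancel _ _) }
  rw [← φ.tsum_eq fun n => S.indicator (1 : exact₂ N → ENNReal) (exactField n A)]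
  refine tsum_congr fun n => ?_
  congr 1
  refine Subtype.ext ?_
  change WithLp.toLp 2 _ = WithLp.toLp 2 _
  congr 1
  change _ = extd A + (2 * π) • toReal (n.1 + extd m)
  rw [extd_add, extd_smul, extd_toReal, toReal_add, smul_add]
  abel

/-- For each `n` the contribution is at most one. It is zero unless `dA + 2πn` can lie in the
compact set for some `A` in the cube, which forces a constant multiple of the Gaussian of `n` to be
at least one; this multiple is a summable majorant. -/
instance : IsFiniteMeasureOnCompacts (exactMeasure N) := by
  constructor
  intro K hK
  obtain ⟨R, hR⟩ := hK.bddAbove_image (f := fun e => ‖e‖ ^ 2) (by fun_prop)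
  obtain ⟨M, hM⟩ := exists_bound_on_fieldCube N 1 (g := fun A => dot (extd A) (extd A))
    (continuous_dot (continuous_extd 1) (continuous_extd 1))
  have hs : Summable fun n : ExactInt N =>
      Real.exp (R + M) * gaussZ (2 * π ^ 2 * 1) n.1 :=
    ((summable_gaussZ (ι := Cell N 2) (c := 2 * π ^ 2 * 1) (by positivity)).comp_injective
      Subtype.val_injective).mul_left _
  unfold exactMeasure
  rw [Measure.sum_apply _ hK.measurableSet]
  refine lt_of_le_of_lt (ENNReal.tsum_le_tsum (g := fun n : ExactInt N => ENNReal.ofReal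
    (Real.exp (R + M) * gaussZ (2 * π ^ 2 * 1) n.1)) fun n => ?_) hs.tsum_ofReal_lt_top
  rw [Measure.map_apply (measurable_exactField n) hK.measurableSet]
  by_cases h1 : 1 ≤ Real.exp (R + M) * gaussZ (2 * π ^ 2 * 1) n.1
  · refine prob_le_one.trans ?_
    rw [← ENNReal.ofReal_one]
    exact ENNReal.ofReal_le_ofReal h1
  · have : (fieldMeasure N 1) (exactField n ⁻¹' K) = 0 := by
      refine measure_mono_null (t := (fieldCube N 1)ᶜ) (fun A hA hA' => h1 ?_) (ae_mem_fieldCube N 1)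
      have h2 : ‖exactField n A‖ ^ 2 ≤ R := hR ⟨_, hA, rfl⟩
      have h3 : ‖exactField n A‖ ^ 2 = dot (extd A + (2 * π) • toReal n.1)
          (extd A + (2 * π) • toReal n.1) := norm_toLp_sq _
      have h4 := exp_neg_dot_le zero_le_one (extd A) n.1
      rw [← h3] at h4
      have h5 : Real.exp (-R) ≤ Real.exp M * gaussZ (2 * π ^ 2 * 1) n.1 := by
        refine le_trans (Real.exp_le_exp.2 (by linarith)) (h4.trans ?_)
        refine mul_le_mul_of_nonneg_right (Real.exp_le_exp.2 ?_) (Real.exp_pos _).le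
        rw [one_mul]; exact hM A hA'
      calc (1 : ℝ) = Real.exp R * Real.exp (-R) := by rw [← Real.exp_add]; simp
        _ ≤ Real.exp R * (Real.exp M * gaussZ (2 * π ^ 2 * 1) n.1) :=
          mul_le_mul_of_nonneg_left h5 (Real.exp_pos _).le
        _ = _ := by rw [Real.exp_add]; ring
    rw [this]
    exact zero_le

/-- Uniqueness of Haar measure. The factor is nonzero since the summand of `n = 0` alone has mass
one. -/
theorem exists_exactMeasure_eq_smul :
    ∃ c : NNReal, c ≠ 0 ∧ exactMeasure N = c • (volume : Measure (exact₂ N)) := by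
  refine ⟨_, fun h => ?_, Measure.isAddLeftInvariant_eq_smul (exactMeasure N) volume⟩
  have h0 : exactMeasure N = 0 := by
    rw [Measure.isAddLeftInvariant_eq_smul (exactMeasure N) volume, h, zero_smul]
  have h1 : (exactMeasure N) Set.univ = 0 := by rw [h0]; rfl
  unfold exactMeasure at h1
  rw [Measure.sum_apply _ MeasurableSet.univ, ENNReal.tsum_eq_zero] at h1
  let n : ExactInt N := ⟨0, extd_zero, by rw [toReal_zero]; funext S; simp [flux]⟩
  have h2 := h1 n
  rw [Measure.map_apply (measurable_exactField n) MeasurableSet.univ, Set.preimage_univ,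
    measure_univ] at h2
  exact one_ne_zero h2

end ExactIntegration

/-! ### Integration over all closed 2-forms -/

section ClosedIntegration

variable {N : ℕ} [NeZero N]

theorem gaussZ_pos {ι : Type*} [Fintype ι] (c : ℝ) (n : ι → ℤ) : 0 < gaussZ c n := Real.exp_pos _

/-- The closed integer-valued 2-form with given fluxes and exact part. -/
def closedOf (p : (Plane → ℤ) × ExactInt N) : Form N 2 ℤ := intForm N p.1 + p.2.1

theorem flux_closedOf (p : (Plane → ℤ) × ExactInt N) :
    flux (toReal (closedOf p)) = fun S => (p.1 S : ℝ) := by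
  rw [closedOf, toReal_add, flux_add, p.2.2.2, add_zero, flux_intForm]

theorem closedOf_injective : Function.Injective (closedOf (N := N)) := by
  intro p q hpq
  have h1 : p.1 = q.1 := by
    funext S
    have := congrFun ((flux_closedOf p).symm.trans ((congrArg _ (congrArg _ hpq)).trans
      (flux_closedOf q))) S
    exact_mod_cast this
  refine Prod.ext h1 (Subtype.ext ?_)
  unfold closedOf at hpq
  rw [h1] at hpq
  exact add_left_cancel hpq

theorem extd_closedOf (p : (Plane → ℤ) × ExactInt N) : extd (closedOf p) = 0 := by
  rw [closedOf, extd_add, extd_intForm, p.2.2.1, add_zero]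

theorem exists_closedOf_eq {n : Form N 2 ℤ} (hn : extd n = 0) : ∃ p, closedOf p = n := by
  obtain ⟨h, hh⟩ := exists_int_flux_eq hn
  refine ⟨(h, ⟨n - intForm N h, ?_, ?_⟩), ?_⟩
  · rw [extd_sub, hn, extd_intForm, sub_zero]
  · have : toReal n = toReal (n - intForm N h) + toReal (intForm N h) := by
      rw [← toReal_add, sub_add_cancel]
    rw [this, flux_add, flux_intForm] at hh
    simpa using hh
  · simp [closedOf]

theorem continuous_toForm : Continuous fun e : exact₂ N => e.1.ofLp :=
  (PiLp.continuous_ofLp 2 _).comp continuous_subtype_val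

/-- Pythagoras: exact forms have no flux, hence are orthogonal to constant forms. -/
theorem norm_sq_le_dot_add_constForm (e : exact₂ N) (h : Plane → ℝ) :
    ‖e‖ ^ 2 + dot (constForm N h) (constForm N h) =
      dot (e.1.ofLp + constForm N h) (e.1.ofLp + constForm N h) := by
  have h1 : ‖e‖ ^ 2 = dot e.1.ofLp e.1.ofLp := norm_toLp_sq e.1.ofLp
  have h2 : dot (constForm N h) e.1.ofLp = 0 := by
    rw [dot_constForm_left, (closed_of_mem_exact₂ e).2]; simp
  rw [dot_add_left, dot_add_right, dot_add_right, dot_comm e.1.ofLp (constForm N h), h2, h1]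
  ring

/-- Bounded by a Gaussian. -/
def GaussBounded (Φ : Form N 2 ℝ → ℂ) : Prop :=
  ∃ K b : ℝ, 0 ≤ K ∧ 0 < b ∧ ∀ f, ‖Φ f‖ ≤ K * Real.exp (-b * dot f f)

theorem integrable_exact₂ {Φ : Form N 2 ℝ → ℂ} (hc : Continuous Φ) (hb : GaussBounded Φ)
    (h : Plane → ℝ) :
    Integrable (fun e : exact₂ N => Φ (e.1.ofLp + constForm N h)) volume := by
  obtain ⟨K, b, hK, hb, hΦ⟩ := hb
  have h1 : Integrable (fun e : exact₂ N => K * Real.exp (-b * ‖e‖ ^ 2)) := by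
    have := (GaussianFourier.integrable_cexp_neg_mul_sq_norm_add (V := exact₂ N) (b := (b : ℂ))
      (by simpa using hb) 0 0).norm
    refine (this.congr (Filter.Eventually.of_forall fun e => ?_)).const_mul K
    simp only [zero_mul, add_zero]
    rw [Complex.norm_exp]
    congr 1
    rw [← Complex.ofReal_pow, ← Complex.ofReal_neg, ← Complex.ofReal_mul, Complex.ofReal_re]
  refine h1.mono' (hc.comp (continuous_toForm.add continuous_const)).aestronglyMeasurable
    (Filter.Eventually.of_forall fun e => (hΦ _).trans ?_)
  refine mul_le_mul_of_nonneg_left (Real.exp_le_exp.2 ?_) hK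
  have h2 := norm_sq_le_dot_add_constForm e h
  have h3 := dot_self_nonneg (constForm N h)
  nlinarith

theorem exists_bound_closed {Φ : Form N 2 ℝ → ℂ} (hb : GaussBounded Φ) :
    ∃ c K : ℝ, 0 < c ∧ ∀ A ∈ fieldCube N 1, ∀ n : Form N 2 ℤ,
      ‖Φ (extd A + (2 * π) • toReal n)‖ ≤ K * gaussZ c n := by
  obtain ⟨K, b, hK, hb, hΦ⟩ := hb
  obtain ⟨M, hM⟩ := exists_bound_on_fieldCube N 1 (g := fun A => b * dot (extd A) (extd A))
    ((continuous_dot (continuous_extd 1) (continuous_extd 1)).const_mul b)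
  refine ⟨2 * π ^ 2 * b, K * Real.exp M, by positivity, fun A hA n => (hΦ _).trans ?_⟩
  rw [mul_assoc]
  refine mul_le_mul_of_nonneg_left ((exp_neg_dot_le hb.le _ _).trans ?_) hK
  exact mul_le_mul_of_nonneg_right (Real.exp_le_exp.2 (hM A hA)) (gaussZ_pos _ _).le

theorem continuous_comp_field {Φ : Form N 2 ℝ → ℂ} (hc : Continuous Φ) (n : Form N 2 ℤ) :
    Continuous fun A : Form N 1 ℝ => Φ (extd A + (2 * π) • toReal n) :=
  hc.comp ((continuous_extd 1).add continuous_const)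

theorem integrable_comp_field {Φ : Form N 2 ℝ → ℂ} (hc : Continuous Φ) (hb : GaussBounded Φ)
    (n : Form N 2 ℤ) :
    Integrable (fun A => Φ (extd A + (2 * π) • toReal n)) (fieldMeasure N 1) := by
  obtain ⟨c, K, hc', hK⟩ := exists_bound_closed hb
  refine Integrable.of_bound (continuous_comp_field hc n).aestronglyMeasurable (K * gaussZ c n) ?_
  filter_upwards [ae_mem_fieldCube N 1] with A hA using hK A hA n

theorem summable_integral_norm_field {Φ : Form N 2 ℝ → ℂ} (hb : GaussBounded Φ) :
    Summable fun n : Form N 2 ℤ => ∫ A, ‖Φ (extd A + (2 * π) • toReal n)‖ ∂(fieldMeasure N 1) := by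
  obtain ⟨c, K, hc', hK⟩ := exists_bound_closed hb
  refine Summable.of_nonneg_of_le (fun n => integral_nonneg fun A => norm_nonneg _) (fun n => ?_)
    ((summable_gaussZ (ι := Cell N 2) hc').mul_left K)
  have h1 : ∀ᵐ A ∂(fieldMeasure N 1), ‖Φ (extd A + (2 * π) • toReal n)‖ ≤ K * gaussZ c n := by
    filter_upwards [ae_mem_fieldCube N 1] with A hA using hK A hA n
  refine (integral_mono_of_nonneg (Filter.Eventually.of_forall fun A => norm_nonneg _)
    (integrable_const _) h1).trans ?_
  simp

/-- With the fluxes fixed, the sum over exact integer forms unfolds the compact integral to the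
whole space of exact forms. The representative `intForm N h` differs from the constant form with the
same fluxes by an exact form, which a translation removes. -/
theorem hasSum_exactField {c : NNReal} (hc : exactMeasure N = c • (volume : Measure (exact₂ N)))
    {Φ : Form N 2 ℝ → ℂ} (hΦ : Continuous Φ) (hb : GaussBounded Φ) (h : Plane → ℤ) :
    ∑' n : ExactInt N, ∫ A, Φ (extd A + (2 * π) • toReal (closedOf (h, n))) ∂(fieldMeasure N 1) =
      c * ∫ e : exact₂ N, Φ (e.1.ofLp + constForm N ((2 * π) • fun S => (h S : ℝ))) := by
  obtain ⟨A₀, hA₀⟩ := exists_eq_of_closed (a := toReal (intForm N h))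
    (by rw [extd_toReal, extd_intForm, toReal_zero])
  rw [flux_intForm] at hA₀
  let g : exact₂ N := ⟨WithLp.toLp 2 (extd ((2 * π) • A₀)), (2 * π) • A₀, rfl⟩
  have hg (e : exact₂ N) : Φ ((g + e).1.ofLp + constForm N ((2 * π) • fun S => (h S : ℝ))) =
      Φ (e.1.ofLp + (2 * π) • toReal (intForm N h)) := by
    congr 1
    change extd ((2 * π) • A₀) + e.1.ofLp + _ = _
    rw [hA₀, extd_smul, constForm_smul, smul_add]
    abel
  have hint := integrable_exact₂ hΦ hb ((2 * π) • fun S => (h S : ℝ))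
  have hint' : Integrable (fun e : exact₂ N => Φ (e.1.ofLp + (2 * π) • toReal (intForm N h)))
      (exactMeasure N) := by
    rw [hc]
    refine Integrable.smul_measure ?_ ENNReal.coe_ne_top
    refine (hint.comp_add_left g).congr (Filter.Eventually.of_forall fun e => hg e)
  have h2 := (hasSum_integral_measure hint').tsum_eq
  rw [← integral_add_left_eq_self _ g]
  simp only [hg]
  have h3 : ∫ e, Φ (e.1.ofLp + (2 * π) • toReal (intForm N h)) ∂(exactMeasure N) =
      c * ∫ e : exact₂ N, Φ (e.1.ofLp + (2 * π) • toReal (intForm N h)) := by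
    rw [hc, integral_smul_nnreal_measure]
    simp [NNReal.smul_def]
  rw [← h3]
  refine Eq.trans ?_ h2
  refine tsum_congr fun n => ?_
  rw [integral_map (measurable_exactField n).aemeasurable]
  · refine integral_congr_ae (Filter.Eventually.of_forall fun A => ?_)
    change Φ _ = Φ _
    congr 1
    rw [closedOf, toReal_add, smul_add]
    change _ = extd A + (2 * π) • toReal n.1 + (2 * π) • toReal (intForm N h)
    abel
  · exact (hΦ.comp (continuous_toForm.add continuous_const)).aestronglyMeasurable

/-- Integrating over compact fields and summing over closed integer-valued 2-forms amounts to
integrating over exact 2-forms and summing over integer fluxes. -/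
theorem exists_integral_tsum_closed (N : ℕ) [NeZero N] :
    ∃ C : ℝ, 0 < C ∧ ∀ Φ : Form N 2 ℝ → ℂ, Continuous Φ → GaussBounded Φ →
      ∫ A, ∑' n : Form N 2 ℤ, (if extd n = 0 then Φ (extd A + (2 * π) • toReal n) else 0)
          ∂(fieldMeasure N 1) =
        C * ∑' h : Plane → ℤ,
          ∫ e : exact₂ N, Φ (e.1.ofLp + constForm N ((2 * π) • fun S => (h S : ℝ))) := by
  obtain ⟨c, hc0, hc⟩ := exists_exactMeasure_eq_smul (N := N)
  refine ⟨c, NNReal.coe_pos.2 (pos_iff_ne_zero.2 hc0), fun Φ hΦ hb => ?_⟩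
  have hs := summable_integral_norm_field hb
  have hi := integrable_comp_field hΦ hb
  have h1 : Summable fun n : Form N 2 ℤ => ∫ A, ‖if extd n = 0 then Φ (extd A + (2 * π) • toReal n)
      else 0‖ ∂(fieldMeasure N 1) := by
    refine Summable.of_nonneg_of_le (fun n => integral_nonneg fun A => norm_nonneg _) (fun n => ?_) hs
    split_ifs with h
    · rfl
    · simp only [norm_zero, integral_zero]
      exact integral_nonneg fun A => norm_nonneg _
  rw [← (hasSum_integral_of_summable_integral_norm (F := fun (n : Form N 2 ℤ) A =>
    if extd n = 0 then Φ (extd A + (2 * π) • toReal n) else 0) (fun n => by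
      by_cases h : extd n = 0
      · simpa only [h, if_true] using hi n
      · simp only [h, if_false]; exact integrable_zero _ _ _) h1).tsum_eq]
  -- Only closed `n` contribute, and these are parametrised by fluxes and exact integer forms.
  rw [← closedOf_injective.tsum_eq (f := fun n : Form N 2 ℤ => ∫ A,
    (if extd n = 0 then Φ (extd A + (2 * π) • toReal n) else 0) ∂(fieldMeasure N 1))]
  · simp only [extd_closedOf, if_true]
    have hs2 : Summable fun p : (Plane → ℤ) × ExactInt N =>
        ∫ A, Φ (extd A + (2 * π) • toReal (closedOf p)) ∂(fieldMeasure N 1) :=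
      Summable.of_norm_bounded (hs.comp_injective closedOf_injective) fun p =>
        norm_integral_le_integral_norm _
    rw [hs2.tsum_prod]
    simp only [hasSum_exactField hc hΦ hb]
    rw [tsum_mul_left]
  · intro n hn
    by_contra h
    refine hn ?_
    have : extd n ≠ 0 := fun h0 => h (exists_closedOf_eq h0)
    simp [this]

end ClosedIntegration

/-! ### The path integrals -/

section PathIntegrals

variable {N : ℕ} [NeZero N]

theorem continuous_star₂ : Continuous (star₂ : Form N 2 ℝ → Form N 2 ℝ) :=
  (IsLinearMap.mk' (M := Form N 2 ℝ) (M₂ := Form N 2 ℝ) star₂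
    ⟨star₂_add, star₂_smul⟩).continuous_of_finiteDimensional

theorem continuous_star₃ : Continuous (star₃ : Form N 3 ℝ → Form N 1 ℝ) :=
  (IsLinearMap.mk' (M := Form N 3 ℝ) (M₂ := Form N 1 ℝ) star₃
    ⟨star₃_add, star₃_smul⟩).continuous_of_finiteDimensional

theorem continuous_bdry (r : ℕ) : Continuous (bdry : Form N (r + 1) ℝ → Form N r ℝ) :=
  (bdryₗ N r ℝ).continuous_of_finiteDimensional

theorem continuous_latticeSum_cup {X : Type*} [TopologicalSpace X] {f g : X → Form N 2 ℝ}
    (hf : Continuous f) (hg : Continuous g) : Continuous fun x => latticeSum (cup (f x) (g x)) := by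
  simp only [latticeSum_cup_eq_dot]
  exact continuous_dot hf (continuous_star₂.comp hg)

theorem continuous_latticeSum_cup₁ {X : Type*} [TopologicalSpace X] {f : X → Form N 2 ℝ}
    (hf : Continuous f) (b : Form N 3 ℝ) : Continuous fun x => latticeSum (cup₁ (f x) b) :=
  (IsLinearMap.mk' (M := Form N 2 ℝ) (M₂ := ℝ) (fun a => latticeSum (cup₁ a b))
    ⟨fun a a' => latticeSum_cup₁_add_left a a' b,
      fun t a => latticeSum_cup₁_smul_left t a b⟩).continuous_of_finiteDimensional.comp hf

theorem continuous_fieldStrength (n : Form N 2 ℤ) :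
    Continuous fun A : Form N 1 ℝ => fieldStrength A n := by
  simp only [fieldStrength_eq]
  exact (continuous_extd 1).add continuous_const

/-- Everything in the weights apart from the kinetic term is a phase, so the Gaussian in `n`
controls sum and integral uniformly over the cube. -/
theorem pathIntegralConverges_of_norm {β : ℝ} (hβ : 0 < β)
    {w : Form N 1 ℝ → Form N 3 ℝ → Form N 2 ℤ → ℂ}
    (hc : ∀ n, Continuous fun A : Form N 1 ℝ × Form N 3 ℝ => w A.1 A.2 n)
    (hn : ∀ Ae Am n, ‖w Ae Am n‖ =
      Real.exp (-(β / 2 * dot (fieldStrength Ae n) (fieldStrength Ae n)))) :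
    PathIntegralConverges w := by
  have hb (Ae Am n) : ‖w Ae Am n‖ ≤
      Real.exp (β / 2 * dot (extd Ae) (extd Ae)) * gaussZ (2 * π ^ 2 * (β / 2)) n := by
    rw [hn, fieldStrength_eq, ← neg_mul]
    exact exp_neg_dot_le (by positivity) _ n
  have hs : Summable (gaussZ (ι := Cell N 2) (2 * π ^ 2 * (β / 2))) :=
    summable_gaussZ (by positivity)
  refine ⟨fun Ae Am => Summable.of_norm_bounded (hs.mul_left _) (hb Ae Am), ?_⟩
  have hg : Continuous fun A : Form N 1 ℝ => β / 2 * dot (extd A) (extd A) :=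
    (continuous_dot (continuous_extd 1) (continuous_extd 1)).const_mul _
  obtain ⟨M, hM⟩ := exists_bound_on_fieldCube N 1 hg
  have hcont : Continuous fun A : Form N 1 ℝ × Form N 3 ℝ => ∑' n, w A.1 A.2 n :=
    continuous_tsum_of_exp_bound hc (hg.comp continuous_fst) hs fun A n => hb A.1 A.2 n
  refine Integrable.of_bound hcont.aestronglyMeasurable
    (Real.exp M * ∑' n, gaussZ (ι := Cell N 2) (2 * π ^ 2 * (β / 2)) n) ?_
  have hae : ∀ᵐ A ∂((fieldMeasure N 1).prod (fieldMeasure N 3)), A.1 ∈ fieldCube N 1 :=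
    Measure.quasiMeasurePreserving_fst.ae (ae_mem_fieldCube N 1)
  filter_upwards [hae] with A hA
  rw [← tsum_mul_left]
  refine tsum_of_norm_bounded (hs.mul_left _).hasSum fun n => (hb A.1 A.2 n).trans ?_
  exact mul_le_mul_of_nonneg_right (Real.exp_le_exp.2 (hM _ hA)) (gaussZ_pos _ _).le

theorem norm_cexp_of_re {z : ℂ} {r : ℝ} (h : z.re = r) : ‖cexp z‖ = Real.exp r := by
  rw [Complex.norm_exp, h]

theorem partitionWeight_converges {β : ℝ} (hβ : 0 < β) (θ : ℝ) :
    PathIntegralConverges (N := N) (partitionWeight β θ) := by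
  refine pathIntegralConverges_of_norm hβ (fun n => ?_) fun Ae Am n => ?_
  · unfold partitionWeight charge₀
    have h1 : Continuous fun A : Form N 1 ℝ × Form N 3 ℝ => fieldStrength A.1 n :=
      (continuous_fieldStrength n).comp continuous_fst
    have h2 := continuous_dot h1 h1
    have h3 := continuous_latticeSum_cup h1 h1
    have h4 : Continuous fun A : Form N 1 ℝ × Form N 3 ℝ => bdry A.2 :=
      (continuous_bdry 2).comp continuous_snd
    have h5 := continuous_dot h4 h1
    fun_prop
  · exact norm_cexp_of_re (by simp)

theorem dyonicWeight_converges (γ : Contour N) (qe qm : ℤ) {β : ℝ} (hβ : 0 < β) (θ p : ℝ) :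
    PathIntegralConverges (dyonicWeight γ qe qm β θ p) := by
  refine pathIntegralConverges_of_norm hβ (fun n => ?_) fun Ae Am n => ?_
  · unfold dyonicWeight dyonicLoop charge
    simp only [latticeSum_cup_one_three_eq_dot]
    have h1 : Continuous fun A : Form N 1 ℝ × Form N 3 ℝ => fieldStrength A.1 n :=
      (continuous_fieldStrength n).comp continuous_fst
    have h2 := continuous_dot h1 h1
    have h3 := continuous_latticeSum_cup h1 h1
    have h3' := continuous_latticeSum_cup₁ h1 (toReal (extd n))
    have h4 : Continuous fun A : Form N 1 ℝ × Form N 3 ℝ => bdry A.2 :=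
      (continuous_bdry 2).comp continuous_snd
    have h5 := continuous_dot h4 h1
    have h6 : Continuous fun A : Form N 1 ℝ × Form N 3 ℝ => dot (toReal γ.tangent) A.1 :=
      continuous_dot continuous_const continuous_fst
    have h7 : Continuous fun A : Form N 1 ℝ × Form N 3 ℝ => dot (toReal γ.tangent) (star₃ A.2) :=
      continuous_dot continuous_const (continuous_star₃.comp continuous_snd)
    fun_prop
  · unfold dyonicWeight dyonicLoop
    rw [← Complex.exp_add]
    exact norm_cexp_of_re (by simp)

/-- Integrating over the magnetic field imposes a constraint on `dn`. -/
theorem pathIntegral_character {G : Form N 1 ℝ → Form N 2 ℤ → ℂ} (hG : ∀ A, Summable (G A))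
    (m : Form N 3 ℤ) {w : Form N 1 ℝ → Form N 3 ℝ → Form N 2 ℤ → ℂ}
    (hw : ∀ Ae Am n, w Ae Am n = G Ae n * cexp (-(I * ((dot Am (toReal (extd n - m)) : ℝ) : ℂ)))) :
    pathIntegral w = ∫ A, ∑' n, (if extd n = m then G A n else 0) ∂(fieldMeasure N 1) := by
  unfold pathIntegral
  congr 1
  funext A
  have hn (Am : Form N 3 ℝ) (n : Form N 2 ℤ) : ‖w A Am n‖ = ‖G A n‖ := by
    rw [hw, norm_mul, norm_cexp_of_re (r := 0) (by simp), Real.exp_zero, mul_one]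
  have hcont (n : Form N 2 ℤ) : Continuous fun Am => w A Am n := by
    simp only [hw]
    have := continuous_dot (continuous_id (X := Form N 3 ℝ))
      (continuous_const (y := toReal (extd n - m)))
    simp only [id] at this
    fun_prop
  have hs : Summable fun n => ∫ Am, ‖w A Am n‖ ∂(fieldMeasure N 3) := by
    simp only [hn]
    simpa using (hG A).norm
  rw [← (hasSum_integral_of_summable_integral_norm (F := fun n Am => w A Am n) (fun n =>
    Integrable.of_bound (hcont n).aestronglyMeasurable ‖G A n‖
      (Filter.Eventually.of_forall fun Am => (hn Am n).le)) hs).tsum_eq]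
  refine tsum_congr fun n => ?_
  simp only [hw]
  rw [integral_const_mul, integral_fieldMeasure_character]
  simp only [sub_eq_zero, mul_ite, mul_one, mul_zero]

/-- The weight of a closed 2-form `f` in the presence of a dual surface `l`, after integrating
over the magnetic field. -/
def reducedWeight (β θ : ℝ) (qe qm p : ℤ) (l : Form N 2 ℤ) (f : Form N 2 ℝ) : ℂ :=
  cexp (-((β / 2 * dot (f + (2 * π * qm) • toReal l) (f + (2 * π * qm) • toReal l) : ℝ) : ℂ) +
    I * ((-(θ / (8 * π ^ 2) * (latticeSum (cup f f) + (2 * π * qm) ^ 2 * vOf l +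
        2 * (2 * π * qm * latticeSum (cup f (toReal l))))) -
      qe * latticeSum (cup f (toReal l)) - p * π * (qm ^ 2 * vOf l) : ℝ) : ℂ))

theorem norm_reducedWeight (β θ : ℝ) (qe qm p : ℤ) (l : Form N 2 ℤ) (f : Form N 2 ℝ) :
    ‖reducedWeight β θ qe qm p l f‖ = Real.exp (-(β / 2 *
      dot (f + (2 * π * qm) • toReal l) (f + (2 * π * qm) • toReal l))) :=
  norm_cexp_of_re (by
    rw [Complex.add_re, Complex.neg_re, Complex.ofReal_re, Complex.re_mul_ofReal, Complex.I_re,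
      zero_mul, add_zero])

theorem continuous_reducedWeight (β θ : ℝ) (qe qm p : ℤ) (l : Form N 2 ℤ) :
    Continuous (reducedWeight β θ qe qm p l) := by
  unfold reducedWeight
  have h1 : Continuous fun f : Form N 2 ℝ => f + (2 * π * qm) • toReal l := by fun_prop
  have h2 := continuous_dot h1 h1
  have h3 := continuous_latticeSum_cup (continuous_id (X := Form N 2 ℝ)) continuous_id
  have h4 := continuous_latticeSum_cup (continuous_id (X := Form N 2 ℝ))
    (continuous_const (y := toReal l))
  simp only [id] at h3 h4
  fun_prop

theorem gaussBounded_reducedWeight {β : ℝ} (hβ : 0 < β) (θ : ℝ) (qe qm p : ℤ) (l : Form N 2 ℤ) :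
    GaussBounded (reducedWeight β θ qe qm p l) := by
  set g := (2 * π * qm) • toReal l with hg
  refine ⟨Real.exp (β / 2 * dot g g), β / 4, (Real.exp_pos _).le, by positivity, fun f => ?_⟩
  rw [norm_reducedWeight, ← Real.exp_add, ← hg]
  refine Real.exp_le_exp.2 ?_
  -- Equivalent to `0 ≤ |f + 2g|²`; it is the reason for halving the decay rate to `β / 4`.
  have h : dot f f ≤ 2 * dot (f + g) (f + g) + 2 * dot g g := by
    have := dot_self_nonneg (f + (2 : ℝ) • g)
    simp only [dot_add_left, dot_add_right, dot_smul_left, dot_smul_right, dot_comm g f] at this ⊢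
    linarith
  nlinarith

/-- Since `dF = 2π dn`, the monopole term completes `F ∪ F` to the Pontryagin square of `F`. -/
theorem charge_eq (A : Form N 1 ℝ) (n : Form N 2 ℤ) :
    charge A n = 1 / (8 * π ^ 2) * pontr (fieldStrength A n) := by
  have hpi := Real.pi_ne_zero
  unfold charge pontr
  rw [show extd (fieldStrength A n) = (2 * π) • toReal (extd n) by
    rw [fieldStrength_eq, extd_fieldStrength], latticeSum_cup₁_smul_right]
  field_simp
  ring

theorem dot_bdry_fieldStrength (A : Form N 1 ℝ) (Am : Form N 3 ℝ) (n : Form N 2 ℤ) :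
    1 / (2 * π) * dot (bdry Am) (fieldStrength A n) = -dot Am (toReal (extd n)) := by
  have hpi := Real.pi_ne_zero
  rw [dot_bdry_three, fieldStrength_eq, extd_fieldStrength, dot_smul_right]
  field_simp

theorem summable_fieldStrength {β : ℝ} (hβ : 0 < β) {G : Form N 1 ℝ → Form N 2 ℤ → ℂ}
    (hG : ∀ A n, ‖G A n‖ = Real.exp (-(β / 2 * dot (fieldStrength A n) (fieldStrength A n))))
    (A : Form N 1 ℝ) : Summable (G A) := by
  refine Summable.of_norm_bounded ((summable_gaussZ (ι := Cell N 2)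
    (c := 2 * π ^ 2 * (β / 2)) (by positivity)).mul_left
      (Real.exp (β / 2 * dot (extd A) (extd A)))) fun n => ?_
  rw [hG, fieldStrength_eq, ← neg_mul]
  exact exp_neg_dot_le (by positivity) _ n

theorem cexp_eq_of_sub {x y : ℝ} {k : ℤ} (h : x = y + k * (2 * π)) :
    cexp (I * (x : ℂ)) = cexp (I * (y : ℂ)) := by
  rw [Complex.exp_eq_exp_iff_exists_int]
  exact ⟨k, by rw [h]; push_cast; ring⟩

theorem partitionFunction_eq_reduced {β : ℝ} (hβ : 0 < β) (θ : ℝ) (l : Form N 2 ℤ) :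
    partitionFunction N β θ = ∫ A, ∑' n : Form N 2 ℤ, (if extd n = 0 then
      reducedWeight β θ 0 0 0 l (extd A + (2 * π) • toReal n) else 0) ∂(fieldMeasure N 1) := by
  unfold partitionFunction
  rw [pathIntegral_character (G := fun A n => cexp (-((β / 2 * dot (fieldStrength A n)
      (fieldStrength A n) : ℝ) : ℂ) - I * ((θ * charge₀ A n : ℝ) : ℂ)))
    (summable_fieldStrength hβ fun A n => norm_cexp_of_re (by simp)) 0]
  · congr 1
    funext A
    refine tsum_congr fun n => ?_
    split_ifs with h
    · unfold reducedWeight charge₀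
      rw [fieldStrength_eq]
      congr 1
      simp
      ring
    · rfl
  · intro Ae Am n
    unfold partitionWeight
    rw [← Complex.exp_add, sub_zero, dot_bdry_fieldStrength]
    congr 1
    push_cast
    ring

theorem pathIntegral_dyonic_eq_reduced {γ : Contour N} {l : Form N 2 ℤ} (hl : IsDualSurface γ l)
    (qe qm p : ℤ) {β : ℝ} (hβ : 0 < β) (θ : ℝ) :
    pathIntegral (dyonicWeight γ qe qm β θ p) = ∫ A, ∑' n : Form N 2 ℤ, (if extd n = 0 then
      reducedWeight β θ qe qm p l (extd A + (2 * π) • toReal n) else 0) ∂(fieldMeasure N 1) := by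
  rw [pathIntegral_character (G := fun A n => cexp (-((β / 2 * dot (fieldStrength A n)
      (fieldStrength A n) : ℝ) : ℂ) + I * ((-(θ * charge A n) - p * π * (pontryagin n : ℝ) +
        qe * dot (toReal γ.tangent) A : ℝ) : ℂ)))
    (summable_fieldStrength hβ fun A n => norm_cexp_of_re (by simp)) (qm • extd l)]
  · congr 1
    funext A
    -- Solves the constraint: the new summation variable is closed.
    rw [← (Equiv.addLeft (qm • l)).tsum_eq]
    refine tsum_congr fun n => ?_
    have hd : extd (qm • l + n) = qm • extd l + extd n := by
      rw [extd_add]; congr 1; exact extd_smul qm l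
    simp only [Equiv.coe_addLeft, hd, add_eq_left]
    split_ifs with h
    · have hF : fieldStrength A (qm • l + n) =
          extd A + (2 * π) • toReal n + (2 * π * qm) • toReal l := by
        rw [fieldStrength_eq, toReal_add, toReal_zsmul, smul_add, smul_smul]; abel
      set f := extd A + (2 * π) • toReal n with hf
      have hfc : extd f = 0 := by rw [hf, extd_fieldStrength, h, toReal_zero, smul_zero]
      have hv : pontr (toReal l) = (vOf l : ℝ) := pontr_toReal l
      obtain ⟨k, hk⟩ : ∃ k : ℤ, pontryagin (qm • l + n) = qm ^ 2 * vOf l + 2 * k := by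
        have h1 := pontryagin_add_closed (qm • l) h
        rw [pontryagin_smul, add_comm n] at h1
        obtain ⟨k, hk⟩ := (Int.modEq_iff_dvd.1 h1.symm)
        exact ⟨k, by rw [← hk]; unfold vOf; ring⟩
      have hfl : latticeSum (cup f (toReal l)) =
          -dot (toReal γ.tangent) A + 2 * π * ((latticeSum (cup n l) : ℤ) : ℝ) := by
        rw [hf, latticeSum_cup_add_left, latticeSum_extd_cup_of_isDualSurface hl,
          latticeSum_cup_smul_left, latticeSum_cup_toReal]
      unfold reducedWeight
      rw [charge_eq, hF, pontr_add_of_closed _ hfc, pontr_smul, latticeSum_cup_smul_right, hv,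
        Complex.exp_add, Complex.exp_add]
      congr 1
      -- Two integers drop out of the phase: the even change of the Pontryagin square under a closed
      -- shift, weighted by `p`, and the pairing of `n` with `l` left over when the electric loop is
      -- written as a cup product of the field with `l`.
      refine cexp_eq_of_sub (k := -(p * k) + qe * latticeSum (cup n l)) ?_
      rw [hk]
      have hpi := Real.pi_ne_zero
      have hdot : dot (toReal γ.tangent) A = -latticeSum (cup f (toReal l)) +
        2 * π * ((latticeSum (cup n l) : ℤ) : ℝ) := by rw [hfl]; ring
      rw [hdot]
      push_cast
      field_simp
      ring
    · rfl
  · intro Ae Am n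
    unfold dyonicWeight dyonicLoop
    rw [← Complex.exp_add, ← Complex.exp_add, dot_bdry_fieldStrength, latticeSum_tangent_cup hl,
      toReal_sub, toReal_zsmul, dot_sub_right, dot_smul_right]
    congr 1
    push_cast
    ring

end PathIntegrals

/-! ### The Gaussian integral over exact 2-forms -/

section GaussianIntegral

variable {N : ℕ} [NeZero N]

/-- The squared norm of the coexact part of `l`. -/
def coexactNormSq (l : Form N 2 ℤ) : ℝ := dot (coexactProj (toReal l)) (coexactProj (toReal l))

theorem latticeSum_constForm_cup (h : Plane → ℝ) (a : Form N 2 ℝ) :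
    latticeSum (cup (constForm N h) a) = fluxPairing h (flux a) := by
  obtain ⟨A, hA⟩ := hodge_decomposition a
  obtain ⟨B, hB⟩ := exists_coexactProj_eq a
  have h1 := latticeSum_cup_comm (extd A) (constForm N h)
  rw [extd_constForm, extd_extd, latticeSum_cup₁_zero_left, latticeSum_cup₁_zero_right,
    latticeSum_extd_cup_of_closed A (extd_constForm (N := N) h)] at h1
  have h2 : latticeSum (cup (constForm N h) (extd A)) = 0 := by linarith
  nth_rw 1 [hA]
  rw [latticeSum_cup_add_right, latticeSum_cup_add_right, h2, latticeSum_cup_constForm, hB,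
    latticeSum_cup_constForm_bdry]
  ring

/-- The exact and constant parts of `a` are closed, so they pair to zero with an exact form. -/
theorem latticeSum_extd_cup_eq (A : Form N 1 ℝ) (a : Form N 2 ℝ) :
    latticeSum (cup (extd A) a) = dot (extd A) (star₂ (coexactProj a)) := by
  obtain ⟨A', hA⟩ := hodge_decomposition a
  nth_rw 1 [hA]
  rw [latticeSum_cup_add_right, latticeSum_cup_add_right, latticeSum_extd_cup_extd,
    latticeSum_extd_cup_of_closed A (extd_constForm (N := N) _), latticeSum_cup_eq_dot]
  ring

theorem fluxPairing_smul (s t : ℝ) (h k : Plane → ℝ) :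
    fluxPairing (s • h) (t • k) = s * t * fluxPairing h k := by
  simp only [fluxPairing, Pi.smul_apply, smul_eq_mul]; ring

theorem dot_exact_const_coexact (e : exact₂ N) (h : Plane → ℝ) (r : ℝ) (a : Form N 2 ℝ) :
    dot (e.1.ofLp + constForm N h + r • coexactProj a) (e.1.ofLp + constForm N h +
        r • coexactProj a) =
      ‖e‖ ^ 2 + ∑ S, h S ^ 2 + r ^ 2 * dot (coexactProj a) (coexactProj a) := by
  obtain ⟨B, hB⟩ := exists_coexactProj_eq a
  obtain ⟨A, hA⟩ := mem_exact₂.1 e.2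
  have h1 : dot (constForm N h) (coexactProj a) = 0 := by
    rw [dot_constForm_left, hB, flux_bdry]; simp
  have h2 : dot e.1.ofLp (coexactProj a) = 0 := by
    rw [← hA, hB, dot_comm]; exact dot_bdry_extd B A
  have h3 : dot (constForm N h) (constForm N h) = ∑ S, h S ^ 2 := by
    rw [dot_constForm_left, flux_constForm]; simp only [sq]
  have h4 := norm_sq_le_dot_add_constForm e h
  have h5 : dot (e.1.ofLp + constForm N h) (coexactProj a) = 0 := by
    rw [dot_add_left, h1, h2, add_zero]
  rw [← h3, h4]
  generalize coexactProj a = c at *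
  generalize e.1.ofLp + constForm N h = b at *
  simp only [dot_add_left, dot_add_right, dot_smul_left, dot_smul_right, dot_comm c b, h5]
  ring

/-- The exponent of the contribution of the fluxes `h`. -/
def fluxWeight (β θ : ℝ) (qe qm : ℤ) (k : Plane → ℝ) (h : Plane → ℤ) : ℂ :=
  cexp (-((2 * π ^ 2 * β * ∑ S, (h S + qm * k S) ^ 2 : ℝ) : ℂ) -
    I * ((2 * π * (qe + θ / (2 * π) * qm) * fluxPairing (fun S => (h S : ℝ)) k +
      θ / 2 * fluxPairing (fun S => (h S : ℝ)) (fun S => (h S : ℝ)) : ℝ) : ℂ))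

/-- The exponent of the contribution of the contour that does not depend on the fluxes. -/
def contourExponent (β θ : ℝ) (qe qm p : ℤ) (l : Form N 2 ℤ) : ℂ :=
  -((2 * π ^ 2 * β * qm ^ 2 * coexactNormSq l +
      (qe + θ / (2 * π) * qm) ^ 2 * coexactNormSq l / (2 * β) : ℝ) : ℂ) +
    I * ((π * (qe + θ / (2 * π) * qm) * qm *
      (vOf l - uOf l - fluxPairing (flux (toReal l)) (flux (toReal l))) -
        θ / 2 * qm ^ 2 * vOf l - p * π * qm ^ 2 * vOf l : ℝ) : ℂ)

/-- The Gaussian determinant of the exact 2-forms. -/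
def gaussDet (N : ℕ) [NeZero N] (β : ℝ) : ℂ :=
  (π / ((β / 2 : ℝ) : ℂ)) ^ (Module.finrank ℝ (exact₂ N) / 2 : ℂ)

theorem gaussDet_ne_zero {β : ℝ} (hβ : 0 < β) : gaussDet N β ≠ 0 := by
  unfold gaussDet
  rw [Ne, Complex.cpow_eq_zero_iff, not_and_or]
  left
  have := Real.pi_ne_zero
  have := hβ.ne'
  refine div_ne_zero (by exact_mod_cast Real.pi_ne_zero) ?_
  exact_mod_cast (half_pos hβ).ne'

theorem latticeSum_cup_add_constForm (e : exact₂ N) (h : Plane → ℝ) :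
    latticeSum (cup (e.1.ofLp + constForm N h) (e.1.ofLp + constForm N h)) = fluxPairing h h := by
  obtain ⟨h1, h2⟩ := closed_of_mem_exact₂ e
  rw [latticeSum_cup_self_of_closed (by rw [extd_add, h1, extd_constForm, add_zero]), flux_add, h2,
    flux_constForm, zero_add]

/-- Once the exact part of `l` is translated away, the exponent is `-(β/2)|e|²` plus an imaginary
linear term `-i s ⟨σ, e⟩`. The Gaussian formula turns the latter into `-s²|σ|²/(2β)`, and all other
terms are independent of `e`. -/
theorem integral_reducedWeight {β : ℝ} (hβ : 0 < β) (θ : ℝ) (qe qm p : ℤ) (l : Form N 2 ℤ)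
    (h : Plane → ℤ) :
    ∫ e : exact₂ N, reducedWeight β θ qe qm p l
        (e.1.ofLp + constForm N ((2 * π) • fun S => (h S : ℝ))) =
      gaussDet N β * cexp (contourExponent β θ qe qm p l) *
        fluxWeight β θ qe qm (flux (toReal l)) h := by
  obtain ⟨A, hA⟩ := hodge_decomposition (toReal l)
  obtain ⟨B, hB⟩ := exists_coexactProj_eq (toReal l)
  have hpi := Real.pi_ne_zero
  set k := flux (toReal l) with hk
  -- The effective electric charge, including the shift by `θ` known as the Witten effect; it is the
  -- real part of `q`.
  set s : ℝ := qe + θ / (2 * π) * qm with hs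
  let H : Plane → ℝ := fun S => (h S : ℝ)
  -- Represents the functional `e ↦ ∑ e ∪ l` on exact forms; its norm is that of the coexact part of
  -- `l`.
  let σ : exact₂ N := ⟨WithLp.toLp 2 (star₂ (coexactProj (toReal l))),
    mem_exact₂.2 ⟨star₃ B, by rw [hB, star₂_bdry]⟩⟩
  -- The exact part of `2π q_m l`: subtracting it from `e` removes it from the kinetic term, at the
  -- price of a constant in `∑ f ∪ l`.
  let g : exact₂ N := ⟨WithLp.toLp 2 (extd ((2 * π * qm) • A)), mem_exact₂.2 ⟨_, rfl⟩⟩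
  have hσ : ‖σ‖ ^ 2 = coexactNormSq l := by
    refine (norm_toLp_sq (star₂ (coexactProj (toReal l)))).trans ?_
    rw [dot_star₂]; rfl
  -- Evaluates this constant. It is where `u` and the term `v q_e q_m` enter the final formula.
  have hAl : 2 * latticeSum (cup (extd A) (toReal l)) = vOf l - uOf l - fluxPairing k k := by
    have := pontr_decomposition hA
    rw [pontr_toReal] at this
    unfold vOf uOf
    linarith
  have hcup (e : exact₂ N) : latticeSum (cup ((e - g).1.ofLp + constForm N ((2 * π) • H))
      (toReal l)) = inner ℝ σ e - π * qm * (vOf l - uOf l - fluxPairing k k) +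
        2 * π * fluxPairing H k := by
    obtain ⟨A', hA'⟩ := mem_exact₂.1 e.2
    have h1 : (e - g).1.ofLp = extd A' + (-(2 * π * qm)) • extd A := by
      change e.1.ofLp - extd ((2 * π * qm) • A) = _
      rw [← hA', extd_smul, neg_smul, ← sub_eq_add_neg]
    have h2 : inner ℝ σ e = latticeSum (cup (extd A') (toReal l)) := by
      rw [latticeSum_extd_cup_eq, dot_comm, ← inner_toLp, hA']; rfl
    rw [h1, latticeSum_cup_add_left, latticeSum_cup_add_left, latticeSum_cup_smul_left, ← h2,
      latticeSum_constForm_cup, ← hk]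
    have h3 := fluxPairing_smul (2 * π) 1 H k
    rw [one_smul] at h3
    rw [h3]
    linear_combination (-(π * qm)) * hAl
  have hdot (e : exact₂ N) : dot ((e - g).1.ofLp + constForm N ((2 * π) • H) +
      (2 * π * qm) • toReal l) ((e - g).1.ofLp + constForm N ((2 * π) • H) +
      (2 * π * qm) • toReal l) = ‖e‖ ^ 2 + 4 * π ^ 2 * ∑ S, (h S + qm * k S) ^ 2 +
        4 * π ^ 2 * qm ^ 2 * coexactNormSq l := by
    have h1 : (e - g).1.ofLp + constForm N ((2 * π) • H) + (2 * π * qm) • toReal l =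
        e.1.ofLp + constForm N ((2 * π) • (H + (qm : ℝ) • k)) +
          (2 * π * qm) • coexactProj (toReal l) := by
      change e.1.ofLp - extd ((2 * π * qm) • A) + _ + _ = _
      nth_rw 1 [hA]
      rw [extd_smul, constForm_smul, constForm_smul, constForm_add, constForm_smul]
      simp only [smul_add, smul_smul]
      abel
    rw [h1, dot_exact_const_coexact]
    have h2 : ∑ S, ((2 * π) • (H + (qm : ℝ) • k)) S ^ 2 =
        4 * π ^ 2 * ∑ S, (h S + qm * k S) ^ 2 := by
      rw [Finset.mul_sum]
      refine Finset.sum_congr rfl fun S _ => ?_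
      simp only [Pi.smul_apply, Pi.add_apply, smul_eq_mul, H]
      ring
    rw [h2]
    unfold coexactNormSq
    ring
  rw [← integral_sub_right_eq_self _ g]
  have hint (e : exact₂ N) : reducedWeight β θ qe qm p l ((e - g).1.ofLp +
      constForm N ((2 * π) • H)) =
      cexp (-((2 * π ^ 2 * β * ∑ S, (h S + qm * k S) ^ 2 +
        2 * π ^ 2 * β * qm ^ 2 * coexactNormSq l : ℝ) : ℂ) +
        I * ((π * s * qm * (vOf l - uOf l - fluxPairing k k) - 2 * π * s * fluxPairing H k -
          θ / 2 * fluxPairing H H - θ / 2 * qm ^ 2 * vOf l - p * π * qm ^ 2 * vOf l : ℝ) : ℂ)) *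
      cexp (-((β / 2 : ℝ) : ℂ) * ‖e‖ ^ 2 + (-I * s) * ((inner ℝ σ e : ℝ) : ℂ)) := by
    unfold reducedWeight
    rw [hcup, hdot, latticeSum_cup_add_constForm, fluxPairing_smul, ← Complex.exp_add]
    congr 1
    rw [show -((β / 2 : ℝ) : ℂ) * ‖e‖ ^ 2 + (-I * s) * ((inner ℝ σ e : ℝ) : ℂ) =
      -((β / 2 * ‖e‖ ^ 2 : ℝ) : ℂ) + I * ((-(s * inner ℝ σ e) : ℝ) : ℂ) by push_cast; ring]
    rw [add_add_add_comm, ← neg_add, ← mul_add, ← Complex.ofReal_add, ← Complex.ofReal_add]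
    refine congrArg₂ (fun x y : ℝ => -(x : ℂ) + I * (y : ℂ)) ?_ ?_
    · ring
    · rw [hs]
      field_simp
      ring
  have hint' : (fun e : exact₂ N => reducedWeight β θ qe qm p l ((e - g).1.ofLp +
      constForm N ((2 * π) • fun S => (h S : ℝ)))) = _ := funext hint
  rw [hint', integral_const_mul, GaussianFourier.integral_cexp_neg_mul_sq_norm_add
    (by rw [Complex.ofReal_re]; positivity)]
  have hG : (π / ((β / 2 : ℝ) : ℂ)) ^ (Module.finrank ℝ (exact₂ N) / 2 : ℂ) = gaussDet N β := rfl
  rw [mul_left_comm, ← Complex.exp_add, hG, mul_assoc (gaussDet N β), contourExponent, fluxWeight,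
    ← Complex.exp_add]
  congr 2
  rw [← Complex.ofReal_pow, hσ]
  have hβ' : (β : ℂ) ≠ 0 := by exact_mod_cast hβ.ne'
  have : (-I * (s : ℂ)) ^ 2 = -(s : ℂ) ^ 2 := by rw [mul_pow, neg_sq, I_sq]; ring
  rw [this, ← hs, ← hk]
  push_cast
  field_simp
  ring

/-- The constant depends only on the lattice and on `β`, so it cancels in expectation values. -/
theorem exists_pathIntegral_eq (N : ℕ) [NeZero N] {β : ℝ} (hβ : 0 < β) :
    ∃ C : ℂ, C ≠ 0 ∧ (∀ θ : ℝ, partitionFunction N β θ =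
        C * ∑' h : Plane → ℤ, fluxWeight β θ 0 0 0 h) ∧
      ∀ (γ : Contour N) (l : Form N 2 ℤ), IsDualSurface γ l → ∀ (θ : ℝ) (qe qm p : ℤ),
        pathIntegral (dyonicWeight γ qe qm β θ p) = C * cexp (contourExponent β θ qe qm p l) *
          ∑' h : Plane → ℤ, fluxWeight β θ qe qm (flux (toReal l)) h := by
  obtain ⟨C, hC, h⟩ := exists_integral_tsum_closed N
  have key (θ : ℝ) (qe qm p : ℤ) (l : Form N 2 ℤ) := h _ (continuous_reducedWeight β θ qe qm p l)
    (gaussBounded_reducedWeight hβ θ qe qm p l)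
  refine ⟨C * gaussDet N β, mul_ne_zero (by exact_mod_cast hC.ne') (gaussDet_ne_zero hβ),
    fun θ => ?_, fun γ l hl θ qe qm p => ?_⟩
  -- At zero charges the dual surface has coefficient zero throughout, so `l = 0` serves and makes
  -- its fluxes vanish.
  · rw [partitionFunction_eq_reduced hβ θ 0, key]
    simp only [integral_reducedWeight hβ]
    have h0 : flux (toReal (0 : Form N 2 ℤ)) = 0 := by
      rw [toReal_zero]; funext S; simp [flux]
    have h1 : contourExponent β θ 0 0 0 (0 : Form N 2 ℤ) = 0 := by simp [contourExponent]
    rw [h0, h1, Complex.exp_zero, mul_one, tsum_mul_left, mul_assoc]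
  · rw [pathIntegral_dyonic_eq_reduced hl qe qm p hβ, key]
    simp only [integral_reducedWeight hβ]
    rw [tsum_mul_left]
    ring

end GaussianIntegral

/-! ### Theta functions of a pair of fluxes -/

section Theta

theorem summable_exp_neg_mul_add_sq {c : ℝ} (hc : 0 < c) (y : ℝ) :
    Summable fun k : ℤ => Real.exp (-c * ((k : ℝ) + y) ^ 2) := by
  refine Summable.of_nonneg_of_le (fun k => (Real.exp_pos _).le) (fun k => ?_)
    ((summable_exp_neg_mul_sq (half_pos hc)).mul_left (Real.exp (c * y ^ 2)))
  rw [← Real.exp_add]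
  refine Real.exp_le_exp.2 ?_
  nlinarith [mul_nonneg hc.le (sq_nonneg ((k : ℝ) + 2 * y))]

theorem summable_exp_neg_int_prod {c : ℝ} (hc : 0 < c) (x y : ℝ) :
    Summable fun p : ℤ × ℤ => Real.exp (-c * (((p.1 : ℝ) + x) ^ 2 + ((p.2 : ℝ) + y) ^ 2)) := by
  refine ((summable_exp_neg_mul_add_sq hc x).mul_of_nonneg (summable_exp_neg_mul_add_sq hc y)
    (fun k => (Real.exp_pos _).le) fun k => (Real.exp_pos _).le).congr fun p => ?_
  rw [← Real.exp_add, mul_add]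

/-- The contribution of the dual fluxes `p` of a plane and the orthogonal plane, where `x`, `y` are
the fluxes of the dual surface. -/
def thetaTerm (x y : ℝ) (qe qm : ℤ) (τ : ℂ) (p : ℤ × ℤ) : ℂ :=
  cexp (((-(π * Complex.normSq (p.1 + p.2 * τ + x * (qe + τ * qm)) / τ.im) : ℝ) : ℂ) +
    I * ((2 * π * y * (p.1 * qm - p.2 * qe) : ℝ) : ℂ))

/-- The theta function of a pair of orthogonal planes. -/
def planeTheta (x y : ℝ) (qe qm : ℤ) (τ : ℂ) : ℂ := ∑' p : ℤ × ℤ, thetaTerm x y qe qm τ p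

theorem norm_thetaTerm (x y : ℝ) (qe qm : ℤ) (τ : ℂ) (p : ℤ × ℤ) :
    ‖thetaTerm x y qe qm τ p‖ =
      Real.exp (-(π * Complex.normSq (p.1 + p.2 * τ + x * (qe + τ * qm)) / τ.im)) :=
  norm_cexp_of_re (by
    rw [Complex.add_re, Complex.ofReal_re, Complex.re_mul_ofReal, Complex.I_re, zero_mul, add_zero])

theorem normSq_theta (x : ℝ) (qe qm : ℤ) (τ : ℂ) (n m : ℤ) :
    Complex.normSq (n + m * τ + x * (qe + τ * qm)) =
      (n + τ.re * m + (qe + τ.re * qm) * x) ^ 2 + τ.im ^ 2 * (m + qm * x) ^ 2 := by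
  rw [Complex.normSq_apply]
  simp only [Complex.add_re, Complex.add_im, Complex.mul_re, Complex.mul_im, Complex.intCast_re,
    Complex.intCast_im, Complex.ofReal_re, Complex.ofReal_im]
  ring

/-- `|n + mτ|²` is positive definite in `(n, m)` because `Im τ > 0`; a shift costs only a constant
factor. -/
theorem summable_norm_thetaTerm (x y : ℝ) (qe qm : ℤ) {τ : ℂ} (hτ : 0 < τ.im) :
    Summable fun p => ‖thetaTerm x y qe qm τ p‖ := by
  set t := τ.im with ht
  set r := τ.re with hr
  set z := (qe + r * qm) * x with hz
  set w := qm * x with hw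
  -- `M` and `K` come from bounding `m = Y - w` and `n = X - rm - z` by the inequalities for squares
  -- of two and three terms. The first summand of `M` absorbs the coefficient of `X²`, the second
  -- that of `t²Y²`.
  set M : ℝ := 3 * t ^ 2 + 2 * (1 + 3 * r ^ 2) with hM
  have hM0 : 0 < M := by positivity
  set K : ℝ := t ^ 2 * (3 * z ^ 2 + (1 + 3 * r ^ 2) * 2 * w ^ 2) with hK
  have key (n m : ℝ) : t ^ 2 * (n ^ 2 + m ^ 2) - K ≤
      M * ((n + r * m + z) ^ 2 + t ^ 2 * (m + w) ^ 2) := by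
    set X := n + r * m + z with hX
    set Y := m + w with hY
    have h1 : m ^ 2 ≤ 2 * Y ^ 2 + 2 * w ^ 2 := by
      have : m = Y - w := by rw [hY]; ring
      rw [this]; nlinarith [sq_nonneg (Y + w)]
    have h2 : n ^ 2 ≤ 3 * X ^ 2 + 3 * (r * m) ^ 2 + 3 * z ^ 2 := by
      have : n = X - r * m - z := by rw [hX]; ring
      rw [this]
      nlinarith [sq_nonneg (X + r * m), sq_nonneg (X + z), sq_nonneg (r * m - z)]
    have h3 : n ^ 2 + m ^ 2 ≤ 3 * X ^ 2 + 3 * z ^ 2 + (1 + 3 * r ^ 2) * (2 * Y ^ 2 + 2 * w ^ 2) := by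
      have : (1 + 3 * r ^ 2) * m ^ 2 ≤ (1 + 3 * r ^ 2) * (2 * Y ^ 2 + 2 * w ^ 2) :=
        mul_le_mul_of_nonneg_left h1 (by positivity)
      nlinarith
    have h4 := mul_le_mul_of_nonneg_left h3 (sq_nonneg t)
    have h5 : 0 ≤ 2 * (1 + 3 * r ^ 2) * X ^ 2 + 3 * t ^ 2 * (t ^ 2 * Y ^ 2) := by positivity
    rw [hK, hM]
    linarith
  refine Summable.of_nonneg_of_le (fun p => norm_nonneg _) (fun p => ?_)
    ((summable_exp_neg_int_prod (c := π * t / M) (by positivity) 0 0).mul_left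
      (Real.exp (π * K / (M * t))))
  rw [norm_thetaTerm, ← Real.exp_add, normSq_theta]
  refine Real.exp_le_exp.2 ?_
  have := key p.1 p.2
  rw [← hr, ← ht, ← hz, ← hw, add_zero, add_zero]
  have h6 : π * K / (M * t) + -(π * t / M) * ((p.1 : ℝ) ^ 2 + (p.2 : ℝ) ^ 2) =
      -(π / (M * t) * (t ^ 2 * ((p.1 : ℝ) ^ 2 + (p.2 : ℝ) ^ 2) - K)) := by field_simp; ring
  rw [h6, neg_le_neg_iff]
  calc _ ≤ π / (M * t) * (M * ((p.1 + r * p.2 + z) ^ 2 + t ^ 2 * (p.2 + w) ^ 2)) :=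
        mul_le_mul_of_nonneg_left this (by positivity)
    _ = _ := by field_simp

/-- At zero charges the phases disappear and all terms are positive. -/
theorem planeTheta_zero_ne_zero (x y : ℝ) {τ : ℂ} (hτ : 0 < τ.im) : planeTheta x y 0 0 τ ≠ 0 := by
  have h (p : ℤ × ℤ) : thetaTerm x y 0 0 τ p = ((‖thetaTerm x y 0 0 τ p‖ : ℝ) : ℂ) := by
    rw [norm_thetaTerm, thetaTerm, Complex.ofReal_exp]
    congr 1
    simp
  unfold planeTheta
  rw [tsum_congr h, ← Complex.ofReal_tsum, Complex.ofReal_ne_zero]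
  exact ((summable_norm_thetaTerm x y 0 0 hτ).tsum_pos (fun p => norm_nonneg _) 0 (by
    rw [norm_thetaTerm]; exact Real.exp_pos _)).ne'

/-- The contribution of the fluxes `p` of a plane and the orthogonal plane. -/
def planeTerm (x y : ℝ) (qe qm : ℤ) (τ : ℂ) (p : ℤ × ℤ) : ℂ :=
  cexp (-((π * τ.im * ((p.1 + qm * x) ^ 2 + (p.2 + qm * y) ^ 2) : ℝ) : ℂ) -
    I * ((2 * π * ((qe + τ.re * qm) * (p.1 * y + p.2 * x) + τ.re * (p.1 * p.2)) : ℝ) : ℂ))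

theorem summable_norm_planeTerm (x y : ℝ) (qe qm : ℤ) {τ : ℂ} (hτ : 0 < τ.im) :
    Summable fun p => ‖planeTerm x y qe qm τ p‖ := by
  refine (summable_exp_neg_int_prod (c := π * τ.im) (by positivity) (qm * x) (qm * y)).congr
    fun p => ?_
  rw [planeTerm, norm_cexp_of_re]
  rw [Complex.sub_re, Complex.neg_re, Complex.ofReal_re, Complex.re_mul_ofReal, Complex.I_re]
  ring

/-- Poisson summation in the second flux at fixed first flux `a`. The dual variable `n` and `a`
combine to the lattice point `n + aτ`, on which the modular group acts linearly; the original sum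
shows no such symmetry. -/
theorem tsum_planeTerm (x y : ℝ) (qe qm : ℤ) {τ : ℂ} (hτ : 0 < τ.im) :
    ∑' p, planeTerm x y qe qm τ p = 1 / (τ.im : ℂ) ^ (1 / 2 : ℂ) *
      cexp (I * ((2 * π * (x * y) * ((qe + τ.re * qm) * qm) : ℝ) : ℂ)) * planeTheta x y qe qm τ := by
  set t := τ.im with ht
  set r := τ.re with hr
  set s : ℝ := qe + r * qm with hs
  have ht0 : (t : ℂ) ≠ 0 := by exact_mod_cast hτ.ne'
  have hfib (a : ℤ) : ∑' b : ℤ, planeTerm x y qe qm τ (a, b) = 1 / (t : ℂ) ^ (1 / 2 : ℂ) *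
      cexp (I * ((2 * π * (x * y) * (s * qm) : ℝ) : ℂ)) *
        ∑' n : ℤ, thetaTerm x y qe qm τ (n, a) := by
    have h1 (b : ℤ) : planeTerm x y qe qm τ (a, b) =
        cexp (-(π * t * ((a + qm * x) ^ 2 + (qm * y) ^ 2)) - 2 * π * I * (s * a * y)) *
        cexp (-π * t * b ^ 2 + 2 * π * (-(t * qm * y) - I * (s * x + r * a)) * b) := by
      rw [planeTerm, ← Complex.exp_add, ← ht, ← hr, ← hs]
      congr 1
      push_cast
      ring
    have h2 (n : ℤ) : thetaTerm x y qe qm τ (n, a) =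
        cexp (-(I * ((2 * π * (x * y) * (s * qm) : ℝ) : ℂ))) *
        cexp (-(π * t * ((a + qm * x) ^ 2 + (qm * y) ^ 2)) - 2 * π * I * (s * a * y)) *
        cexp (-π / t * (n + I * (-(t * qm * y) - I * (s * x + r * a))) ^ 2) := by
      rw [thetaTerm, ← Complex.exp_add, ← Complex.exp_add, normSq_theta, ← ht, ← hr, ← hs]
      congr 1
      have hI : (n : ℂ) + I * (-(t * qm * y) - I * (s * x + r * a)) =
          n + s * x + r * a - I * (t * qm * y) := by linear_combination (-(s * x + r * a : ℂ)) * I_sq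
      have hI2 : ((n : ℂ) + s * x + r * a - I * (t * qm * y)) ^ 2 =
          (n + s * x + r * a) ^ 2 - 2 * I * (n + s * x + r * a) * (t * qm * y) -
            (t * qm * y) ^ 2 := by linear_combination ((t * qm * y : ℂ)) ^ 2 * I_sq
      rw [hI, hI2]
      have hqe : (qe : ℂ) = s - r * qm := by rw [hs]; push_cast; ring
      push_cast
      rw [hqe]
      field_simp
      ring
    simp only [h1, h2]
    rw [tsum_mul_left, tsum_mul_left, Complex.tsum_exp_neg_quadratic (by simpa using hτ),
      Complex.exp_neg]
    have := Complex.exp_ne_zero (I * ((2 * π * (x * y) * (s * qm) : ℝ) : ℂ))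
    field_simp
  -- The outer variable `a` is the second coordinate of the theta term, so absolute summability is
  -- needed to sum in the other order.
  have hsw := summable_norm_thetaTerm x y qe qm hτ
  have hsw' : Summable fun p : ℤ × ℤ => thetaTerm x y qe qm τ p.swap :=
    ((Equiv.prodComm ℤ ℤ).summable_iff.2 hsw.of_norm)
  rw [(summable_norm_planeTerm x y qe qm hτ).of_norm.tsum_prod]
  simp only [hfib]
  rw [tsum_mul_left]
  congr 1
  unfold planeTheta
  rw [← (Equiv.prodComm ℤ ℤ).tsum_eq]
  exact (hsw'.tsum_prod).symm

theorem im_moebius {a b c d : ℤ} (h : a * d - b * c = 1) {τ : ℂ} :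
    ((a * τ + b) / (c * τ + d) : ℂ).im = τ.im / Complex.normSq (c * τ + d) := by
  rw [Complex.div_im, ← sub_div]
  congr 1
  have : (a * d - b * c : ℝ) = 1 := by exact_mod_cast h
  simp
  linear_combination τ.im * this

theorem denom_ne_zero {a b c d : ℤ} (h : a * d - b * c = 1) {τ : ℂ} (hτ : 0 < τ.im) :
    (c * τ + d : ℂ) ≠ 0 := by
  intro h0
  have h1 := congrArg Complex.im h0
  have h2 := congrArg Complex.re h0
  simp at h1 h2
  rcases h1 with rfl | h1
  · simp at h2; subst h2; simp at h
  · exact hτ.ne' h1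

theorem charge_moebius {a b c d : ℤ} (h : a * d - b * c = 1) {τ : ℂ} (hτ : 0 < τ.im) (qe qm : ℤ) :
    ((a * qe - b * qm : ℤ) : ℂ) + (a * τ + b) / (c * τ + d) * ((-c * qe + d * qm : ℤ) : ℂ) =
      (qe + τ * qm) / (c * τ + d) := by
  have hd := denom_ne_zero h hτ
  have hC : (a * d - b * c : ℂ) = 1 := by exact_mod_cast h
  rw [eq_div_iff hd, add_mul, mul_right_comm, div_mul_cancel₀ _ hd]
  push_cast
  linear_combination (qe + τ * qm) * hC

/-- The action of `SL(2,ℤ)` on pairs of integers. -/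
def pairEquiv {a b c d : ℤ} (h : a * d - b * c = 1) : ℤ × ℤ ≃ ℤ × ℤ where
  toFun p := (a * p.1 - b * p.2, -c * p.1 + d * p.2)
  invFun p := (d * p.1 + b * p.2, c * p.1 + a * p.2)
  left_inv p := Prod.ext (by linear_combination p.1 * h) (by linear_combination p.2 * h)
  right_inv p := Prod.ext (by linear_combination p.1 * h) (by linear_combination p.2 * h)

/-- When the summation pair transforms like the charges, the shifted lattice point is divided by `cτ
+ d`, as is `q`; the resulting factor in the squared norm cancels that of `Im τ`. The phase is a
determinant of two pairs, hence invariant. -/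
theorem planeTheta_moebius {a b c d : ℤ} (h : a * d - b * c = 1) {τ : ℂ} (hτ : 0 < τ.im)
    (x y : ℝ) (qe qm : ℤ) :
    planeTheta x y (a * qe - b * qm) (-c * qe + d * qm) ((a * τ + b) / (c * τ + d)) =
      planeTheta x y qe qm τ := by
  have hd := denom_ne_zero h hτ
  have hC : (a * d - b * c : ℂ) = 1 := by exact_mod_cast h
  unfold planeTheta
  rw [← (pairEquiv h).tsum_eq]
  refine tsum_congr fun p => ?_
  unfold thetaTerm
  simp only [pairEquiv, Equiv.coe_fn_mk]
  have h1 : (((a * p.1 - b * p.2 : ℤ) : ℂ) + ((-c * p.1 + d * p.2 : ℤ) : ℂ) *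
      ((a * τ + b) / (c * τ + d)) + x * (((a * qe - b * qm : ℤ) : ℂ) +
      (a * τ + b) / (c * τ + d) * ((-c * qe + d * qm : ℤ) : ℂ))) =
      (p.1 + p.2 * τ + x * (qe + τ * qm)) / (c * τ + d) := by
    rw [eq_div_iff hd]
    push_cast
    field_simp
    linear_combination (p.1 + p.2 * τ + x * (qe + τ * qm)) * hC
  have hn : Complex.normSq (c * τ + d) ≠ 0 := by simpa using hd
  rw [h1, im_moebius h, map_div₀]
  congr 3
  · generalize Complex.normSq (c * τ + d) = r at *
    field_simp
  · push_cast
    congr 1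
    linear_combination (p.1 * qm - p.2 * qe : ℂ) * hC

end Theta

/-! ### The sum over fluxes -/

section FluxSum

theorem univ_plane : (Finset.univ : Finset Plane) = {plane 0 1 (by decide), plane 2 3 (by decide),
    plane 0 2 (by decide), plane 1 3 (by decide), plane 0 3 (by decide), plane 1 2 (by decide)} := by
  decide

theorem sum_plane {M : Type*} [AddCommMonoid M] (f : Plane → M) : ∑ S, f S =
    f (plane 0 1 (by decide)) + (f (plane 2 3 (by decide)) + (f (plane 0 2 (by decide)) +
      (f (plane 1 3 (by decide)) + (f (plane 0 3 (by decide)) + f (plane 1 2 (by decide)))))) := by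
  rw [univ_plane, Finset.sum_insert (by decide), Finset.sum_insert (by decide),
    Finset.sum_insert (by decide), Finset.sum_insert (by decide), Finset.sum_insert (by decide),
    Finset.sum_singleton]

/-- Fluxes through the planes as pairs of fluxes through orthogonal planes. -/
def fluxPairs (h : Plane → ℤ) : (ℤ × ℤ) × (ℤ × ℤ) × (ℤ × ℤ) :=
  ((h (plane 0 1 (by decide)), h (plane 2 3 (by decide))),
    (h (plane 0 2 (by decide)), -h (plane 1 3 (by decide))),
    (h (plane 0 3 (by decide)), h (plane 1 2 (by decide))))

theorem fluxPairs_bijective : Function.Bijective fluxPairs := by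
  constructor
  · intro h k hk
    simp only [fluxPairs, Prod.mk.injEq, neg_inj] at hk
    obtain ⟨⟨h1, h2⟩, ⟨h3, h4⟩, h5, h6⟩ := hk
    funext S
    have hS := univ_plane ▸ Finset.mem_univ S
    simp only [Finset.mem_insert, Finset.mem_singleton] at hS
    rcases hS with rfl | rfl | rfl | rfl | rfl | rfl <;> assumption
  · rintro ⟨⟨a, b⟩, ⟨c, d⟩, e, f⟩
    refine ⟨fun S => if S = plane 0 1 (by decide) then a else if S = plane 2 3 (by decide) then b
      else if S = plane 0 2 (by decide) then c else if S = plane 1 3 (by decide) then -d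
      else if S = plane 0 3 (by decide) then e else f, ?_⟩
    have e1 : plane 2 3 (by decide) ≠ plane 0 1 (by decide) := by decide
    have e2 : plane 0 2 (by decide) ≠ plane 0 1 (by decide) := by decide
    have e3 : plane 0 2 (by decide) ≠ plane 2 3 (by decide) := by decide
    have e4 : plane 1 3 (by decide) ≠ plane 0 1 (by decide) := by decide
    have e5 : plane 1 3 (by decide) ≠ plane 2 3 (by decide) := by decide
    have e6 : plane 1 3 (by decide) ≠ plane 0 2 (by decide) := by decide
    have e7 : plane 0 3 (by decide) ≠ plane 0 1 (by decide) := by decide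
    have e8 : plane 0 3 (by decide) ≠ plane 2 3 (by decide) := by decide
    have e9 : plane 0 3 (by decide) ≠ plane 0 2 (by decide) := by decide
    have e10 : plane 0 3 (by decide) ≠ plane 1 3 (by decide) := by decide
    have e11 : plane 1 2 (by decide) ≠ plane 0 1 (by decide) := by decide
    have e12 : plane 1 2 (by decide) ≠ plane 2 3 (by decide) := by decide
    have e13 : plane 1 2 (by decide) ≠ plane 0 2 (by decide) := by decide
    have e14 : plane 1 2 (by decide) ≠ plane 1 3 (by decide) := by decide
    have e15 : plane 1 2 (by decide) ≠ plane 0 3 (by decide) := by decide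
    simp only [fluxPairs, if_true, if_neg e1, if_neg e2, if_neg e3, if_neg e4, if_neg e5, if_neg e6,
      if_neg e7, if_neg e8, if_neg e9, if_neg e10, if_neg e11, if_neg e12, if_neg e13, if_neg e14,
      if_neg e15, neg_neg]

/-- The product of the theta functions of the three pairs of orthogonal planes. -/
def fluxTheta (k : Plane → ℝ) (qe qm : ℤ) (τ : ℂ) : ℂ :=
  planeTheta (k (plane 0 1 (by decide))) (k (plane 2 3 (by decide))) qe qm τ *
    (planeTheta (k (plane 0 2 (by decide))) (-k (plane 1 3 (by decide))) qe qm τ *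
      planeTheta (k (plane 0 3 (by decide))) (k (plane 1 2 (by decide))) qe qm τ)

theorem fluxTheta_zero_ne_zero (k : Plane → ℝ) {τ : ℂ} (hτ : 0 < τ.im) : fluxTheta k 0 0 τ ≠ 0 :=
  mul_ne_zero (planeTheta_zero_ne_zero _ _ hτ)
    (mul_ne_zero (planeTheta_zero_ne_zero _ _ hτ) (planeTheta_zero_ne_zero _ _ hτ))

theorem fluxTheta_moebius {a b c d : ℤ} (h : a * d - b * c = 1) {τ : ℂ} (hτ : 0 < τ.im)
    (k : Plane → ℝ) (qe qm : ℤ) :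
    fluxTheta k (a * qe - b * qm) (-c * qe + d * qm) ((a * τ + b) / (c * τ + d)) =
      fluxTheta k qe qm τ := by
  unfold fluxTheta
  rw [planeTheta_moebius h hτ, planeTheta_moebius h hτ, planeTheta_moebius h hτ]

/-- The sign attached to the plane `13` turns the flux pairing into three hyperbolic blocks with
equal signs, so the weight is a product over pairs of orthogonal planes. -/
theorem fluxWeight_eq (qe qm : ℤ) (k : Plane → ℝ) (h : Plane → ℤ) (τ : ℂ) :
    fluxWeight (τ.im / (2 * π)) (2 * π * τ.re) qe qm k h =
      planeTerm (k (plane 0 1 (by decide))) (k (plane 2 3 (by decide))) qe qm τ (fluxPairs h).1 *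
      (planeTerm (k (plane 0 2 (by decide))) (-k (plane 1 3 (by decide))) qe qm τ
          (fluxPairs h).2.1 *
        planeTerm (k (plane 0 3 (by decide))) (k (plane 1 2 (by decide))) qe qm τ
          (fluxPairs h).2.2) := by
  have hpi := Real.pi_ne_zero
  unfold fluxWeight planeTerm
  rw [← Complex.exp_add, ← Complex.exp_add, sum_plane]
  congr 1
  simp only [fluxPairs, fluxPairing]
  generalize h (plane 0 1 (by decide)) = h01
  generalize h (plane 2 3 (by decide)) = h23
  generalize h (plane 0 2 (by decide)) = h02
  generalize h (plane 1 3 (by decide)) = h13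
  generalize h (plane 0 3 (by decide)) = h03
  generalize h (plane 1 2 (by decide)) = h12
  generalize k (plane 0 1 (by decide)) = k01
  generalize k (plane 2 3 (by decide)) = k23
  generalize k (plane 0 2 (by decide)) = k02
  generalize k (plane 1 3 (by decide)) = k13
  generalize k (plane 0 3 (by decide)) = k03
  generalize k (plane 1 2 (by decide)) = k12
  rw [sub_add_sub_comm, sub_add_sub_comm, ← neg_add, ← neg_add, ← mul_add, ← mul_add,
    ← Complex.ofReal_add, ← Complex.ofReal_add, ← Complex.ofReal_add, ← Complex.ofReal_add]
  refine congrArg₂ (fun x y : ℝ => -(x : ℂ) - I * (y : ℂ)) ?_ ?_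
  · push_cast
    field_simp
    ring
  · push_cast
    field_simp
    ring

theorem tsum_fluxWeight (qe qm : ℤ) (k : Plane → ℝ) {τ : ℂ} (hτ : 0 < τ.im) :
    ∑' h, fluxWeight (τ.im / (2 * π)) (2 * π * τ.re) qe qm k h =
      (1 / (τ.im : ℂ) ^ (1 / 2 : ℂ)) ^ 3 *
        cexp (I * ((π * ((qe + τ.re * qm) * qm) * fluxPairing k k : ℝ) : ℂ)) *
        fluxTheta k qe qm τ := by
  simp only [fluxWeight_eq]
  have hs (x y : ℝ) := summable_norm_planeTerm x y qe qm hτ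
  refine ((Equiv.ofBijective _ fluxPairs_bijective).tsum_eq (fun p =>
    planeTerm (k (plane 0 1 (by decide))) (k (plane 2 3 (by decide))) qe qm τ p.1 *
      (planeTerm (k (plane 0 2 (by decide))) (-k (plane 1 3 (by decide))) qe qm τ p.2.1 *
        planeTerm (k (plane 0 3 (by decide))) (k (plane 1 2 (by decide))) qe qm τ p.2.2))).trans ?_
  rw [← tsum_mul_tsum_of_summable_norm (hs _ _) ((hs _ _).mul_norm (hs _ _)),
    ← tsum_mul_tsum_of_summable_norm (hs _ _) (hs _ _), tsum_planeTerm _ _ _ _ hτ,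
    tsum_planeTerm _ _ _ _ hτ, tsum_planeTerm _ _ _ _ hτ]
  -- Each pair contributes `2xy`, and the three contributions make up the self-pairing of `k`.
  have h1 : cexp (I * ((π * ((qe + τ.re * qm) * qm) * fluxPairing k k : ℝ) : ℂ)) =
      cexp (I * ((2 * π * (k (plane 0 1 (by decide)) * k (plane 2 3 (by decide))) *
        ((qe + τ.re * qm) * qm) : ℝ) : ℂ)) *
      (cexp (I * ((2 * π * (k (plane 0 2 (by decide)) * -k (plane 1 3 (by decide))) *
        ((qe + τ.re * qm) * qm) : ℝ) : ℂ)) *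
      cexp (I * ((2 * π * (k (plane 0 3 (by decide)) * k (plane 1 2 (by decide))) *
        ((qe + τ.re * qm) * qm) : ℝ) : ℂ))) := by
    rw [← Complex.exp_add, ← Complex.exp_add]
    congr 1
    unfold fluxPairing
    push_cast
    ring
  rw [h1, fluxTheta]
  ring

end FluxSum

/-! ### The functions `F` in terms of theta functions -/

section DyonicFunctions

variable {N : ℕ} [NeZero N]

/-- After Poisson summation the oscillating flux sum becomes a nonzero factor times theta functions
with positive terms. -/
theorem partitionFunction_ne_zero {β : ℝ} (hβ : 0 < β) (θ : ℝ) : partitionFunction N β θ ≠ 0 := by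
  obtain ⟨C, hC, h, -⟩ := exists_pathIntegral_eq N hβ
  have hpi := Real.pi_ne_zero
  have hτ : 0 < (⟨θ / (2 * π), 2 * π * β⟩ : ℂ).im := by change 0 < 2 * π * β; positivity
  have h1 : (⟨θ / (2 * π), 2 * π * β⟩ : ℂ).im / (2 * π) = β := by
    change 2 * π * β / (2 * π) = β; field_simp
  have h2 : 2 * π * (⟨θ / (2 * π), 2 * π * β⟩ : ℂ).re = θ := by
    change 2 * π * (θ / (2 * π)) = θ; field_simp
  have h3 := tsum_fluxWeight 0 0 0 hτ
  rw [h1, h2] at h3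
  rw [h, h3]
  refine mul_ne_zero hC (mul_ne_zero (mul_ne_zero (pow_ne_zero 3 (one_div_ne_zero ?_))
    (Complex.exp_ne_zero _)) (fluxTheta_zero_ne_zero 0 hτ))
  rw [Ne, Complex.cpow_eq_zero_iff, not_and_or]
  exact Or.inl (by exact_mod_cast hτ.ne')

theorem dyonicExpectation_eq {γ : Contour N} {l : Form N 2 ℤ} (hl : IsDualSurface γ l) {τ : ℂ}
    (hτ : 0 < τ.im) (qe qm p : ℤ) :
    dyonicExpectation γ qe qm (τ.im / (2 * π)) (2 * π * τ.re) p =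
      cexp (contourExponent (τ.im / (2 * π)) (2 * π * τ.re) qe qm p l) *
        cexp (I * ((π * ((qe + τ.re * qm) * qm) *
          fluxPairing (flux (toReal l)) (flux (toReal l)) : ℝ) : ℂ)) *
        (fluxTheta (flux (toReal l)) qe qm τ / fluxTheta 0 0 0 τ) := by
  obtain ⟨C, hC, h1, h2⟩ := exists_pathIntegral_eq N (β := τ.im / (2 * π)) (by positivity)
  unfold dyonicExpectation
  rw [h2 γ l hl, h1, tsum_fluxWeight _ _ _ hτ, tsum_fluxWeight _ _ _ hτ]
  have h3 := fluxTheta_zero_ne_zero 0 hτ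
  have h4 : (τ.im : ℂ) ^ (1 / 2 : ℂ) ≠ 0 := by
    rw [Ne, Complex.cpow_eq_zero_iff, not_and_or]
    exact Or.inl (by exact_mod_cast hτ.ne')
  have h5 : cexp (I * ((π * (((0 : ℤ) + τ.re * (0 : ℤ)) * (0 : ℤ)) *
      fluxPairing (0 : Plane → ℝ) 0 : ℝ) : ℂ)) = 1 := by simp
  rw [h5]
  field_simp

theorem neg_one_cpow_ofReal (x : ℝ) : (-1 : ℂ) ^ (x : ℂ) = cexp (I * ((π * x : ℝ) : ℂ)) := by
  rw [Complex.cpow_def_of_ne_zero (by norm_num), Complex.log_neg_one]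
  congr 1
  push_cast
  ring

/-- The function `F` with characteristics `k₁/2`, `k₂/2` in terms of theta functions. -/
def dyonicTheta (l : Form N 2 ℤ) (k₁ k₂ qe qm : ℤ) (τ : ℂ) : ℂ :=
  cexp (((-(π * coexactNormSq l * Complex.normSq (qe + τ * qm) / τ.im) : ℝ) : ℂ) -
      I * π * uOf l * (qm * (qe + τ * qm))) *
    cexp (I * ((π * ((vOf l * (k₁ * qe ^ 2 + qe * qm + k₂ * qm ^ 2) : ℤ) : ℝ) : ℝ) : ℂ)) *
    (fluxTheta (flux (toReal l)) qe qm τ / fluxTheta 0 0 0 τ)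

theorem normSq_charge (qe qm : ℤ) (τ : ℂ) :
    Complex.normSq (qe + τ * qm) = (qe + τ.re * qm) ^ 2 + τ.im ^ 2 * qm ^ 2 := by
  rw [Complex.normSq_apply]
  simp only [Complex.add_re, Complex.add_im, Complex.mul_re, Complex.mul_im, Complex.intCast_re,
    Complex.intCast_im]
  ring

/-- Three simplifications occur. The phase from Poisson summation cancels the self-pairing of the
fluxes of `l`; the `θ`-dependent multiples of `v` cancel and leave `v q_e q_m`; and the prefactor in
the definition of `F` completes the `u`-term to an expression holomorphic in `τ`. -/
theorem contourExponent_eq (l : Form N 2 ℤ) (qe qm p : ℤ) {τ : ℂ} (hτ : 0 < τ.im) :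
    ((2 * π ^ 2 * uOf l * (τ.im / (2 * π)) * qm ^ 2 : ℝ) : ℂ) +
      (contourExponent (τ.im / (2 * π)) (2 * π * τ.re) qe qm p l +
      I * ((π * ((qe + τ.re * qm) * qm) *
        fluxPairing (flux (toReal l)) (flux (toReal l)) : ℝ) : ℂ)) =
    ((-(π * coexactNormSq l * Complex.normSq (qe + τ * qm) / τ.im) : ℝ) : ℂ) -
      I * π * uOf l * (qm * (qe + τ * qm)) +
      I * ((π * (vOf l * (qe * qm - p * qm ^ 2)) : ℝ) : ℂ) := by
  have hpi : (π : ℂ) ≠ 0 := by exact_mod_cast Real.pi_ne_zero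
  have ht : (τ.im : ℂ) ≠ 0 := by exact_mod_cast hτ.ne'
  have h1 : I * π * uOf l * (qm * (qe + τ * qm)) =
      I * π * uOf l * (qm * (qe + τ.re * qm)) - π * uOf l * qm ^ 2 * τ.im := by
    nth_rw 1 [← Complex.re_add_im τ]
    linear_combination (π * uOf l * qm ^ 2 * τ.im : ℂ) * I_sq
  rw [normSq_charge, h1]
  unfold contourExponent
  generalize fluxPairing (flux (toReal l)) (flux (toReal l)) = B
  generalize coexactNormSq l = w
  push_cast
  field_simp
  ring

/-- The exponent `X` of the sign and the parameter `p` matter only through a parity, which lets one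
statement cover both expressions for `F`. -/
theorem dyonicExpectation_eq_dyonicTheta {γ : Contour N} {l : Form N 2 ℤ}
    (hl : IsDualSurface γ l) {τ : ℂ} (hτ : 0 < τ.im) {k₁ k₂ p qe qm X : ℤ}
    (hX : Even (X + vOf l * (qe * qm - p * qm ^ 2) -
      vOf l * (k₁ * qe ^ 2 + qe * qm + k₂ * qm ^ 2))) :
    cexp ((2 * π ^ 2 * uOf l * (τ.im / (2 * π)) * (qm : ℝ) ^ 2 : ℝ) : ℂ) *
        (-1 : ℂ) ^ (((X : ℤ) : ℝ) : ℂ) *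
        dyonicExpectation γ qe qm (τ.im / (2 * π)) (2 * π * τ.re) p =
      dyonicTheta l k₁ k₂ qe qm τ := by
  rw [dyonicExpectation_eq hl hτ, neg_one_cpow_ofReal, dyonicTheta, ← mul_assoc]
  congr 1
  rw [← Complex.exp_add, ← Complex.exp_add, ← Complex.exp_add, add_right_comm,
    contourExponent_eq l qe qm p hτ, Complex.exp_add, Complex.exp_add, mul_assoc]
  congr 1
  rw [← Complex.exp_add, ← mul_add, ← Complex.ofReal_add]
  obtain ⟨j, hj⟩ := hX
  refine cexp_eq_of_sub (k := j) ?_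
  have : ((X : ℤ) : ℝ) + vOf l * (qe * qm - p * qm ^ 2) -
      ((vOf l * (k₁ * qe ^ 2 + qe * qm + k₂ * qm ^ 2) : ℤ) : ℝ) = j + j := by exact_mod_cast hj
  linear_combination π * this

theorem dyonicTheta_congr {l : Form N 2 ℤ} {k₁ k₂ m₁ m₂ qe qm : ℤ} (τ : ℂ)
    (h : Even (vOf l * (k₁ * qe ^ 2 + k₂ * qm ^ 2) - vOf l * (m₁ * qe ^ 2 + m₂ * qm ^ 2))) :
    dyonicTheta l k₁ k₂ qe qm τ = dyonicTheta l m₁ m₂ qe qm τ := by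
  unfold dyonicTheta
  congr 2
  obtain ⟨j, hj⟩ := h
  refine cexp_eq_of_sub (k := j) ?_
  have : ((vOf l * (k₁ * qe ^ 2 + k₂ * qm ^ 2) : ℤ) : ℝ) -
      ((vOf l * (m₁ * qe ^ 2 + m₂ * qm ^ 2) : ℤ) : ℝ) = j + j := by exact_mod_cast hj
  push_cast at this ⊢
  linear_combination π * this

/-- Modulo 2, squares of the matrix entries equal the entries and `ad + bc` is one. The product of
the new charges contributes `ac` and `bd` to the coefficients of the squares; these are the shifts
`ac/2` and `bd/2` of the characteristics. A finite check over `ZMod 2` suffices. -/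
theorem even_characteristic_sub {a b c d : ℤ} (h : a * d - b * c = 1) (k₁ k₂ qe qm : ℤ) :
    Even ((k₁ * (a * qe - b * qm) ^ 2 + (a * qe - b * qm) * (-c * qe + d * qm) +
        k₂ * (-c * qe + d * qm) ^ 2) -
      ((a * k₁ + c * k₂ + a * c) * qe ^ 2 + qe * qm + (b * k₁ + d * k₂ + b * d) * qm ^ 2)) := by
  have key : ∀ a b c d k l e m : ZMod 2, a * d - b * c = 1 →
      (k * (a * e - b * m) ^ 2 + (a * e - b * m) * (-c * e + d * m) + l * (-c * e + d * m) ^ 2) -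
        ((a * k + c * l + a * c) * e ^ 2 + e * m + (b * k + d * l + b * d) * m ^ 2) = 0 := by
    decide
  have h2 : (a * d - b * c : ZMod 2) = 1 := by exact_mod_cast congrArg (Int.cast (R := ZMod 2)) h
  rw [even_iff_two_dvd]
  refine (ZMod.intCast_zmod_eq_zero_iff_dvd _ 2).1 ?_
  have := key a b c d k₁ k₂ qe qm h2
  push_cast
  exact this

theorem dyonicTheta_moebius {a b c d : ℤ} (h : a * d - b * c = 1) {τ : ℂ} (hτ : 0 < τ.im)
    (l : Form N 2 ℤ) (k₁ k₂ qe qm : ℤ) :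
    dyonicTheta l k₁ k₂ (a * qe - b * qm) (-c * qe + d * qm) ((a * τ + b) / (c * τ + d)) =
      cexp (I * uOf l * π * (c * (qe + τ * qm) ^ 2 / (c * τ + d))) *
        dyonicTheta l (a * k₁ + c * k₂ + a * c) (b * k₁ + d * k₂ + b * d) qe qm τ := by
  have hd := denom_ne_zero h hτ
  have hn : Complex.normSq (c * τ + d) ≠ 0 := by simpa using hd
  unfold dyonicTheta
  have h0 : fluxTheta 0 0 0 ((a * τ + b) / (c * τ + d)) = fluxTheta 0 0 0 τ := by
    have := fluxTheta_moebius h hτ 0 0 0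
    simpa using this
  rw [fluxTheta_moebius h hτ, h0,
    ← mul_assoc (cexp (I * uOf l * π * (c * (qe + τ * qm) ^ 2 / (c * τ + d))))]
  congr 1
  rw [← Complex.exp_add, ← Complex.exp_add, ← Complex.exp_add]
  have h2 : Complex.normSq ((qe + τ * qm) / (c * τ + d)) / ((a * τ + b) / (c * τ + d) : ℂ).im =
      Complex.normSq (qe + τ * qm) / τ.im := by
    rw [im_moebius h, map_div₀]
    generalize Complex.normSq (c * τ + d) = r at *
    field_simp
  obtain ⟨j, hj⟩ := even_characteristic_sub h k₁ k₂ qe qm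
  rw [charge_moebius h hτ, mul_div_assoc, mul_div_assoc, h2, Complex.exp_eq_exp_iff_exists_int]
  refine ⟨vOf l * j, ?_⟩
  have hj' := congrArg (Int.cast (R := ℂ)) hj
  push_cast at hj' ⊢
  -- The product `q_m q` is invariant only up to `c q²/(cτ + d)`; this defect is the exponent of the
  -- factor of automorphy.
  have h3 : (-c * qe + d * qm) * ((qe + τ * qm) / (c * τ + d)) =
      qm * (qe + τ * qm) - c * (qe + τ * qm) ^ 2 / (c * τ + d) := by
    field_simp
    ring
  rw [h3]
  linear_combination I * π * vOf l * hj'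

theorem dyonicF_eq_dyonicTheta {γ : Contour N} {l : Form N 2 ℤ} (hl : IsDualSurface γ l) {τ : ℂ}
    (hτ : 0 < τ.im) (k₁ k₂ qe qm : ℤ) :
    dyonicF γ l ((k₁ : ℝ) / 2) ((k₂ : ℝ) / 2) ((qe : ℂ) + τ * qm, τ) =
      dyonicTheta l k₁ k₂ qe qm τ := by
  unfold dyonicF
  rw [electricCharge_eq qe qm hτ, magneticCharge_eq qe qm hτ]
  rw [← dyonicExpectation_eq_dyonicTheta hl hτ (p := k₂) (X := k₁ * vOf l * qe ^ 2)
    ⟨-(vOf l * k₂ * qm ^ 2), by ring⟩]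
  rw [mul_div_cancel₀ _ (two_ne_zero (α := ℝ)), mul_div_cancel₀ _ (two_ne_zero (α := ℝ))]
  push_cast
  rfl

end DyonicFunctions

/-! ### The modular group -/

section Modular

theorem det_eq_one (M : Matrix.SpecialLinearGroup (Fin 2) ℤ) :
    M.1 0 0 * M.1 1 1 - M.1 0 1 * M.1 1 0 = 1 := by
  rw [← Matrix.det_fin_two]; exact M.2

theorem modAct_one (z : ℂ × ℂ) : modAct 1 z = z := by
  refine Prod.ext ?_ ?_ <;> simp [modAct]

theorem modAct_im_pos (M : Matrix.SpecialLinearGroup (Fin 2) ℤ) {z : ℂ × ℂ} (hz : 0 < z.2.im) :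
    0 < (modAct M z).2.im := by
  change 0 < (((M.1 0 0 : ℂ) * z.2 + M.1 0 1) / ((M.1 1 0 : ℂ) * z.2 + M.1 1 1)).im
  rw [im_moebius (det_eq_one M)]
  exact div_pos hz (Complex.normSq_pos.2 (denom_ne_zero (det_eq_one M) hz))

theorem denom_modAct (M₁ M₂ : Matrix.SpecialLinearGroup (Fin 2) ℤ) {z : ℂ × ℂ} (hz : 0 < z.2.im) :
    ((M₁ * M₂).1 1 0 : ℂ) * z.2 + (M₁ * M₂).1 1 1 =
      ((M₁.1 1 0 : ℂ) * (modAct M₂ z).2 + M₁.1 1 1) * ((M₂.1 1 0 : ℂ) * z.2 + M₂.1 1 1) := by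
  have h2 := denom_ne_zero (det_eq_one M₂) hz
  simp only [modAct, Matrix.SpecialLinearGroup.coe_mul, Matrix.mul_apply, Fin.sum_univ_two]
  push_cast
  field_simp
  ring

theorem modAct_mul (M₁ M₂ : Matrix.SpecialLinearGroup (Fin 2) ℤ) {z : ℂ × ℂ} (hz : 0 < z.2.im) :
    modAct (M₁ * M₂) z = modAct M₁ (modAct M₂ z) := by
  have h2 := denom_ne_zero (det_eq_one M₂) hz
  have h1 := denom_ne_zero (det_eq_one M₁) (modAct_im_pos M₂ hz)
  have hd := denom_modAct M₁ M₂ hz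
  refine Prod.ext ?_ ?_
  · change z.1 / _ = (z.1 / _) / _
    rw [hd, div_div, mul_comm]
  · change (((M₁ * M₂).1 0 0 : ℂ) * z.2 + (M₁ * M₂).1 0 1) / _ = _ / _
    rw [hd, div_eq_div_iff (mul_ne_zero h1 h2) h1]
    have : ((M₁ * M₂).1 0 0 : ℂ) * z.2 + (M₁ * M₂).1 0 1 =
        ((M₁.1 0 0 : ℂ) * (modAct M₂ z).2 + M₁.1 0 1) * ((M₂.1 1 0 : ℂ) * z.2 + M₂.1 1 1) := by
      simp only [modAct, Matrix.SpecialLinearGroup.coe_mul, Matrix.mul_apply, Fin.sum_univ_two]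
      push_cast
      field_simp
      ring
    rw [this]
    ring

theorem modAct_charge (M : Matrix.SpecialLinearGroup (Fin 2) ℤ) {z : ℂ × ℂ} (hz : 0 < z.2.im)
    {qe qm : ℤ} (h : z.1 = (qe : ℂ) + z.2 * qm) :
    (modAct M z).1 = ((M.1 0 0 * qe - M.1 0 1 * qm : ℤ) : ℂ) +
      (modAct M z).2 * ((-(M.1 1 0) * qe + M.1 1 1 * qm : ℤ) : ℂ) := by
  simp only [modAct]
  rw [h]
  exact (charge_moebius (det_eq_one M) hz qe qm).symm

/-- The exponents obey an additive cocycle relation, which follows from the multiplicative one for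
`cτ + d` together with the determinant condition on `M₂`. -/
theorem autFactor_mul (u : ℝ) (M₁ M₂ : Matrix.SpecialLinearGroup (Fin 2) ℤ) {z : ℂ × ℂ}
    (hz : 0 < z.2.im) :
    autFactor u (M₁ * M₂) z = autFactor u M₁ (modAct M₂ z) * autFactor u M₂ z := by
  have h2 := denom_ne_zero (det_eq_one M₂) hz
  have h1 := denom_ne_zero (det_eq_one M₁) (modAct_im_pos M₂ hz)
  have hC : ((M₂.1 0 0 : ℂ) * M₂.1 1 1 - M₂.1 0 1 * M₂.1 1 0 : ℂ) = 1 := by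
    exact_mod_cast det_eq_one M₂
  unfold autFactor
  rw [← Complex.exp_add, ← mul_add, denom_modAct M₁ M₂ hz]
  congr 2
  have h3 : (modAct M₂ z).1 = z.1 / ((M₂.1 1 0 : ℂ) * z.2 + M₂.1 1 1) := rfl
  have h4 : (modAct M₂ z).2 * ((M₂.1 1 0 : ℂ) * z.2 + M₂.1 1 1) =
      (M₂.1 0 0 : ℂ) * z.2 + M₂.1 0 1 := div_mul_cancel₀ _ h2
  have h5 : ((M₁ * M₂).1 1 0 : ℂ) = M₁.1 1 0 * M₂.1 0 0 + M₁.1 1 1 * M₂.1 1 0 := by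
    simp [Matrix.SpecialLinearGroup.coe_mul, Matrix.mul_apply, Fin.sum_univ_two]
  rw [h3, h5]
  generalize (modAct M₂ z).2 = w at *
  field_simp
  linear_combination (M₁.1 1 0 : ℂ) * z.1 ^ 2 * (hC - M₂.1 1 0 * h4)

/-- Each of the six matrices over `ZMod 2` has an explicit integral lift of determinant one. -/
theorem redTwo_surjective : Function.Surjective redTwo := by
  have key : ∀ M : Matrix.SpecialLinearGroup (Fin 2) (ZMod 2), M = redTwo ⟨!![1, 0; 0, 1], by decide⟩ ∨
      M = redTwo ⟨!![0, -1; 1, 0], by decide⟩ ∨ M = redTwo ⟨!![1, 1; 0, 1], by decide⟩ ∨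
      M = redTwo ⟨!![1, 0; 1, 1], by decide⟩ ∨ M = redTwo ⟨!![1, -1; 1, 0], by decide⟩ ∨
      M = redTwo ⟨!![0, -1; 1, 1], by decide⟩ := by decide
  intro M
  rcases key M with h | h | h | h | h | h <;> exact ⟨_, h.symm⟩

theorem charAct_one (a : ZMod 2 × ZMod 2) : charAct 1 a = a := by
  revert a; decide

theorem charAct_mul (M₁ M₂ : Matrix.SpecialLinearGroup (Fin 2) (ZMod 2)) (a : ZMod 2 × ZMod 2) :
    charAct (M₁ * M₂) a = charAct M₂ (charAct M₁ a) := by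
  revert M₁ M₂ a; decide

theorem charAct_ne (M : Matrix.SpecialLinearGroup (Fin 2) (ZMod 2)) {a : ZMod 2 × ZMod 2}
    (h : a ≠ (1, 1)) : charAct M a ≠ (1, 1) := by
  revert M a; decide

theorem card_SL_two : Fintype.card (Matrix.SpecialLinearGroup (Fin 2) (ZMod 2)) = 6 := by decide

/-- The action on the characteristics other than `(½, ½)`. -/
def charPerm : Matrix.SpecialLinearGroup (Fin 2) (ZMod 2) →*
    Equiv.Perm {a : ZMod 2 × ZMod 2 // a ≠ (1, 1)} where
  toFun M :=
    -- `charAct` is a right action, so the inverse is needed to obtain a homomorphism.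
    { toFun := fun a => ⟨charAct M⁻¹ a, charAct_ne _ a.2⟩
      invFun := fun a => ⟨charAct M a, charAct_ne _ a.2⟩
      left_inv := fun a => Subtype.ext (by
        change charAct M (charAct M⁻¹ a) = a
        rw [← charAct_mul, inv_mul_cancel, charAct_one])
      right_inv := fun a => Subtype.ext (by
        change charAct M⁻¹ (charAct M a) = a
        rw [← charAct_mul, mul_inv_cancel, charAct_one]) }
  map_one' := Equiv.ext fun a => Subtype.ext (by
    change charAct 1⁻¹ a = a
    rw [inv_one, charAct_one])
  map_mul' M₁ M₂ := Equiv.ext fun a => Subtype.ext (by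
    change charAct (M₁ * M₂)⁻¹ a = charAct M₁⁻¹ (charAct M₂⁻¹ a)
    rw [mul_inv_rev, charAct_mul])

theorem charPerm_injective : Function.Injective charPerm := by
  have key : ∀ M : Matrix.SpecialLinearGroup (Fin 2) (ZMod 2),
      (∀ a : ZMod 2 × ZMod 2, a ≠ (1, 1) → charAct M⁻¹ a = a) → M = 1 := by decide
  rw [injective_iff_map_eq_one]
  intro M hM
  exact key M fun a ha => congrArg Subtype.val (congrArg (fun σ => σ ⟨a, ha⟩) hM)

theorem charPerm_bijective : Function.Bijective charPerm := by
  rw [Fintype.bijective_iff_injective_and_card]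
  refine ⟨charPerm_injective, ?_⟩
  rw [card_SL_two, Fintype.card_perm]
  decide

theorem card_charSubtype : Fintype.card {a : ZMod 2 × ZMod 2 // a ≠ (1, 1)} = 3 := by decide

theorem charAct_orbit (a : ZMod 2 × ZMod 2) : {b | ∃ M, b = charAct (redTwo M) a} =
      if a = (1, 1) then {(1, 1)} else {(0, 0), (0, 1), (1, 0)} := by
  have key : ∀ a b : ZMod 2 × ZMod 2, (∃ M, b = charAct M a) ↔
      if a = (1, 1) then b = (1, 1) else b = (0, 0) ∨ b = (0, 1) ∨ b = (1, 0) := by decide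
  ext b
  have h : (∃ M, b = charAct (redTwo M) a) ↔ ∃ M, b = charAct M a :=
    ⟨fun ⟨M, h⟩ => ⟨_, h⟩, fun ⟨M, h⟩ => by
      obtain ⟨M', rfl⟩ := redTwo_surjective M
      exact ⟨M', h⟩⟩
  rw [Set.mem_ofPred_eq, h, key]
  split_ifs <;> rfl

end Modular

/-! ### Transformation laws -/

section Transformations

variable {N : ℕ} [NeZero N] {γ : Contour N} {l : Form N 2 ℤ}

theorem dyonicF_moebius (hl : IsDualSurface γ l) {a b c d : ℤ} (h : a * d - b * c = 1) {τ : ℂ}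
    (hτ : 0 < τ.im) (k₁ k₂ qe qm : ℤ) :
    dyonicF γ l ((k₁ : ℝ) / 2) ((k₂ : ℝ) / 2)
        ((qe + τ * qm) / (c * τ + d), (a * τ + b) / (c * τ + d)) =
      cexp (I * uOf l * π * (c * (qe + τ * qm) ^ 2 / (c * τ + d))) *
        dyonicF γ l (((a * k₁ + c * k₂ + a * c : ℤ) : ℝ) / 2)
          (((b * k₁ + d * k₂ + b * d : ℤ) : ℝ) / 2) (qe + τ * qm, τ) := by
  have hτ' : 0 < ((a * τ + b) / (c * τ + d) : ℂ).im := by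
    rw [im_moebius h]
    exact div_pos hτ (Complex.normSq_pos.2 (denom_ne_zero h hτ))
  rw [← charge_moebius h hτ, dyonicF_eq_dyonicTheta hl hτ', dyonicF_eq_dyonicTheta hl hτ,
    dyonicTheta_moebius h hτ]

theorem dyonicF_congr (hl : IsDualSurface γ l) {τ : ℂ} (hτ : 0 < τ.im) {k₁ k₂ m₁ m₂ : ℤ}
    (h₁ : Even (k₁ - m₁)) (h₂ : Even (k₂ - m₂)) (qe qm : ℤ) :
    dyonicF γ l ((k₁ : ℝ) / 2) ((k₂ : ℝ) / 2) (qe + τ * qm, τ) =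
      dyonicF γ l ((m₁ : ℝ) / 2) ((m₂ : ℝ) / 2) (qe + τ * qm, τ) := by
  rw [dyonicF_eq_dyonicTheta hl hτ, dyonicF_eq_dyonicTheta hl hτ]
  refine dyonicTheta_congr τ ?_
  obtain ⟨i, hi⟩ := h₁
  obtain ⟨j, hj⟩ := h₂
  exact ⟨vOf l * (i * qe ^ 2 + j * qm ^ 2), by
    linear_combination vOf l * qe ^ 2 * hi + vOf l * qm ^ 2 * hj⟩

theorem dyonicF_congr_of_even (hl : IsDualSurface γ l) (hv : Even (vOf l)) {τ : ℂ}
    (hτ : 0 < τ.im) (k₁ k₂ m₁ m₂ qe qm : ℤ) :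
    dyonicF γ l ((k₁ : ℝ) / 2) ((k₂ : ℝ) / 2) (qe + τ * qm, τ) =
      dyonicF γ l ((m₁ : ℝ) / 2) ((m₂ : ℝ) / 2) (qe + τ * qm, τ) := by
  rw [dyonicF_eq_dyonicTheta hl hτ, dyonicF_eq_dyonicTheta hl hτ]
  refine dyonicTheta_congr τ ?_
  rw [← mul_sub]
  exact hv.mul_right _

theorem coupling_im (β θ : ℝ) : (coupling β θ).im = 2 * π * β := by
  unfold coupling
  rw [Complex.add_im, Complex.ofReal_im, zero_add, Complex.im_mul_ofReal,
    ← Complex.ofReal_ofNat, ← Complex.ofReal_mul, Complex.im_ofReal_mul, Complex.I_im, mul_one]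

theorem coupling_re (β θ : ℝ) : (coupling β θ).re = θ / (2 * π) := by
  unfold coupling
  rw [Complex.add_re, Complex.ofReal_re, Complex.re_mul_ofReal,
    ← Complex.ofReal_ofNat, ← Complex.ofReal_mul, Complex.re_ofReal_mul, Complex.I_re, mul_zero,
    zero_mul, add_zero]

theorem dyonicF_coupling {β : ℝ} (hβ : 0 < β) (θ α₁ α₂ : ℝ) (qe qm : ℤ) :
    dyonicF γ l α₁ α₂ ((qe : ℂ) + coupling β θ * qm, coupling β θ) =
      cexp ((2 * π ^ 2 * uOf l * β * (qm : ℝ) ^ 2 : ℝ) : ℂ) *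
        (-1 : ℂ) ^ ((2 * α₁ * vOf l * (qe : ℝ) ^ 2 : ℝ) : ℂ) *
        dyonicExpectation γ qe qm β θ (2 * α₂) := by
  have hpi := Real.pi_ne_zero
  have hτ : 0 < (coupling β θ).im := by rw [coupling_im]; positivity
  unfold dyonicF
  rw [electricCharge_eq qe qm hτ, magneticCharge_eq qe qm hτ]
  rw [show (coupling β θ).im / (2 * π) = β by rw [coupling_im]; field_simp,
    show 2 * π * (coupling β θ).re = θ by rw [coupling_re]; field_simp]

theorem dyonicF_coupling_zero (hl : IsDualSurface γ l) {β : ℝ} (hβ : 0 < β) (θ : ℝ)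
    (k₁ k₂ qe qm : ℤ) :
    dyonicF γ l ((k₁ : ℝ) / 2) ((k₂ : ℝ) / 2) ((qe : ℂ) + coupling β θ * qm, coupling β θ) =
      cexp ((2 * π ^ 2 * uOf l * β * (qm : ℝ) ^ 2 : ℝ) : ℂ) *
        (-1 : ℂ) ^ ((2 * ((k₁ : ℝ) / 2) * vOf l * (qe : ℝ) ^ 2 +
          2 * ((k₂ : ℝ) / 2) * vOf l * (qm : ℝ) ^ 2 : ℝ) : ℂ) *
        dyonicExpectation γ qe qm β θ 0 := by
  have hpi := Real.pi_ne_zero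
  have hτ : 0 < (coupling β θ).im := by rw [coupling_im]; positivity
  have h1 : (coupling β θ).im / (2 * π) = β := by rw [coupling_im]; field_simp
  have h2 : 2 * π * (coupling β θ).re = θ := by rw [coupling_re]; field_simp
  have h3 := dyonicExpectation_eq_dyonicTheta hl hτ (k₁ := k₁) (k₂ := k₂) (p := 0) (qe := qe)
    (qm := qm) (X := k₁ * vOf l * qe ^ 2 + k₂ * vOf l * qm ^ 2) ⟨0, by ring⟩
  rw [h1, h2] at h3
  rw [dyonicF_eq_dyonicTheta hl hτ, ← h3]
  rw [mul_div_cancel₀ _ (two_ne_zero (α := ℝ)), mul_div_cancel₀ _ (two_ne_zero (α := ℝ))]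
  push_cast
  rfl

/-- The general transformation law produces integer characteristics; they may be replaced by their
representatives 0 and 1 because only their parity matters. -/
theorem dyonicFChar_modAct (hl : IsDualSurface γ l) (M : Matrix.SpecialLinearGroup (Fin 2) ℤ)
    (x : ZMod 2 × ZMod 2) {τ : ℂ} (hτ : 0 < τ.im) (qe qm : ℤ) :
    dyonicFChar γ l x (modAct M (qe + τ * qm, τ)) =
      autFactor (uOf l) M (qe + τ * qm, τ) *
        dyonicFChar γ l (charAct (redTwo M) x) (qe + τ * qm, τ) := by
  have hval (y : ZMod 2) : ((y.val : ℤ) : ZMod 2) = y := by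
    rw [Int.cast_natCast, ZMod.natCast_zmod_val]
  have h := dyonicF_moebius hl (det_eq_one M) hτ x.1.val x.2.val qe qm
  have hM (i j : Fin 2) : ((M.1 i j : ℤ) : ZMod 2) = (redTwo M).1 i j := rfl
  unfold dyonicFChar
  have he (y : ZMod 2) (m : ℤ) (hm : (m : ZMod 2) = y) : Even (m - (y.val : ℤ)) := by
    rw [even_iff_two_dvd]
    refine (ZMod.intCast_zmod_eq_zero_iff_dvd _ 2).1 ?_
    rw [Int.cast_sub, hval, hm, sub_self]
  rw [dyonicF_congr hl hτ (m₁ := (charAct (redTwo M) x).1.val)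
    (m₂ := (charAct (redTwo M) x).2.val) (he _ _ (by push_cast [hval, hM]; rfl))
    (he _ _ (by push_cast [hval, hM]; rfl))] at h
  simp only [Int.cast_natCast] at h
  exact h

end Transformations

end

end LatticeMaxwell

/-! ### Assembly of the theorem -/

theorem mainTheorem1 (N : ℕ) [NeZero N] (γ : Contour N) (hγ : γ.IsContractible) :
    -- the path integrals converge and the partition function does not vanish
    (∀ β θ : ℝ, 0 < β →
      PathIntegralConverges (N := N) (partitionWeight β θ) ∧ partitionFunction N β θ ≠ 0 ∧
      ∀ (qe qm : ℤ) (p : ℝ), PathIntegralConverges (dyonicWeight γ qe qm β θ p)) ∧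
    -- the 2-form `l` exists, and `u` and the parity of `v` depend on the contour only
    (∃ l : Form N 2 ℤ, IsDualSurface γ l) ∧
    (∀ l l' : Form N 2 ℤ, IsDualSurface γ l → IsDualSurface γ l' →
      uOf l = uOf l' ∧ vOf l ≡ vOf l' [ZMOD 2]) ∧
    (∀ l : Form N 2 ℤ, IsDualSurface γ l →
      -- the two expressions for `F`
      (∀ (α₁ α₂ : ℝ), IsHalfInt α₁ → IsHalfInt α₂ → ∀ (β θ : ℝ), 0 < β → ∀ qe qm : ℤ,
        dyonicF γ l α₁ α₂ ((qe : ℂ) + coupling β θ * qm, coupling β θ) =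
          Complex.exp ((2 * Real.pi ^ 2 * uOf l * β * (qm : ℝ) ^ 2 : ℝ) : ℂ) *
            (-1 : ℂ) ^ ((2 * α₁ * vOf l * (qe : ℝ) ^ 2 : ℝ) : ℂ) *
            dyonicExpectation γ qe qm β θ (2 * α₂) ∧
        dyonicF γ l α₁ α₂ ((qe : ℂ) + coupling β θ * qm, coupling β θ) =
          Complex.exp ((2 * Real.pi ^ 2 * uOf l * β * (qm : ℝ) ^ 2 : ℝ) : ℂ) *
            (-1 : ℂ) ^ ((2 * α₁ * vOf l * (qe : ℝ) ^ 2 + 2 * α₂ * vOf l * (qm : ℝ) ^ 2 : ℝ) : ℂ) *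
            dyonicExpectation γ qe qm β θ 0) ∧
      -- the `S`- and `T`-transformations
      (∀ (α₁ α₂ : ℝ), IsHalfInt α₁ → IsHalfInt α₂ → ∀ τ : ℂ, 0 < τ.im → ∀ qe qm : ℤ, ∀ q : ℂ,
        q = (qe : ℂ) + τ * qm →
        dyonicF γ l α₁ α₂ (q / τ, -1 / τ) =
          Complex.exp (Complex.I * uOf l * Real.pi * (q ^ 2 / τ)) *
            dyonicF γ l α₂ (-α₁) (q, τ) ∧
        dyonicF γ l α₁ α₂ (q, τ + 1) = dyonicF γ l α₁ (α₁ + α₂ + 1 / 2) (q, τ)) ∧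
      -- the characteristics matter modulo `ℤ` only
      (∀ (α₁ α₂ : ℝ), IsHalfInt α₁ → IsHalfInt α₂ → ∀ τ : ℂ, 0 < τ.im → ∀ qe qm : ℤ, ∀ q : ℂ,
        q = (qe : ℂ) + τ * qm → ∀ k₁ k₂ : ℤ,
        dyonicF γ l (α₁ + k₁) (α₂ + k₂) (q, τ) = dyonicF γ l α₁ α₂ (q, τ)) ∧
      -- the transformation under a general element of `SL(2,ℤ)`
      (∀ (M : Matrix.SpecialLinearGroup (Fin 2) ℤ) (a : ZMod 2 × ZMod 2) (τ : ℂ), 0 < τ.im →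
        ∀ qe qm : ℤ, ∀ q : ℂ, q = (qe : ℂ) + τ * qm →
        dyonicFChar γ l a (modAct M (q, τ)) =
          autFactor (uOf l) M (q, τ) * dyonicFChar γ l (charAct (redTwo M) a) (q, τ)) ∧
      -- for even `v` the characteristics do not matter
      (Even (vOf l) → ∀ (α₁ α₂ : ℝ), IsHalfInt α₁ → IsHalfInt α₂ → ∀ τ : ℂ, 0 < τ.im →
        ∀ qe qm : ℤ, ∀ q : ℂ, q = (qe : ℂ) + τ * qm →
        dyonicF γ l α₁ α₂ (q, τ) = dyonicF γ l 0 0 (q, τ))) ∧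
    -- `SL(2,ℤ)` acts on `(q, τ)`, by integral transformations of the charges
    (∀ z : ℂ × ℂ, 0 < z.2.im →
      modAct 1 z = z ∧
      ∀ M : Matrix.SpecialLinearGroup (Fin 2) ℤ,
        0 < (modAct M z).2.im ∧
        (∀ M' : Matrix.SpecialLinearGroup (Fin 2) ℤ,
          modAct (M' * M) z = modAct M' (modAct M z)) ∧
        ∀ qe qm : ℤ, z.1 = (qe : ℂ) + z.2 * qm →
          (modAct M z).1 = ((M.1 0 0 * qe - M.1 0 1 * qm : ℤ) : ℂ) +
            (modAct M z).2 * ((-(M.1 1 0) * qe + M.1 1 1 * qm : ℤ) : ℂ)) ∧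
    -- the factor of automorphy
    (∀ (u : ℝ) (M₁ M₂ : Matrix.SpecialLinearGroup (Fin 2) ℤ) (z : ℂ × ℂ), 0 < z.2.im →
      autFactor u (M₁ * M₂) z = autFactor u M₁ (modAct M₂ z) * autFactor u M₂ z) ∧
    -- the action on characteristics factors through `SL(2,ℤ₂) ≅ 𝔖₃`
    Function.Surjective redTwo ∧
    (∀ a, charAct 1 a = a) ∧
    (∀ M₁ M₂ a, charAct (M₁ * M₂) a = charAct M₂ (charAct M₁ a)) ∧
    Nonempty (Matrix.SpecialLinearGroup (Fin 2) (ZMod 2) ≃* Equiv.Perm (Fin 3)) ∧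
    (∃ φ : Matrix.SpecialLinearGroup (Fin 2) (ZMod 2) ≃*
        Equiv.Perm {a : ZMod 2 × ZMod 2 // a ≠ (1, 1)},
      ∀ M a, (φ M a : ZMod 2 × ZMod 2) = charAct M⁻¹ a) ∧
    -- the two orbits of `SL(2,ℤ)`
    (∀ a : ZMod 2 × ZMod 2, {b | ∃ M, b = charAct (redTwo M) a} =
      if a = (1, 1) then {(1, 1)} else {(0, 0), (0, 1), (1, 0)}) := by
  refine ⟨fun β θ hβ => ⟨partitionWeight_converges hβ θ, partitionFunction_ne_zero hβ θ,
      fun qe qm p => dyonicWeight_converges γ qe qm hβ θ p⟩,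
    exists_isDualSurface γ hγ, fun l l' h h' => uOf_eq_and_vOf_modEq h h', fun l hl =>
      ⟨?_, ?_, ?_, ?_, ?_⟩,
    fun z hz => ⟨modAct_one z, fun M => ⟨modAct_im_pos M hz, fun M' => modAct_mul M' M hz,
      fun qe qm h => modAct_charge M hz h⟩⟩,
    fun u M₁ M₂ z hz => autFactor_mul u M₁ M₂ hz, redTwo_surjective, charAct_one, charAct_mul,
    ⟨(MulEquiv.ofBijective charPerm charPerm_bijective).trans
      (Fintype.equivFinOfCardEq card_charSubtype).permCongrHom⟩,
    ⟨MulEquiv.ofBijective charPerm charPerm_bijective, fun M a => rfl⟩, charAct_orbit⟩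
  · rintro _ _ ⟨k₁, rfl⟩ ⟨k₂, rfl⟩ β θ hβ qe qm
    exact ⟨dyonicF_coupling hβ θ _ _ qe qm, dyonicF_coupling_zero hl hβ θ k₁ k₂ qe qm⟩
  · rintro _ _ ⟨k₁, rfl⟩ ⟨k₂, rfl⟩ τ hτ qe qm _ rfl
    constructor
    -- The generator `S`; here `ac = bd = 0`, so the characteristics are only exchanged, with one
    -- sign.
    · have h := dyonicF_moebius hl (a := 0) (b := -1) (c := 1) (d := 0) (by norm_num) hτ k₁ k₂ qe qm
      simp only [Int.cast_zero, Int.cast_one, Int.cast_neg, zero_mul, one_mul, add_zero, zero_add,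
        neg_mul, mul_zero, neg_div] at h
      simpa only [neg_div] using h
    -- The generator `T`; the shift by one half comes from `bd = 1`, and `c = 0` makes the factor of
    -- automorphy trivial.
    · have h := dyonicF_moebius hl (a := 1) (b := 1) (c := 0) (d := 1) (by norm_num) hτ k₁ k₂ qe qm
      simp only [Int.cast_zero, Int.cast_one, zero_mul, one_mul, add_zero, zero_add,
        mul_zero, div_one, Complex.exp_zero] at h
      rw [h]
      congr 1
      push_cast
      ring
  · rintro _ _ ⟨k₁, rfl⟩ ⟨k₂, rfl⟩ τ hτ qe qm _ rfl j₁ j₂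
    have h := dyonicF_congr hl hτ (k₁ := k₁ + 2 * j₁) (m₁ := k₁) (k₂ := k₂ + 2 * j₂) (m₂ := k₂)
      ⟨j₁, by ring⟩ ⟨j₂, by ring⟩ qe qm
    rw [← h]
    congr 1 <;> push_cast <;> ring
  · rintro M a τ hτ qe qm _ rfl
    exact dyonicFChar_modAct hl M a hτ qe qm
  · rintro hv _ _ ⟨k₁, rfl⟩ ⟨k₂, rfl⟩ τ hτ qe qm _ rfl
    simpa using dyonicF_congr_of_even hl hv hτ k₁ k₂ 0 0 qe qm
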